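/- Let $n\ge 1$. Let $dV$ be Lebesgue measure on $\mathbb{C}^n$ normalized so that $\int_{\mathbb{C}^n} e^{-|z|^2}\,dV(z)=1$. For $0<p<\infty$ and real $\alpha$, let $F^p_\alpha$ be the space of all entire functions $f$ on $\mathbb{C}^n$ with $$\|f\|_{F^p_\alpha}:=\Big(\int_{\mathbb{C}^n}\big|f(z)e^{-|z|^2/2}\big|^p\,\frac{dV(z)}{(1+|z|)^{\alpha}}\Big)^{1/p}<\infty .$$ For an entire function $f$ with homogeneous expansion $f=\sum_{k\ge0}f_k$ ($f_k$ a homogeneous polynomial of degree $k$) and real $s$, put $f_s^-=\sum_{k\le|s|}f_k$ and $f_s^+=f-f_s^-$. For real $\sigma$ put $$(\psi,\varphi)_\sigma=\int_{\mathbb{C}^n}\psi(z)\overline{\varphi(z)}e^{-|z|^2}\,\frac{dV(z)}{|z|^\sigma},\qquad \langle f,g\rangle_\sigma=\begin{cases}(f,g)_\sigma & \text{if }\sigma<2n,\\ (f_{\sigma/2}^-,g_{\sigma/2}^-)_0+(f_{\sigma/2}^+,g_{\sigma/2}^+)_\sigma & \text{if }\sigma\ge 2n.\end{cases}$$ **Theorem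 5.5.** Let $1<p<\infty$, let $q$ be the conjugate exponent, $1/p+1/q=1$, and let $\alpha,\beta$ be real numbers. Then $(F^p_{\alpha p})^*=F^q_{\beta q}$, with equivalent norms, under the pairing $\langle\cdot,\cdot\rangle_{\alpha+\beta}$. That is: for all $f\in F^p_{\alpha p}$ and $g\in F^q_{\beta q}$ the integrals that define $\langle f,g\rangle_{\alpha+\beta}$ converge absolutely; the map $g\mapsto\langle\cdot,g\rangle_{\alpha+\beta}$ is a conjugate-linear bijection of $F^q_{\beta q}$ onto the space $(F^p_{\alpha p})^*$ of bounded linear functionals on $F^p_{\alpha p}$; and there is a constant $C>0$, depending only on $n,p,\alpha,\beta$, such that $$C^{-1}\|g\|_{F^q_{\beta q}}\le\big\|\langle\cdot,g\rangle_{\alpha+\beta}\big\|_{(F^p_{\alpha p})^*}\le C\|g\|_{F^q_{\beta q}}\qquad\text{for all } g\in F^q_{\beta q}.$$ -/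

import Mathlib

open MeasureTheory

noncomputable section

namespace Fock

/-- The volume measure `dV` on `ℂⁿ`, normalized so that `∫ exp (-|z|²) dV(z) = 1`
(see `integral_exp_neg_sq`). -/
def V (n : ℕ) : Measure (EuclideanSpace ℂ (Fin n)) :=
  ENNReal.ofReal (Real.pi ^ n)⁻¹ • (volume : Measure (EuclideanSpace ℂ (Fin n)))

theorem integral_exp_neg_sq (n : ℕ) : ∫ z, Real.exp (-‖z‖ ^ 2) ∂(V n) = 1 := by
  have h := GaussianFourier.integral_rexp_neg_mul_sq_norm
    (V := EuclideanSpace ℂ (Fin n)) (b := 1) one_pos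
  have hd : Module.finrank ℝ (EuclideanSpace ℂ (Fin n)) = 2 * n := by
    rw [(WithLp.linearEquiv 2 ℝ (Fin n → ℂ)).finrank_eq, Module.finrank_pi_fintype]
    simp [Complex.finrank_real_complex, mul_comm]
  rw [hd] at h
  have he : ((2 * n : ℕ) : ℝ) / 2 = (n : ℝ) := by push_cast; ring
  rw [he, Real.rpow_natCast, div_one] at h
  have hp : (0 : ℝ) < Real.pi ^ n := by positivity
  rw [V, integral_smul_measure, ENNReal.toReal_ofReal (by positivity)]
  simp only [neg_mul, one_mul] at h
  rw [h, smul_eq_mul, inv_mul_cancel₀ hp.ne']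

/-- The weighted measure `dV_α(z) = dV(z) / (1 + |z|)^α`. -/
def Vw (n : ℕ) (α : ℝ) : Measure (EuclideanSpace ℂ (Fin n)) :=
  (V n).withDensity fun z => ENNReal.ofReal ((1 + ‖z‖) ^ (-α))

/-- The weighted measure `dW_α(z) = dV(z) / |z|^α`. -/
def W (n : ℕ) (α : ℝ) : Measure (EuclideanSpace ℂ (Fin n)) :=
  (V n).withDensity fun z => ENNReal.ofReal (‖z‖ ^ (-α))

/-- The function `ψ(z) exp (-|z|²/2)`. -/
def gauss {n : ℕ} (ψ : EuclideanSpace ℂ (Fin n) → ℂ) : EuclideanSpace ℂ (Fin n) → ℂ :=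
  fun z => ψ z * (Real.exp (-‖z‖ ^ 2 / 2) : ℂ)

/-- The entire functions `f` on `ℂⁿ` with `∫ |f(z) exp (-|z|²/2)|^p dV_α(z) < ∞`,
as a vector space of functions (meant for `0 < p < ∞`). -/
def carrier (n : ℕ) (p α : ℝ) : Submodule ℂ (EuclideanSpace ℂ (Fin n) → ℂ) where
  carrier := {f | Differentiable ℂ f ∧ MemLp (gauss f) (ENNReal.ofReal p) (Vw n α)}
  zero_mem' := by
    refine ⟨differentiable_const 0, ?_⟩
    have h : gauss (0 : EuclideanSpace ℂ (Fin n) → ℂ) = 0 := by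
      funext z; simp [gauss]
    rw [h]
    exact MemLp.zero
  add_mem' := by
    rintro f g ⟨hf, hf'⟩ ⟨hg, hg'⟩
    refine ⟨hf.add hg, ?_⟩
    have h : gauss (f + g) = gauss f + gauss g := by
      funext z; simp [gauss, add_mul]
    rw [h]
    exact hf'.add hg'
  smul_mem' := by
    rintro c f ⟨hf, hf'⟩
    refine ⟨hf.const_smul c, ?_⟩
    have h : gauss (c • f) = c • gauss f := by
      funext z; simp [gauss, mul_assoc]
    rw [h]
    exact hf'.const_smul c

/-- The weighted Fock space `F^p_α(ℂⁿ)`. This is a type of its own, so that its topology is the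
one of its norm (defined below), not that of pointwise convergence. -/
def FockSpace (n : ℕ) (p α : ℝ) : Type := carrier n p α

namespace FockSpace

variable {n : ℕ} {p α : ℝ}

instance : AddCommGroup (FockSpace n p α) := inferInstanceAs (AddCommGroup (carrier n p α))

instance : Module ℂ (FockSpace n p α) := inferInstanceAs (Module ℂ (carrier n p α))

instance : CoeFun (FockSpace n p α) fun _ => EuclideanSpace ℂ (Fin n) → ℂ := ⟨fun f => f.1⟩

instance [h : Fact (1 < p)] : Fact (1 ≤ ENNReal.ofReal p) :=
  ⟨ENNReal.one_le_ofReal.2 h.out.le⟩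

/-- The embedding of `F^p_α` in an `L^p` space, `f ↦ f exp (-|·|²/2) ∈ L^p(dV_α)`. -/
def toLp (n : ℕ) (p α : ℝ) :
    FockSpace n p α →ₗ[ℂ] Lp ℂ (ENNReal.ofReal p) (Vw n α) where
  toFun f := MemLp.toLp (gauss f) f.2.2
  map_add' f g := by
    rw [← MemLp.toLp_add]
    congr 1
    funext z
    exact add_mul (f z) (g z) _
  map_smul' c f := by
    rw [RingHom.id_apply, ← MemLp.toLp_const_smul]
    congr 1
    funext z
    exact mul_assoc c (f z) _

theorem volume_absolutelyContinuous (n : ℕ) (α : ℝ) :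
    (volume : Measure (EuclideanSpace ℂ (Fin n))) ≪ Vw n α := by
  have h1 : (volume : Measure (EuclideanSpace ℂ (Fin n))) ≪ V n := by
    refine Measure.absolutelyContinuous_smul ?_
    have : (0 : ℝ) < (Real.pi ^ n)⁻¹ := by positivity
    simpa using this
  refine h1.trans (withDensity_absolutelyContinuous' ?_ ?_)
  · exact Measurable.aemeasurable (by fun_prop)
  · refine Filter.Eventually.of_forall fun z => ?_
    have : (0 : ℝ) < (1 + ‖z‖) ^ (-α) := by positivity
    simpa using this

theorem toLp_injective (n : ℕ) (p α : ℝ) : Function.Injective (toLp n p α) := by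
  intro f g h
  have h1 : gauss f =ᵐ[Vw n α] gauss g := (MemLp.toLp_eq_toLp_iff f.2.2 g.2.2).1 h
  have h2 := (volume_absolutelyContinuous n α).ae_le h1
  have hc : ∀ u : FockSpace n p α, Continuous (gauss u) := by
    intro u
    have := u.2.1.continuous
    unfold gauss
    fun_prop
  have h3 : gauss f = gauss g := (Continuous.ae_eq_iff_eq volume (hc f) (hc g)).1 h2
  refine Subtype.ext (funext fun z => ?_)
  have h4 := congrFun h3 z
  simp only [gauss] at h4
  exact mul_right_cancel₀ (by exact_mod_cast (Real.exp_pos _).ne') h4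

/-- The norm of `F^p_α` for `p > 1`, given by the formula in `norm_eq`. -/
instance [Fact (1 < p)] : NormedAddCommGroup (FockSpace n p α) :=
  NormedAddCommGroup.induced _ _ (toLp n p α) (toLp_injective n p α)

instance [Fact (1 < p)] : NormedSpace ℂ (FockSpace n p α) :=
  NormedSpace.induced ℂ _ _ (toLp n p α)

theorem norm_eq [hp : Fact (1 < p)] (f : FockSpace n p α) :
    ‖f‖ = (∫ z, ‖f z * (Real.exp (-‖z‖ ^ 2 / 2) : ℂ)‖ ^ p ∂(Vw n α)) ^ (1 / p) := by
  have hp0 : 0 < p := one_pos.trans hp.out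
  have h : ‖f‖ = ‖MemLp.toLp (gauss f) f.2.2‖ := rfl
  rw [h, Lp.norm_toLp, MemLp.eLpNorm_eq_integral_rpow_norm (by simpa using hp0)
    ENNReal.ofReal_ne_top f.2.2, ENNReal.toReal_ofReal hp0.le, one_div,
    ENNReal.toReal_ofReal (by positivity)]
  rfl

end FockSpace

/-- The homogeneous component `f_k` of degree `k` in the Taylor expansion `f = ∑ f_k` of an entire
function at the origin. -/
def homComp {n : ℕ} (f : EuclideanSpace ℂ (Fin n) → ℂ) (k : ℕ) :
    EuclideanSpace ℂ (Fin n) → ℂ :=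
  fun z => ((k.factorial : ℂ))⁻¹ * iteratedFDeriv ℂ k f 0 fun _ => z

/-- `f_s^- = ∑_{k ≤ |s|} f_k`. -/
def lowPart {n : ℕ} (s : ℝ) (f : EuclideanSpace ℂ (Fin n) → ℂ) : EuclideanSpace ℂ (Fin n) → ℂ :=
  fun z => ∑ k ∈ Finset.range (⌊|s|⌋₊ + 1), homComp f k z

/-- `f_s^+ = f - f_s^- = ∑_{k > |s|} f_k`. -/
def highPart {n : ℕ} (s : ℝ) (f : EuclideanSpace ℂ (Fin n) → ℂ) : EuclideanSpace ℂ (Fin n) → ℂ :=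
  fun z => f z - lowPart s f z

/-- The integrand `ψ(z) conj(φ(z)) exp (-|z|²)`. -/
def integrand {n : ℕ} (ψ φ : EuclideanSpace ℂ (Fin n) → ℂ) : EuclideanSpace ℂ (Fin n) → ℂ :=
  fun z => ψ z * (starRingEnd ℂ) (φ z) * (Real.exp (-‖z‖ ^ 2) : ℂ)

/-- `(ψ, φ)_σ = ∫ ψ conj(φ) exp (-|z|²) dW_σ`. -/
def intPairing {n : ℕ} (σ : ℝ) (ψ φ : EuclideanSpace ℂ (Fin n) → ℂ) : ℂ :=
  ∫ z, integrand ψ φ z ∂(W n σ)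

/-- The pairing `⟨f, g⟩_σ`: it is `(f, g)_σ` if `σ < 2n`, and
`(f_{σ/2}^-, g_{σ/2}^-)_0 + (f_{σ/2}^+, g_{σ/2}^+)_σ` if `σ ≥ 2n`. -/
def pairing {n : ℕ} (σ : ℝ) (f g : EuclideanSpace ℂ (Fin n) → ℂ) : ℂ :=
  if σ < 2 * n then intPairing σ f g
  else intPairing 0 (lowPart (σ / 2) f) (lowPart (σ / 2) g) +
    intPairing σ (highPart (σ / 2) f) (highPart (σ / 2) g)

/-- The integrals that define `⟨f, g⟩_σ` converge absolutely. -/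
def PairingConverges {n : ℕ} (σ : ℝ) (f g : EuclideanSpace ℂ (Fin n) → ℂ) : Prop :=
  if σ < 2 * n then Integrable (integrand f g) (W n σ)
  else Integrable (integrand (lowPart (σ / 2) f) (lowPart (σ / 2) g)) (W n 0) ∧
    Integrable (integrand (highPart (σ / 2) f) (highPart (σ / 2) g)) (W n σ)

end Fock

end

/-! ### Weighted norms, the Hölder and Young inequalities, Gaussian kernels -/

noncomputable section

namespace Fock

open Filter Topology
open scoped ENNReal NNReal

/-! Write σ = α + β. All the measures involved are rotation invariant, so homogeneous components of
different degrees are orthogonal. In degree k, polar coordinates show that passing from dV to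
dV/|z|^σ only multiplies the pairing by Γ(n+k-σ/2)/Γ(n+k). Hence ⟨·,·⟩_σ is the unweighted pairing
with its k-th component multiplied by the positive number `coef n σ k`. The separate treatment of
low degrees for σ ≥ 2n replaces this factor by 1 in finitely many degrees, among them all those
where integrability at the origin fails. The form of this used below is `pairing_kerComp`: pairing
(z·w̄)^k/k! with g returns `coef n σ k` times the conjugate of g_k(w).

Boundedness of the pairing is Hölder's inequality away from the origin and vanishing of the high
parts near it (`exists_lintegral_highSum_le`).

For surjectivity, a functional L has the candidate g₀(w) = conj L(e^{z·w̄}) for the unweighted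
pairing. It is entire, and testing L on projections of extremal functions puts it in F^q with weight
exponent -α (`exists_wnorm_transform_le`). Dividing its k-th component by `coef n σ k` should give
g, so the point is that this multiplier, of size k^{σ/2}, sends weight exponent -α to -α + σ = β
(`multBound_inv_coef`). It is factored into a fractional integration along rays, whose action on
degree k is a Beta integral, and finitely many first-order Euler operators. Through the reproducing
formula `proj_eq_self` each factor is dominated by an integral operator with Gaussian off-diagonal
decay, and `exists_wnorm_le_of_kernel` bounds these.

That g represents L is checked on the kernels e^{z·w̄} only, which suffices because a functional
vanishing on them is zero (`eq_zero_of_kerF`). Injectivity reads the components of g off the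
pairing, and the lower norm bound is the norm control of the preimage found above. -/

/-- The space `ℂⁿ` with its Euclidean norm. -/
abbrev Cn (n : ℕ) : Type := EuclideanSpace ℂ (Fin n)

variable {n : ℕ}

instance isAddHaarMeasure_V (n : ℕ) : (V n).IsAddHaarMeasure :=
  Measure.IsAddHaarMeasure.smul _ (by simp; positivity) (by simp)

/-- The norm of `F exp (-|·|²/2) (1 + |·|)^(-a)` in `L^p(dV)`, for arbitrary functions `F`. -/
def wnorm (p a : ℝ) (F : Cn n → ℂ) : ℝ≥0∞ :=
  (∫⁻ z, (‖F z‖ₑ * ENNReal.ofReal (Real.exp (-‖z‖ ^ 2 / 2) * (1 + ‖z‖) ^ (-a))) ^ p ∂(V n)) ^ (1 / p)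

/-- With the weight exponent written as a * p, the density is the p-th power of (1+|z|)^(-a). The
weight thus moves inside the power, and a and b simply add up in Hölder's inequality. -/
theorem eLpNorm_gauss {p : ℝ} (hp : 0 < p) (a : ℝ) (F : Cn n → ℂ) :
    eLpNorm (gauss F) (ENNReal.ofReal p) (Vw n (a * p)) = wnorm p a F := by
  have hp' : ENNReal.ofReal p ≠ 0 := by simpa using hp
  rw [eLpNorm_eq_lintegral_rpow_enorm_toReal hp' ENNReal.ofReal_ne_top,
    ENNReal.toReal_ofReal hp.le, wnorm, Vw,
    lintegral_withDensity_eq_lintegral_mul_non_measurable _ (by fun_prop)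
      (Eventually.of_forall fun z => ENNReal.ofReal_lt_top)]
  congr 1
  refine lintegral_congr fun z => ?_
  have h1 : (0 : ℝ) < 1 + ‖z‖ := by positivity
  have h2 : ENNReal.ofReal ((1 + ‖z‖) ^ (-(a * p))) = ENNReal.ofReal ((1 + ‖z‖) ^ (-a)) ^ p := by
    rw [ENNReal.ofReal_rpow_of_nonneg (by positivity) hp.le, ← Real.rpow_mul h1.le]
    congr 2; ring
  have h3 : ‖gauss F z‖ₑ = ‖F z‖ₑ * ENNReal.ofReal (Real.exp (-‖z‖ ^ 2 / 2)) := by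
    rw [gauss, enorm_mul, ← ofReal_norm (Complex.ofReal _), Complex.norm_real,
      Real.norm_of_nonneg (Real.exp_pos _).le]
  rw [Pi.mul_apply, h2, h3, ENNReal.ofReal_mul (Real.exp_pos _).le, ← mul_assoc,
    ENNReal.mul_rpow_of_nonneg _ (ENNReal.ofReal ((1 + ‖z‖) ^ (-a))) hp.le, mul_comm]

theorem mem_carrier {p a : ℝ} (hp : 0 < p) {F : Cn n → ℂ} (hF : Differentiable ℂ F)
    (h : wnorm p a F ≠ ∞) : F ∈ carrier n p (a * p) := by
  refine ⟨hF, ?_, ?_⟩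
  · have := hF.continuous
    exact Continuous.aestronglyMeasurable (by unfold gauss; fun_prop)
  · rw [eLpNorm_gauss hp]
    exact h.lt_top

theorem wnorm_coe {p a : ℝ} [hp : Fact (1 < p)] (f : FockSpace n p (a * p)) :
    wnorm p a f = ENNReal.ofReal ‖f‖ := by
  have h : ‖f‖ = ‖MemLp.toLp (gauss f) f.2.2‖ := rfl
  rw [h, Lp.norm_toLp, ENNReal.ofReal_toReal f.2.2.2.ne,
    eLpNorm_gauss (one_pos.trans hp.out)]

/-- An entire function of finite norm as an element of the Fock space. -/
def mkFock {p a : ℝ} [hp : Fact (1 < p)] (F : Cn n → ℂ) (hF : Differentiable ℂ F)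
    (h : wnorm p a F ≠ ∞) : FockSpace n p (a * p) :=
  ⟨F, mem_carrier (one_pos.trans hp.out) hF h⟩

@[simp] theorem mkFock_apply {p a : ℝ} [hp : Fact (1 < p)] (F : Cn n → ℂ)
    (hF : Differentiable ℂ F) (h : wnorm p a F ≠ ∞) (z : Cn n) :
    (mkFock F hF h : FockSpace n p (a * p)) z = F z := rfl

namespace FockSpace

variable {p a : ℝ}

theorem ext {f g : FockSpace n p a} (h : ∀ z, f z = g z) : f = g :=
  Subtype.ext (funext h)

theorem differentiable (f : FockSpace n p a) : Differentiable ℂ f := f.2.1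

theorem continuous (f : FockSpace n p a) : Continuous f := f.2.1.continuous

@[simp] theorem add_apply (f g : FockSpace n p a) (z : Cn n) : (f + g) z = f z + g z := rfl
@[simp] theorem sub_apply (f g : FockSpace n p a) (z : Cn n) : (f - g) z = f z - g z := rfl
@[simp] theorem smul_apply (c : ℂ) (f : FockSpace n p a) (z : Cn n) : (c • f) z = c * f z := rfl
@[simp] theorem zero_apply (z : Cn n) : (0 : FockSpace n p a) z = 0 := rfl

end FockSpace

theorem norm_le_of_wnorm_le {p a : ℝ} [hp : Fact (1 < p)] (f : FockSpace n p (a * p)) {C : ℝ}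
    (hC : 0 ≤ C) (h : wnorm p a f ≤ ENNReal.ofReal C) : ‖f‖ ≤ C := by
  rw [wnorm_coe] at h
  exact (ENNReal.ofReal_le_ofReal_iff hC).1 h

theorem wnorm_le_mul {p : ℝ} (hp : 0 < p) (a : ℝ) {F G : Cn n → ℂ} {C : ℝ≥0∞} (hC : C ≠ ∞)
    (h : ∀ z, ‖F z‖ₑ ≤ C * ‖G z‖ₑ) : wnorm p a F ≤ C * wnorm p a G := by
  have : (∫⁻ z, (‖F z‖ₑ * ENNReal.ofReal (Real.exp (-‖z‖ ^ 2 / 2) * (1 + ‖z‖) ^ (-a))) ^ p ∂(V n)) ≤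
      C ^ p * ∫⁻ z, (‖G z‖ₑ * ENNReal.ofReal (Real.exp (-‖z‖ ^ 2 / 2) * (1 + ‖z‖) ^ (-a))) ^ p
        ∂(V n) := by
    rw [← lintegral_const_mul' _ _ (by simp [hC, hp.le])]
    refine lintegral_mono fun z => ?_
    rw [← ENNReal.mul_rpow_of_nonneg _ _ hp.le, ← mul_assoc]
    gcongr
    exact h z
  unfold wnorm
  calc _ ≤ _ := ENNReal.rpow_le_rpow this (by positivity)
    _ = _ := by
      rw [ENNReal.mul_rpow_of_nonneg _ _ (by positivity), ← ENNReal.rpow_mul,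
        mul_one_div_cancel hp.ne', ENNReal.rpow_one]

/-- Hölder's inequality for the Gaussian weights. -/
theorem lintegral_mul_le_wnorm {p q : ℝ} (hpq : p.HolderConjugate q) (a b : ℝ) {F G : Cn n → ℂ}
    (hF : AEMeasurable F (V n)) (hG : AEMeasurable G (V n)) :
    ∫⁻ z, ‖F z‖ₑ * ‖G z‖ₑ * ENNReal.ofReal (Real.exp (-‖z‖ ^ 2) * (1 + ‖z‖) ^ (-(a + b))) ∂(V n) ≤
      wnorm p a F * wnorm q b G := by
  refine le_trans (le_of_eq ?_) (ENNReal.lintegral_mul_le_Lp_mul_Lq (V n) hpq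
    (f := fun z => ‖F z‖ₑ * ENNReal.ofReal (Real.exp (-‖z‖ ^ 2 / 2) * (1 + ‖z‖) ^ (-a)))
    (g := fun z => ‖G z‖ₑ * ENNReal.ofReal (Real.exp (-‖z‖ ^ 2 / 2) * (1 + ‖z‖) ^ (-b)))
    (by fun_prop) (by fun_prop))
  refine lintegral_congr fun z => ?_
  have h1 : (0 : ℝ) < 1 + ‖z‖ := by positivity
  have : Real.exp (-‖z‖ ^ 2) * (1 + ‖z‖) ^ (-(a + b)) =
      (Real.exp (-‖z‖ ^ 2 / 2) * (1 + ‖z‖) ^ (-a)) * (Real.exp (-‖z‖ ^ 2 / 2) * (1 + ‖z‖) ^ (-b)) := by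
    rw [neg_add, Real.rpow_add h1, mul_mul_mul_comm, ← Real.exp_add]
    congr 2; ring
  rw [this, ENNReal.ofReal_mul (by positivity), Pi.mul_apply]
  ring

theorem integrable_exp_neg_mul_norm_sq {c : ℝ} (hc : 0 < c) :
    Integrable (fun z : Cn n => Real.exp (-c * ‖z‖ ^ 2)) (V n) := by
  refine Integrable.smul_measure ?_ ENNReal.ofReal_ne_top
  have h := (GaussianFourier.integrable_cexp_neg_mul_sq_norm_add (V := Cn n) (b := c)
    (by simpa using hc) 0 0).norm
  refine h.congr (Eventually.of_forall fun z => ?_)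
  simp [Complex.norm_exp, ← Complex.ofReal_pow]

theorem lintegral_exp_neg_mul_norm_sq_lt_top {c : ℝ} (hc : 0 < c) :
    ∫⁻ z : Cn n, ENNReal.ofReal (Real.exp (-c * ‖z‖ ^ 2)) ∂(V n) < ∞ := by
  have := (integrable_exp_neg_mul_norm_sq (n := n) hc).lintegral_lt_top
  exact this

/-- Since (1+r)^b ≤ e^{|b|r}, it remains to absorb a linear exponent into a quadratic one by
completing the square. This pays for every polynomial or exponential loss with a small part of a
Gaussian. -/
theorem exp_mul_rpow_le (A b c : ℝ) (hc : 0 < c) :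
    ∃ C : ℝ, 0 < C ∧ ∀ r : ℝ, 0 ≤ r → Real.exp (A * r) * (1 + r) ^ b ≤ C * Real.exp (c * r ^ 2) := by
  refine ⟨Real.exp ((|A| + |b|) ^ 2 / (4 * c)), Real.exp_pos _, fun r hr => ?_⟩
  have h1 : (1 + r) ^ b ≤ Real.exp (|b| * r) := by
    calc (1 + r) ^ b ≤ (1 + r) ^ |b| :=
          Real.rpow_le_rpow_of_exponent_le (by linarith) (le_abs_self b)
      _ ≤ (Real.exp r) ^ |b| := by
          refine Real.rpow_le_rpow (by linarith) ?_ (abs_nonneg b)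
          linarith [Real.add_one_le_exp r]
      _ = _ := by rw [← Real.exp_mul, mul_comm]
  calc _ ≤ Real.exp (A * r) * Real.exp (|b| * r) := by gcongr
    _ ≤ Real.exp ((|A| + |b|) ^ 2 / (4 * c) + c * r ^ 2) := by
      rw [← Real.exp_add]
      refine Real.exp_le_exp.2 ?_
      have h2 : A * r ≤ |A| * r := by gcongr; exact le_abs_self A
      have h3 : 0 ≤ ((|A| + |b|) - 2 * c * r) ^ 2 / (4 * c) := by positivity
      have h4 : ((|A| + |b|) - 2 * c * r) ^ 2 / (4 * c) =
        (|A| + |b|) ^ 2 / (4 * c) + c * r ^ 2 - (|A| + |b|) * r := by field_simp; ring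
      linarith
    _ = _ := Real.exp_add _ _

/-- Functions of exponential type lie in all the weighted spaces. -/
theorem exists_wnorm_le_of_growth {p : ℝ} (hp : 0 < p) (a A : ℝ) :
    ∃ C : ℝ, 0 ≤ C ∧ ∀ (M : ℝ) (F : Cn n → ℂ), (∀ z, ‖F z‖ ≤ M * Real.exp (A * ‖z‖)) →
      wnorm p a F ≤ ENNReal.ofReal (C * M) := by
  have key : wnorm p a (fun z : Cn n => (Real.exp (A * ‖z‖) : ℂ)) ≠ ∞ := by
    obtain ⟨C, hC, hb⟩ := exp_mul_rpow_le A (-a) (1 / 4) (by norm_num)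
    refine ENNReal.rpow_ne_top_of_nonneg (by positivity) (ne_of_lt ?_)
    refine lt_of_le_of_lt (b := ENNReal.ofReal C ^ p *
      ∫⁻ z : Cn n, ENNReal.ofReal (Real.exp (-(p / 4) * ‖z‖ ^ 2)) ∂(V n)) ?_ ?_
    · rw [← lintegral_const_mul _ (by fun_prop)]
      refine lintegral_mono fun z => ?_
      have h1 : ‖(Real.exp (A * ‖z‖) : ℂ)‖ₑ = ENNReal.ofReal (Real.exp (A * ‖z‖)) := by
        rw [← ofReal_norm, Complex.norm_real, Real.norm_of_nonneg (Real.exp_pos _).le]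
      have h2 : ENNReal.ofReal (Real.exp (-(p / 4) * ‖z‖ ^ 2)) =
          ENNReal.ofReal (Real.exp (-(1 / 4) * ‖z‖ ^ 2)) ^ p := by
        rw [ENNReal.ofReal_rpow_of_nonneg (by positivity) hp.le, ← Real.exp_mul]
        congr 2; ring
      rw [h1, h2, ← ENNReal.mul_rpow_of_nonneg _ _ hp.le, ← ENNReal.ofReal_mul (by positivity),
        ← ENNReal.ofReal_mul (by positivity)]
      refine ENNReal.rpow_le_rpow (ENNReal.ofReal_le_ofReal ?_) hp.le
      calc Real.exp (A * ‖z‖) * (Real.exp (-‖z‖ ^ 2 / 2) * (1 + ‖z‖) ^ (-a))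
          = (Real.exp (A * ‖z‖) * (1 + ‖z‖) ^ (-a)) * Real.exp (-‖z‖ ^ 2 / 2) := by ring
        _ ≤ (C * Real.exp (1 / 4 * ‖z‖ ^ 2)) * Real.exp (-‖z‖ ^ 2 / 2) := by
          exact mul_le_mul_of_nonneg_right (hb _ (norm_nonneg z)) (Real.exp_pos _).le
        _ = _ := by rw [mul_assoc, ← Real.exp_add]; congr 2; ring
    · exact ENNReal.mul_lt_top (ENNReal.rpow_lt_top_of_nonneg hp.le ENNReal.ofReal_ne_top)
        (lintegral_exp_neg_mul_norm_sq_lt_top (by positivity))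
  refine ⟨(wnorm p a (fun z : Cn n => (Real.exp (A * ‖z‖) : ℂ))).toReal, by positivity,
    fun M F hF => ?_⟩
  have hM : 0 ≤ M := by
    have := (norm_nonneg _).trans (hF 0)
    simpa using this
  rw [ENNReal.ofReal_mul (by positivity), ENNReal.ofReal_toReal key, mul_comm]
  refine wnorm_le_mul hp a ENNReal.ofReal_ne_top fun z => ?_
  rw [← ofReal_norm, ← ofReal_norm, ← ENNReal.ofReal_mul hM, Complex.norm_real,
    Real.norm_of_nonneg (Real.exp_pos _).le]
  exact ENNReal.ofReal_le_ofReal (hF z)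

/-- Young's inequality for the convolution with an integrable function. -/
theorem lintegral_conv_rpow_le {p : ℝ} (hp : 1 < p) {ψ F : Cn n → ℝ≥0∞}
    (hψ : Measurable ψ) (hF : Measurable F) :
    ∫⁻ z, (∫⁻ w, F w * ψ (z - w) ∂(V n)) ^ p ∂(V n) ≤
      (∫⁻ z, ψ z ∂(V n)) ^ p * ∫⁻ w, F w ^ p ∂(V n) := by
  have hp0 : 0 < p := by linarith
  have hpq : p.HolderConjugate (Real.conjExponent p) := Real.HolderConjugate.conjExponent hp
  set q := Real.conjExponent p
  have hq0 : 0 < q := hpq.symm.pos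
  have hsum : 1 / p + 1 / q = 1 := by simpa using hpq.inv_add_inv_eq_one
  set I := ∫⁻ z, ψ z ∂(V n)
  have hI : ∀ z, ∫⁻ w, ψ (z - w) ∂(V n) = I := fun z => lintegral_sub_left_eq_self ψ z
  have h1 : ∀ z, (∫⁻ w, F w * ψ (z - w) ∂(V n)) ^ p ≤
      I ^ (p / q) * ∫⁻ w, F w ^ p * ψ (z - w) ∂(V n) := by
    intro z
    -- Hölder with ψ split as ψ^(1/p) · ψ^(1/q); the second factor integrates to a power of the
    -- total mass of ψ.
    have := ENNReal.lintegral_mul_le_Lp_mul_Lq (V n) hpq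
      (f := fun w => F w * ψ (z - w) ^ (1 / p)) (g := fun w => ψ (z - w) ^ (1 / q))
      (by fun_prop) (by fun_prop)
    have e1 : ∀ w, ((fun w => F w * ψ (z - w) ^ (1 / p)) * fun w => ψ (z - w) ^ (1 / q)) w =
        F w * ψ (z - w) := by
      intro w
      rw [Pi.mul_apply, mul_assoc, ← ENNReal.rpow_add_of_nonneg _ _ (by positivity) (by positivity),
        hsum, ENNReal.rpow_one]
    have e2 : ∀ w, (F w * ψ (z - w) ^ (1 / p)) ^ p = F w ^ p * ψ (z - w) := by
      intro w
      rw [ENNReal.mul_rpow_of_nonneg _ _ hp0.le, ← ENNReal.rpow_mul, one_div_mul_cancel hp0.ne',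
        ENNReal.rpow_one]
    have e3 : ∀ w, (ψ (z - w) ^ (1 / q)) ^ q = ψ (z - w) := by
      intro w
      rw [← ENNReal.rpow_mul, one_div_mul_cancel hq0.ne', ENNReal.rpow_one]
    simp only [e1, e2, e3, hI] at this
    calc _ ≤ _ := ENNReal.rpow_le_rpow this hp0.le
      _ = _ := by
        rw [ENNReal.mul_rpow_of_nonneg _ _ hp0.le, ← ENNReal.rpow_mul, ← ENNReal.rpow_mul,
          one_div_mul_cancel hp0.ne', ENNReal.rpow_one, mul_comm]
        congr 2; ring
  calc _ ≤ ∫⁻ z, I ^ (p / q) * ∫⁻ w, F w ^ p * ψ (z - w) ∂(V n) ∂(V n) := lintegral_mono h1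
    _ = I ^ (p / q) * ∫⁻ w, ∫⁻ z, F w ^ p * ψ (z - w) ∂(V n) ∂(V n) := by
      rw [lintegral_const_mul, lintegral_lintegral_swap]
      · fun_prop
      · apply Measurable.lintegral_prod_right'
          (f := fun x : Cn n × Cn n => F x.2 ^ p * ψ (x.1 - x.2))
        fun_prop
    _ = I ^ (p / q) * ∫⁻ w, F w ^ p * I ∂(V n) := by
      congr 1
      refine lintegral_congr fun w => ?_
      rw [lintegral_const_mul _ (by fun_prop), lintegral_sub_right_eq_self ψ w]
    _ = _ := by
      rw [lintegral_mul_const _ (by fun_prop), mul_comm (∫⁻ w, F w ^ p ∂(V n)), ← mul_assoc]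
      congr 1
      nth_rewrite 2 [← ENNReal.rpow_one I]
      rw [← ENNReal.rpow_add_of_nonneg _ _ (by positivity) (by positivity)]
      congr 1
      field_simp at hsum ⊢
      linarith

/-- Peetre's inequality, from the triangle inequality in one direction or the other according to the
sign of a. Moving a polynomial weight from z to w costs only a power of 1+|z-w|. -/
theorem one_add_norm_rpow_le (a : ℝ) (z w : Cn n) :
    (1 + ‖z‖) ^ (-a) ≤ (1 + ‖w‖) ^ (-a) * (1 + ‖z - w‖) ^ |a| := by
  have hz : (0 : ℝ) < 1 + ‖z‖ := by positivity
  have hw : (0 : ℝ) < 1 + ‖w‖ := by positivity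
  have hzw : (0 : ℝ) < 1 + ‖z - w‖ := by positivity
  have h1 : 1 + ‖z‖ ≤ (1 + ‖w‖) * (1 + ‖z - w‖) := by
    have : ‖z‖ ≤ ‖w‖ + ‖z - w‖ := by simpa using norm_add_le w (z - w)
    nlinarith [norm_nonneg w, norm_nonneg (z - w)]
  have h2 : 1 + ‖w‖ ≤ (1 + ‖z‖) * (1 + ‖z - w‖) := by
    have : ‖w‖ ≤ ‖z‖ + ‖z - w‖ := by
      have := norm_sub_le z (z - w); simpa using this
    nlinarith [norm_nonneg z, norm_nonneg (z - w)]
  rcases le_total 0 a with ha | ha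
  · rw [abs_of_nonneg ha, Real.rpow_neg hz.le, Real.rpow_neg hw.le]
    rw [← div_eq_inv_mul, le_div_iff₀ (by positivity), ← div_eq_inv_mul, div_le_iff₀ (by positivity),
      ← Real.mul_rpow hzw.le hz.le, mul_comm]
    exact Real.rpow_le_rpow hw.le h2 ha
  · rw [abs_of_nonpos ha, ← Real.mul_rpow hw.le hzw.le]
    exact Real.rpow_le_rpow hz.le h1 (by linarith)

/-- Integral operators whose kernel decays like a Gaussian off the diagonal are bounded between
the weighted spaces. -/
theorem exists_wnorm_le_of_kernel {p : ℝ} (hp : 1 < p) (a b : ℝ) {c : ℝ} (hc : 0 < c) :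
    ∃ C : ℝ, 0 ≤ C ∧ ∀ (K : ℝ) (F u : Cn n → ℂ), Measurable F →
      (∀ z, ‖u z‖ₑ * ENNReal.ofReal (Real.exp (-‖z‖ ^ 2 / 2)) ≤
        ENNReal.ofReal (K * (1 + ‖z‖) ^ b) * ∫⁻ w, ‖F w‖ₑ * ENNReal.ofReal
          (Real.exp (-‖w‖ ^ 2 / 2) * Real.exp (-c * ‖z - w‖ ^ 2)) ∂(V n)) →
      wnorm p (a + b) u ≤ ENNReal.ofReal (C * K) * wnorm p a F := by
  have hp0 : 0 < p := by linarith
  -- Half of the Gaussian decay absorbs the (1+|z-w|)^|a| caused by moving the weight; the other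
  -- half is the integrable convolution kernel.
  obtain ⟨C₁, hC₁, hb⟩ := exp_mul_rpow_le 0 |a| (c / 2) (by positivity)
  have hI := lintegral_exp_neg_mul_norm_sq_lt_top (n := n) (c := c / 2) (by positivity)
  set I := ∫⁻ z : Cn n, ENNReal.ofReal (Real.exp (-(c / 2) * ‖z‖ ^ 2)) ∂(V n) with hIdef
  refine ⟨C₁ * I.toReal, by positivity, fun K F u hF hu => ?_⟩
  let G : Cn n → ℝ≥0∞ := fun w =>
    ‖F w‖ₑ * ENNReal.ofReal (Real.exp (-‖w‖ ^ 2 / 2) * (1 + ‖w‖) ^ (-a))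
  let ψ : Cn n → ℝ≥0∞ := fun z => ENNReal.ofReal (Real.exp (-(c / 2) * ‖z‖ ^ 2))
  have hψ : Measurable ψ := by unfold ψ; fun_prop
  have hG : Measurable G := by unfold G; fun_prop
  -- For negative K the truncation in `ENNReal.ofReal` makes the hypothesis force u = 0.
  rcases lt_or_ge K 0 with hK | hK
  · have hu0 : ∀ z, u z = 0 := by
      intro z
      have h := hu z
      rw [ENNReal.ofReal_of_nonpos (mul_nonpos_of_nonpos_of_nonneg hK.le (by positivity)),
        zero_mul, nonpos_iff_eq_zero, mul_eq_zero] at h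
      rcases h with h | h
      · simpa using h
      · exact absurd h (by simp [Real.exp_pos])
    have : wnorm p (a + b) u = 0 := by
      simp [wnorm, hu0, hp0]
    rw [this]; exact zero_le
  have h1 : ∀ z, ‖u z‖ₑ * ENNReal.ofReal (Real.exp (-‖z‖ ^ 2 / 2) * (1 + ‖z‖) ^ (-(a + b))) ≤
      ENNReal.ofReal (C₁ * K) * ∫⁻ w, G w * ψ (z - w) ∂(V n) := by
    intro z
    have hz : (0 : ℝ) < 1 + ‖z‖ := by positivity
    rw [ENNReal.ofReal_mul (by positivity), ← mul_assoc]
    refine (mul_le_mul_left (hu z) _).trans ?_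
    rw [mul_right_comm, ← ENNReal.ofReal_mul (by positivity), mul_assoc, ← Real.rpow_add hz,
      ← lintegral_const_mul' _ _ ENNReal.ofReal_ne_top,
      ← lintegral_const_mul' _ _ ENNReal.ofReal_ne_top]
    refine lintegral_mono fun w => ?_
    have e : b + -(a + b) = -a := by ring
    simp only [e, G, ψ]
    rw [mul_left_comm, mul_left_comm (ENNReal.ofReal (C₁ * K)), mul_assoc (‖F w‖ₑ)]
    refine mul_le_mul_right ?_ _
    rw [← ENNReal.ofReal_mul (by positivity), ← ENNReal.ofReal_mul (by positivity),
      ← ENNReal.ofReal_mul (by positivity)]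
    refine ENNReal.ofReal_le_ofReal ?_
    have hbb := hb ‖z - w‖ (norm_nonneg _)
    rw [zero_mul, Real.exp_zero, one_mul] at hbb
    calc K * (1 + ‖z‖) ^ (-a) * (Real.exp (-‖w‖ ^ 2 / 2) * Real.exp (-c * ‖z - w‖ ^ 2))
        ≤ K * ((1 + ‖w‖) ^ (-a) * (C₁ * Real.exp (c / 2 * ‖z - w‖ ^ 2))) *
          (Real.exp (-‖w‖ ^ 2 / 2) * Real.exp (-c * ‖z - w‖ ^ 2)) := by
          gcongr
          exact (one_add_norm_rpow_le a z w).trans (by gcongr)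
      _ = C₁ * K * (Real.exp (-‖w‖ ^ 2 / 2) * (1 + ‖w‖) ^ (-a) *
          (Real.exp (c / 2 * ‖z - w‖ ^ 2) * Real.exp (-c * ‖z - w‖ ^ 2))) := by ring
      _ = _ := by
          rw [← Real.exp_add]
          have : c / 2 * ‖z - w‖ ^ 2 + -c * ‖z - w‖ ^ 2 = -(c / 2) * ‖z - w‖ ^ 2 := by ring
          rw [this]; ring
  have h2 : ∫⁻ z, (‖u z‖ₑ * ENNReal.ofReal (Real.exp (-‖z‖ ^ 2 / 2) * (1 + ‖z‖) ^ (-(a + b)))) ^ p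
      ∂(V n) ≤ (ENNReal.ofReal (C₁ * K) * I) ^ p * ∫⁻ w, G w ^ p ∂(V n) := by
    calc _ ≤ ∫⁻ z, ENNReal.ofReal (C₁ * K) ^ p * (∫⁻ w, G w * ψ (z - w) ∂(V n)) ^ p ∂(V n) := by
          refine lintegral_mono fun z => ?_
          rw [← ENNReal.mul_rpow_of_nonneg _ _ hp0.le]
          exact ENNReal.rpow_le_rpow (h1 z) hp0.le
      _ ≤ _ := by
          rw [lintegral_const_mul' _ _ (by simp [hp0.le]), ENNReal.mul_rpow_of_nonneg _ _ hp0.le,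
            mul_assoc]
          gcongr
          exact lintegral_conv_rpow_le hp hψ hG
  calc wnorm p (a + b) u ≤ ((ENNReal.ofReal (C₁ * K) * I) ^ p * ∫⁻ w, G w ^ p ∂(V n)) ^ (1 / p) :=
        ENNReal.rpow_le_rpow h2 (by positivity)
    _ = _ := by
        rw [ENNReal.mul_rpow_of_nonneg _ _ (by positivity), ← ENNReal.rpow_mul,
          mul_one_div_cancel hp0.ne', ENNReal.rpow_one]
        have : C₁ * I.toReal * K = C₁ * K * I.toReal := by ring
        rw [this, ENNReal.ofReal_mul (p := C₁ * K) (by positivity), ENNReal.ofReal_toReal hI.ne]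
        rfl

end Fock
end

/-! ### Rotations, the reproducing formula and point evaluations -/

noncomputable section

namespace Fock

open Filter Topology
open scoped ENNReal NNReal

variable {n : ℕ}

/-- The rotation `z ↦ e^{iθ} z`. -/
def rot (θ : ℝ) (z : Cn n) : Cn n := Complex.exp (θ * Complex.I) • z

@[simp] theorem norm_rot (θ : ℝ) (z : Cn n) : ‖rot θ z‖ = ‖z‖ := by
  rw [rot, norm_smul, Complex.norm_exp_ofReal_mul_I, one_mul]

theorem continuous_rot (θ : ℝ) : Continuous (rot θ : Cn n → Cn n) := by
  unfold rot; fun_prop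

theorem continuous_rot_uncurry : Continuous fun x : ℝ × Cn n => rot x.1 x.2 := by
  unfold rot; fun_prop

theorem measurePreserving_rot_volume (θ : ℝ) :
    MeasurePreserving (rot θ : Cn n → Cn n) volume volume := by
  let L : Cn n ≃ₗᵢ[ℝ] Cn n :=
    { toFun := rot θ
      invFun := rot (-θ)
      map_add' := fun x y => by simp [rot, smul_add]
      map_smul' := fun c x => by simp only [rot, RingHom.id_apply]; rw [smul_comm]
      left_inv := fun x => by simp [rot, smul_smul, ← Complex.exp_add]
      right_inv := fun x => by simp [rot, smul_smul, ← Complex.exp_add]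
      norm_map' := norm_rot θ }
  exact L.measurePreserving

theorem measurePreserving_rot_V (θ : ℝ) :
    MeasurePreserving (rot θ : Cn n → Cn n) (V n) (V n) :=
  (measurePreserving_rot_volume θ).smul_measure _

theorem measurePreserving_rot_W (σ θ : ℝ) :
    MeasurePreserving (rot θ : Cn n → Cn n) (W n σ) (W n σ) := by
  refine ⟨(continuous_rot θ).measurable, ?_⟩
  ext s hs
  have hm := (continuous_rot (n := n) θ).measurable
  rw [Measure.map_apply hm hs, W, withDensity_apply _ (hm hs), withDensity_apply _ hs,
    ← (measurePreserving_rot_V θ).setLIntegral_comp_preimage hs (by fun_prop)]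
  simp

instance sigmaFinite_W (σ : ℝ) : SigmaFinite (W n σ) := by
  unfold W
  infer_instance

/-- Invariance makes the integral of each rotate of H the same, and Fubini moves the average over θ
inside. On each circle the one-variable theory (mean value property, Cauchy's formula) then applies.
-/
theorem integral_eq_integral_average {μ : Measure (Cn n)} [SFinite μ]
    (hμ : ∀ θ, MeasurePreserving (rot θ) μ μ) {H : Cn n → ℂ} (hc : Continuous H)
    (hi : Integrable H μ) :
    ∫ z, H z ∂μ =
      ∫ z, ((2 * Real.pi)⁻¹ • ∫ θ in (0 : ℝ)..(2 * Real.pi), H (rot θ z)) ∂μ := by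
  have hinv : ∀ θ, ∫ z, H (rot θ z) ∂μ = ∫ z, H z ∂μ := by
    intro θ
    have h1 := (hμ θ).map_eq
    nth_rewrite 2 [← h1]
    rw [integral_map (continuous_rot θ).aemeasurable hc.aestronglyMeasurable]
  have hpi : (0 : ℝ) ≤ 2 * Real.pi := by positivity
  have hint : Integrable (Function.uncurry fun (z : Cn n) (θ : ℝ) => H (rot θ z))
      (μ.prod (volume.restrict (Set.Ioc 0 (2 * Real.pi)))) := by
    have hcont : Continuous (Function.uncurry fun (θ : ℝ) (z : Cn n) => H (rot θ z)) :=
      hc.comp continuous_rot_uncurry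
    have : Integrable (Function.uncurry fun (θ : ℝ) (z : Cn n) => H (rot θ z))
        ((volume.restrict (Set.Ioc 0 (2 * Real.pi))).prod μ) := by
      rw [integrable_prod_iff hcont.aestronglyMeasurable]
      refine ⟨Eventually.of_forall fun θ => ?_, ?_⟩
      · exact ((hμ θ).integrable_comp hc.aestronglyMeasurable).2 hi
      · have : ∀ θ, ∫ z, ‖H (rot θ z)‖ ∂μ = ∫ z, ‖H z‖ ∂μ := by
          intro θ
          have h1 := (hμ θ).map_eq
          nth_rewrite 2 [← h1]
          rw [integral_map (continuous_rot θ).aemeasurable hc.norm.aestronglyMeasurable]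
        simp only [Function.uncurry_apply_pair, this]
        exact integrable_const _
    exact this.swap
  rw [integral_smul]
  simp_rw [intervalIntegral.integral_of_le hpi]
  rw [integral_integral_swap hint]
  simp only [hinv, integral_const, smul_smul]
  simp [Real.pi_pos.le]
  rw [← mul_assoc]
  have : (Real.pi : ℂ) ≠ 0 := by exact_mod_cast Real.pi_ne_zero
  field_simp

/-- `F` is integrable against `e^{A|w| - |w|²}` for all `A`. -/
structure ExpIntegrable (F : Cn n → ℂ) : Prop where
  aestronglyMeasurable : AEStronglyMeasurable F (V n)
  integrable : ∀ A : ℝ, Integrable (fun w => ‖F w‖ * Real.exp (A * ‖w‖ - ‖w‖ ^ 2)) (V n)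

/-- Hölder against e^{A|w|}, which has finite norm for the conjugate exponent with weight exponent
-a; the two weights cancel. -/
theorem exists_lintegral_exp_le {p : ℝ} (hp : 1 < p) (a A : ℝ) :
    ∃ C : ℝ, 0 ≤ C ∧ ∀ F : Cn n → ℂ, AEMeasurable F (V n) →
      ∫⁻ w, ‖F w‖ₑ * ENNReal.ofReal (Real.exp (A * ‖w‖ - ‖w‖ ^ 2)) ∂(V n) ≤
        ENNReal.ofReal C * wnorm p a F := by
  have hpq : p.HolderConjugate (Real.conjExponent p) := Real.HolderConjugate.conjExponent hp
  obtain ⟨C, hC, h⟩ := exists_wnorm_le_of_growth (n := n) hpq.symm.pos (-a) A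
  refine ⟨C, hC, fun F hF => ?_⟩
  have h1 := h 1 (fun z => (Real.exp (A * ‖z‖) : ℂ)) (fun z => by
    rw [Complex.norm_real, Real.norm_of_nonneg (Real.exp_pos _).le, one_mul])
  have h2 := lintegral_mul_le_wnorm hpq a (-a) hF
    (G := fun z => (Real.exp (A * ‖z‖) : ℂ)) (by fun_prop)
  rw [mul_one] at h1
  rw [mul_comm]
  refine le_trans (le_of_eq ?_) (h2.trans (mul_le_mul_right h1 _))
  refine lintegral_congr fun w => ?_
  rw [← ofReal_norm (Complex.ofReal _), Complex.norm_real, Real.norm_of_nonneg (Real.exp_pos _).le,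
    mul_assoc, ← ENNReal.ofReal_mul (Real.exp_pos _).le]
  congr 2
  rw [add_neg_cancel, neg_zero, Real.rpow_zero, mul_one, ← Real.exp_add]
  congr 1

theorem ExpIntegrable.of_wnorm {p a : ℝ} (hp : 1 < p) {F : Cn n → ℂ}
    (hF : AEMeasurable F (V n)) (h : wnorm p a F ≠ ∞) : ExpIntegrable F := by
  refine ⟨hF.aestronglyMeasurable, fun A => ⟨?_, ?_⟩⟩
  · exact hF.aestronglyMeasurable.norm.mul (by fun_prop)
  · obtain ⟨C, hC, hb⟩ := exists_lintegral_exp_le (n := n) hp a A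
    refine lt_of_le_of_lt (le_trans (le_of_eq ?_) (hb F hF))
      (ENNReal.mul_lt_top ENNReal.ofReal_lt_top h.lt_top)
    refine lintegral_congr fun w => ?_
    rw [enorm_mul, enorm_norm, Real.enorm_of_nonneg (Real.exp_pos _).le]

theorem FockSpace.wnorm_ne_top {p a : ℝ} [hp : Fact (1 < p)] (f : FockSpace n p (a * p)) :
    wnorm p a f ≠ ∞ := by
  rw [wnorm_coe]; exact ENNReal.ofReal_ne_top

theorem FockSpace.expIntegrable {p a : ℝ} [hp : Fact (1 < p)] (f : FockSpace n p (a * p)) :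
    ExpIntegrable f :=
  ExpIntegrable.of_wnorm hp.out f.continuous.aemeasurable f.wnorm_ne_top

/-- The factor |w| ≤ e^{|w|} only raises A by one. Differentiating the kernel e^{z·w̄} in z
therefore never leaves this class. -/
theorem ExpIntegrable.mul_inner {F : Cn n → ℂ} (hF : ExpIntegrable F) (v : Cn n) :
    ExpIntegrable fun w => F w * inner ℂ w v := by
  have hm : AEStronglyMeasurable (fun w => F w * inner ℂ w v) (V n) :=
    hF.1.mul (by fun_prop)
  refine ⟨hm, fun A => ?_⟩
  refine ((hF.2 (A + 1)).const_mul ‖v‖).mono' (hm.norm.mul (by fun_prop)) ?_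
  refine Eventually.of_forall fun w => ?_
  rw [Real.norm_of_nonneg (by positivity), norm_mul]
  have h1 : ‖inner ℂ w v‖ ≤ ‖w‖ * ‖v‖ := norm_inner_le_norm w v
  have h2 : ‖w‖ ≤ Real.exp ‖w‖ := by linarith [Real.add_one_le_exp ‖w‖]
  have h3 : Real.exp ((A + 1) * ‖w‖ - ‖w‖ ^ 2) =
      Real.exp ‖w‖ * Real.exp (A * ‖w‖ - ‖w‖ ^ 2) := by
    rw [← Real.exp_add]; congr 1; ring
  rw [h3]
  calc ‖F w‖ * ‖inner ℂ w v‖ * Real.exp (A * ‖w‖ - ‖w‖ ^ 2)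
      ≤ ‖F w‖ * (Real.exp ‖w‖ * ‖v‖) * Real.exp (A * ‖w‖ - ‖w‖ ^ 2) := by
        gcongr; exact h1.trans (by gcongr)
    _ = _ := by ring

/-- The integral operator `F ↦ ∫ F(w) e^{z·w̄} e^{-|w|²} dV(w)`. -/
def proj (F : Cn n → ℂ) (z : Cn n) : ℂ :=
  ∫ w, F w * Complex.exp (inner ℂ w z) * (Real.exp (-‖w‖ ^ 2) : ℂ) ∂(V n)

theorem norm_exp_inner_le (w z : Cn n) : ‖Complex.exp (inner ℂ w z)‖ ≤ Real.exp (‖w‖ * ‖z‖) := by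
  rw [Complex.norm_exp]
  exact Real.exp_le_exp.2 ((Complex.re_le_norm _).trans (norm_inner_le_norm w z))

theorem norm_ofReal_exp (x : ℝ) : ‖(Real.exp x : ℂ)‖ = Real.exp x := by
  rw [Complex.norm_real, Real.norm_of_nonneg (Real.exp_pos _).le]

theorem ExpIntegrable.integrable_kernel {F : Cn n → ℂ} (hF : ExpIntegrable F) (z : Cn n) :
    Integrable (fun w => F w * Complex.exp (inner ℂ w z) * (Real.exp (-‖w‖ ^ 2) : ℂ)) (V n) := by
  refine (hF.2 ‖z‖).mono' ((hF.1.mul (by fun_prop)).mul (by fun_prop)) ?_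
  refine Eventually.of_forall fun w => ?_
  rw [norm_mul, norm_mul, norm_ofReal_exp, mul_assoc, sub_eq_add_neg, Real.exp_add]
  have := norm_exp_inner_le w z
  rw [mul_comm ‖w‖] at this
  gcongr

theorem hasFDerivAt_proj {F : Cn n → ℂ} (hF : ExpIntegrable F) (z : Cn n) :
    HasFDerivAt (proj F) (∫ w, (F w * Complex.exp (inner ℂ w z) * (Real.exp (-‖w‖ ^ 2) : ℂ)) •
      innerSL ℂ w ∂(V n)) z := by
  refine hasFDerivAt_integral_of_dominated_of_fderiv_le (s := Metric.ball z 1)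
    (F := fun z w => F w * Complex.exp (inner ℂ w z) * (Real.exp (-‖w‖ ^ 2) : ℂ))
    (F' := fun z w => (F w * Complex.exp (inner ℂ w z) * (Real.exp (-‖w‖ ^ 2) : ℂ)) • innerSL ℂ w)
    -- In ‖z‖ + 2, one unit is the radius of the ball around z and the other pays for the factor |w|
    -- produced by the derivative.
    (bound := fun w => ‖F w‖ * Real.exp ((‖z‖ + 2) * ‖w‖ - ‖w‖ ^ 2))
    (Metric.ball_mem_nhds z one_pos) ?_ (hF.integrable_kernel z) ?_ ?_ (hF.2 _) ?_
  · exact Eventually.of_forall fun y => (hF.integrable_kernel y).1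
  · exact (hF.integrable_kernel z).1.smul (innerSL ℂ).continuous.aestronglyMeasurable
  · refine Eventually.of_forall fun w y hy => ?_
    have hy' : ‖y‖ ≤ ‖z‖ + 1 := by
      have := norm_le_norm_add_norm_sub' y z
      rw [mem_ball_iff_norm] at hy
      linarith
    rw [norm_smul, norm_mul, norm_mul, norm_ofReal_exp, innerSL_apply_norm]
    have h2 : ‖w‖ ≤ Real.exp ‖w‖ := by linarith [Real.add_one_le_exp ‖w‖]
    have h3 : Real.exp ((‖z‖ + 2) * ‖w‖ - ‖w‖ ^ 2) =
        Real.exp (‖w‖ * (‖z‖ + 1)) * Real.exp (-‖w‖ ^ 2) * Real.exp ‖w‖ := by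
      rw [← Real.exp_add, ← Real.exp_add]; congr 1; ring
    rw [h3, mul_assoc, mul_assoc, mul_assoc]
    gcongr
    exact (norm_exp_inner_le w y).trans (by gcongr)
  · refine Eventually.of_forall fun w y _ => ?_
    have h1 : HasFDerivAt (fun y => (inner ℂ w y : ℂ)) (innerSL ℂ w) y :=
      (innerSL ℂ w).hasFDerivAt
    have h2 := (h1.cexp.const_mul (F w)).mul_const (Real.exp (-‖w‖ ^ 2) : ℂ)
    refine h2.congr_fderiv ?_
    rw [smul_smul, smul_smul]
    congr 1; ring

theorem fderiv_proj_apply {F : Cn n → ℂ} (hF : ExpIntegrable F) (z v : Cn n) :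
    fderiv ℂ (proj F) z v = proj (fun w => F w * inner ℂ w v) z := by
  rw [(hasFDerivAt_proj hF z).fderiv, ContinuousLinearMap.integral_apply, proj]
  · refine integral_congr_ae (Eventually.of_forall fun w => ?_)
    simp only [smul_apply, innerSL_apply_apply, smul_eq_mul]
    ring
  · have hb := (hF.2 (‖z‖ + 1))
    refine hb.mono' ((hF.integrable_kernel z).1.smul
      (innerSL ℂ).continuous.aestronglyMeasurable) ?_
    refine Eventually.of_forall fun w => ?_
    rw [norm_smul, norm_mul, norm_mul, norm_ofReal_exp, innerSL_apply_norm]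
    have h2 : ‖w‖ ≤ Real.exp ‖w‖ := by linarith [Real.add_one_le_exp ‖w‖]
    have h3 : Real.exp ((‖z‖ + 1) * ‖w‖ - ‖w‖ ^ 2) =
        Real.exp (‖w‖ * ‖z‖) * Real.exp (-‖w‖ ^ 2) * Real.exp ‖w‖ := by
      rw [← Real.exp_add, ← Real.exp_add]; congr 1; ring
    rw [h3, mul_assoc, mul_assoc, mul_assoc]
    gcongr
    exact norm_exp_inner_le w z

/-- A derivative in a fixed direction is again `proj` of a function of the same class, so induction
applies. Together with the reproducing formula this makes the elements of the Fock spaces smooth. -/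
theorem contDiff_proj {F : Cn n → ℂ} (hF : ExpIntegrable F) (m : ℕ) :
    ContDiff ℂ m (proj F) := by
  induction m generalizing F with
  | zero =>
    rw [Nat.cast_zero, contDiff_zero]
    exact continuous_iff_continuousAt.2 fun z => (hasFDerivAt_proj hF z).continuousAt
  | succ m ih =>
    rw [Nat.cast_succ, contDiff_succ_iff_fderiv]
    refine ⟨fun z => (hasFDerivAt_proj hF z).differentiableAt, fun h => absurd h (by simp), ?_⟩
    rw [contDiff_clm_apply_iff]
    intro v
    have : (fun z => fderiv ℂ (proj F) z v) = proj (fun w => F w * inner ℂ w v) :=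
      funext fun z => fderiv_proj_apply hF z v
    rw [this]
    exact ih (hF.mul_inner v)

/-- The mean value property of the entire function t ↦ h(tz) on the unit circle. -/
theorem average_eq {h : Cn n → ℂ} (hh : Differentiable ℂ h) (z : Cn n) :
    (2 * Real.pi)⁻¹ • ∫ θ in (0 : ℝ)..(2 * Real.pi), h (rot θ z) = h 0 := by
  have hd : Differentiable ℂ fun t : ℂ => h (t • z) := hh.comp (by fun_prop)
  have := (hd.diffContOnCl (s := Metric.ball 0 |1|)).circleAverage
  rw [Real.circleAverage, zero_smul] at this
  rw [← this]
  congr 1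
  refine intervalIntegral.integral_congr fun θ _ => ?_
  simp [circleMap, rot]

theorem integral_mul_exp_eq {h : Cn n → ℂ} (hh : Differentiable ℂ h)
    (hi : Integrable (fun w => h w * (Real.exp (-‖w‖ ^ 2) : ℂ)) (V n)) :
    ∫ w, h w * (Real.exp (-‖w‖ ^ 2) : ℂ) ∂(V n) = h 0 := by
  have := hh.continuous
  rw [integral_eq_integral_average measurePreserving_rot_V (by fun_prop) hi]
  have e : ∀ z : Cn n, (2 * Real.pi)⁻¹ • ∫ θ in (0 : ℝ)..(2 * Real.pi),
      h (rot θ z) * (Real.exp (-‖rot θ z‖ ^ 2) : ℂ) = h 0 * (Real.exp (-‖z‖ ^ 2) : ℂ) := by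
    intro z
    simp only [norm_rot, intervalIntegral.integral_mul_const]
    rw [← average_eq hh z, smul_mul_assoc]
  simp only [e]
  rw [integral_const_mul, integral_complex_ofReal, integral_exp_neg_sq, Complex.ofReal_one, mul_one]

/-- The reproducing formula of the Fock spaces. -/
theorem proj_eq_self {f : Cn n → ℂ} (hf : Differentiable ℂ f) (hi : ExpIntegrable f) :
    proj f = f := by
  funext z
  -- Translation by z turns the integrand into the entire function f(z+w) e^{-⟨z,w⟩} of w times
  -- e^{-|w|²}. By the mean value property its integral is the value at w = 0, namely f(z).
  have key : ∀ w : Cn n, f (z + w) * Complex.exp (inner ℂ (z + w) z) *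
      (Real.exp (-‖z + w‖ ^ 2) : ℂ) =
      (f (z + w) * Complex.exp (-inner ℂ z w)) * (Real.exp (-‖w‖ ^ 2) : ℂ) := by
    intro w
    have e1 : ((‖z + w‖ ^ 2 : ℝ) : ℂ) = inner ℂ (z + w) (z + w) := by
      rw [inner_self_eq_norm_sq_to_K]; norm_cast
    have e2 : ((‖w‖ ^ 2 : ℝ) : ℂ) = inner ℂ w w := by
      rw [inner_self_eq_norm_sq_to_K]; norm_cast
    rw [mul_assoc, mul_assoc, Complex.ofReal_exp, Complex.ofReal_exp, ← Complex.exp_add,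
      ← Complex.exp_add, Complex.ofReal_neg, Complex.ofReal_neg, e1, e2]
    congr 2
    simp only [inner_add_left, inner_add_right]
    ring
  rw [proj, ← integral_add_left_eq_self _ z]
  simp only [key]
  rw [integral_mul_exp_eq]
  · simp
  · refine (hf.comp (by fun_prop)).mul ?_
    have : Differentiable ℂ fun w : Cn n => (inner ℂ z w : ℂ) := (innerSL ℂ z).differentiable
    exact (this.neg).cexp
  · have := (hi.integrable_kernel z).comp_add_left z
    simpa only [key] using this

namespace FockSpace

variable {p a : ℝ} [hp : Fact (1 < p)]

theorem proj_eq (f : FockSpace n p (a * p)) : proj f = f :=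
  proj_eq_self f.differentiable f.expIntegrable

theorem contDiff (f : FockSpace n p (a * p)) (m : ℕ) : ContDiff ℂ m f := by
  rw [← f.proj_eq]; exact contDiff_proj f.expIntegrable m

end FockSpace

/-- Stated for arbitrary measurable F, because the completeness proof applies it to an L^p limit
that is not yet known to be holomorphic. -/
theorem exists_norm_proj_le {p : ℝ} (hp : 1 < p) (a R : ℝ) :
    ∃ C : ℝ, 0 ≤ C ∧ ∀ F : Cn n → ℂ, AEMeasurable F (V n) → ∀ z, ‖z‖ ≤ R →
      ‖proj F z‖ₑ ≤ ENNReal.ofReal C * wnorm p a F := by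
  obtain ⟨C, hC, h⟩ := exists_lintegral_exp_le (n := n) hp a R
  refine ⟨C, hC, fun F hF z hz => ?_⟩
  refine (enorm_integral_le_lintegral_enorm _).trans (le_trans (lintegral_mono fun w => ?_) (h F hF))
  rw [enorm_mul, enorm_mul, mul_assoc]
  gcongr
  rw [← ofReal_norm, ← ofReal_norm, ← ENNReal.ofReal_mul (norm_nonneg _)]
  refine ENNReal.ofReal_le_ofReal ?_
  rw [norm_ofReal_exp, sub_eq_add_neg, Real.exp_add]
  gcongr
  refine (norm_exp_inner_le w z).trans (Real.exp_le_exp.2 ?_)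
  rw [mul_comm]; gcongr

theorem exists_norm_apply_le (p a R : ℝ) [hp : Fact (1 < p)] :
    ∃ C : ℝ, 0 ≤ C ∧ ∀ (f : FockSpace n p (a * p)) (z : Cn n), ‖z‖ ≤ R → ‖f z‖ ≤ C * ‖f‖ := by
  obtain ⟨C, hC, h⟩ := exists_norm_proj_le (n := n) hp.out a R
  refine ⟨C, hC, fun f z hz => ?_⟩
  have := h f f.continuous.aemeasurable z hz
  rw [f.proj_eq, wnorm_coe, ← ENNReal.ofReal_mul hC, ← ofReal_norm] at this
  exact (ENNReal.ofReal_le_ofReal_iff (by positivity)).1 this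

/-- Point evaluation as a bounded functional. -/
def evalL (p a : ℝ) [hp : Fact (1 < p)] (z : Cn n) : FockSpace n p (a * p) →L[ℂ] ℂ :=
  LinearMap.mkContinuous
    { toFun := fun f => f z
      map_add' := fun _ _ => rfl
      map_smul' := fun _ _ => rfl }
    (exists_norm_apply_le (n := n) p a ‖z‖).choose
    fun f => (exists_norm_apply_le (n := n) p a ‖z‖).choose_spec.2 f z le_rfl

@[simp] theorem evalL_apply {p a : ℝ} [hp : Fact (1 < p)] (z : Cn n) (f : FockSpace n p (a * p)) :
    evalL p a z f = f z := rfl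

end Fock
end

/-! ### Completeness and homogeneous expansions -/

noncomputable section

namespace Fock

open Filter Topology
open scoped ENNReal NNReal ContDiff

variable {n : ℕ}

theorem FockSpace.smooth {p a : ℝ} [hp : Fact (1 < p)] (f : FockSpace n p (a * p)) :
    ContDiff ℂ ∞ f :=
  contDiff_infty.2 f.contDiff

/-- A Cauchy sequence has a limit F in L^p; with G its unweighted form, `proj G` is entire and, by
the reproducing formula, the pointwise limit of the sequence. A subsequence also converges almost
everywhere to F, so the two limits agree. Completeness is needed to sum and integrate kernels in
norm. -/
instance completeSpace_FockSpace {p a : ℝ} [hp : Fact (1 < p)] :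
    CompleteSpace (FockSpace n p (a * p)) := by
  have hp0 : 0 < p := one_pos.trans hp.out
  refine Metric.complete_of_cauchySeq_tendsto fun u hu => ?_
  have hiso : Isometry (FockSpace.toLp n p (a * p)) :=
    AddMonoidHomClass.isometry_of_norm _ fun f => rfl
  obtain ⟨F, hF⟩ := cauchySeq_tendsto_of_complete (hiso.uniformContinuous.comp_cauchySeq hu)
  let G : Cn n → ℂ := fun w => F w * (Real.exp (‖w‖ ^ 2 / 2) : ℂ)
  have hgG : ∀ w, gauss G w = F w := by
    intro w
    simp only [gauss, G]
    rw [mul_assoc, ← Complex.ofReal_mul, ← Real.exp_add]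
    simp [neg_div]
  have hgG' : gauss G = F := funext hgG
  have hGm : Measurable G := by
    have := (Lp.stronglyMeasurable F).measurable
    unfold G; fun_prop
  have hGn : wnorm p a G ≠ ⊤ := by
    rw [← eLpNorm_gauss hp0, hgG']
    exact (Lp.memLp F).2.ne
  have hGe : ExpIntegrable G := ExpIntegrable.of_wnorm hp.out hGm.aemeasurable hGn
  have hlim : Tendsto (fun k => wnorm p a (fun w => u k w - G w)) atTop (𝓝 0) := by
    have h1 : MemLp (F : Cn n → ℂ) (ENNReal.ofReal p) (Vw n (a * p)) := Lp.memLp F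
    have h2 := (Lp.tendsto_Lp_iff_tendsto_eLpNorm'' (fun k => gauss (u k)) (fun k => (u k).2.2)
      F h1).1 (by rw [Lp.toLp_coeFn]; exact hF)
    refine h2.congr fun k => ?_
    rw [← eLpNorm_gauss hp0]
    congr 1
    funext w
    rw [Pi.sub_apply, ← hgG w]
    simp only [gauss]; ring
  have hpt : ∀ z, Tendsto (fun k => u k z) atTop (𝓝 (proj G z)) := by
    intro z
    obtain ⟨C, hC, hb⟩ := exists_norm_proj_le (n := n) hp.out a ‖z‖
    rw [tendsto_iff_edist_tendsto_0]
    refine tendsto_of_tendsto_of_tendsto_of_le_of_le tendsto_const_nhds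
      (h := fun k => ENNReal.ofReal C * wnorm p a (fun w => u k w - G w)) ?_
      (fun k => zero_le) fun k => ?_
    · simpa using ENNReal.Tendsto.const_mul hlim (Or.inr ENNReal.ofReal_ne_top)
    · have h1 := hb (fun w => u k w - G w)
        ((u k).continuous.measurable.sub hGm).aemeasurable z le_rfl
      have h2 : proj (fun w => u k w - G w) z = u k z - proj G z := by
        conv_rhs => rw [← (u k).proj_eq]
        simp only [proj, sub_mul]
        exact integral_sub ((u k).expIntegrable.integrable_kernel z) (hGe.integrable_kernel z)
      rw [h2] at h1
      rwa [edist_eq_enorm_sub]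
  obtain ⟨ns, hns, hae⟩ := (tendstoInMeasure_of_tendsto_Lp hF).exists_seq_tendsto_ae
  have heq : gauss (proj G) =ᵐ[Vw n (a * p)] F := by
    have h2 : ∀ᵐ w ∂(Vw n (a * p)), ∀ k, FockSpace.toLp n p (a * p) (u k) w = gauss (u k) w :=
      ae_all_iff.2 fun k => MemLp.coeFn_toLp (u k).2.2
    filter_upwards [hae, h2] with w hw1 hw2
    refine tendsto_nhds_unique ?_ hw1
    simp only [Function.comp_apply, hw2]
    exact ((hpt w).comp hns.tendsto_atTop).mul_const _
  let g : FockSpace n p (a * p) := ⟨proj G, (contDiff_proj hGe 1).differentiable (by simp),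
    (memLp_congr_ae heq).2 (Lp.memLp F)⟩
  have hg : FockSpace.toLp n p (a * p) g = F :=
    Lp.ext ((MemLp.coeFn_toLp g.2.2).trans heq)
  refine ⟨g, ?_⟩
  rw [hiso.isEmbedding.isInducing.tendsto_nhds_iff, hg]
  exact hF

theorem homComp_smul (f : Cn n → ℂ) (k : ℕ) (t : ℂ) (z : Cn n) :
    homComp f k (t • z) = t ^ k * homComp f k z := by
  have := (iteratedFDeriv ℂ k f 0).map_smul_univ (fun _ => t) (fun _ => z)
  simp only [homComp, this, Finset.prod_const, Finset.card_univ, Fintype.card_fin, smul_eq_mul]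
  ring

theorem contDiff_homComp (f : Cn n → ℂ) (k : ℕ) : ContDiff ℂ ∞ (homComp f k) := by
  unfold homComp
  refine contDiff_const.mul ?_
  exact (ContinuousMultilinearMap.contDiff _).comp (contDiff_pi.2 fun _ => contDiff_id)

/-- On the complex line through z, f_k(z) is the k-th Taylor coefficient of t ↦ f(tz). All facts
about components are reduced to one variable in this way. -/
theorem homComp_eq_iteratedDeriv {f : Cn n → ℂ} (hf : ContDiff ℂ ∞ f) (k : ℕ) (z : Cn n) :
    homComp f k z = ((k.factorial : ℂ))⁻¹ * iteratedDeriv k (fun t : ℂ => f (t • z)) 0 := by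
  have h := (ContinuousLinearMap.toSpanSingleton ℂ z).iteratedFDeriv_comp_right hf 0
    (i := k) (by exact_mod_cast le_top)
  rw [iteratedDeriv_eq_iteratedFDeriv]
  have e : (fun t : ℂ => f (t • z)) = f ∘ ContinuousLinearMap.toSpanSingleton ℂ z := by
    funext t; simp
  rw [e, h, homComp]
  simp

theorem differentiable_slice {f : Cn n → ℂ} (hf : ContDiff ℂ ∞ f) (z : Cn n) :
    Differentiable ℂ fun t : ℂ => f (t • z) :=
  (hf.differentiable (by simp)).comp (by fun_prop)

theorem hasSum_homComp_smul {f : Cn n → ℂ} (hf : ContDiff ℂ ∞ f) (z : Cn n) (t : ℂ) :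
    HasSum (fun k => t ^ k * homComp f k z) (f (t • z)) := by
  have := Complex.hasSum_taylorSeries_of_entire (differentiable_slice hf z) 0 t
  convert! this using 2 with k
  rw [homComp_eq_iteratedDeriv hf, sub_zero, smul_eq_mul, smul_eq_mul]
  ring

theorem hasSum_homComp {f : Cn n → ℂ} (hf : ContDiff ℂ ∞ f) (z : Cn n) :
    HasSum (fun k => homComp f k z) (f z) := by
  simpa using hasSum_homComp_smul hf z 1

/-- Uniqueness of power series on the line through z. This is the tool for computing components of
sums, truncations, kernels and images of operators. -/
theorem homComp_eq_of_hasSum {f : Cn n → ℂ} (hf : ContDiff ℂ ∞ f) {z : Cn n} {c : ℕ → ℂ}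
    (h : ∀ t : ℂ, HasSum (fun k => t ^ k * c k) (f (t • z))) (k : ℕ) : homComp f k z = c k := by
  have h1 : HasFPowerSeriesAt (fun t : ℂ => f (t • z))
      (FormalMultilinearSeries.ofScalars ℂ fun k => homComp f k z) 0 :=
    hasFPowerSeriesAt_iff.2 (Eventually.of_forall fun t => by
      simpa [FormalMultilinearSeries.coeff_ofScalars] using hasSum_homComp_smul hf z t)
  have h2 : HasFPowerSeriesAt (fun t : ℂ => f (t • z))
      (FormalMultilinearSeries.ofScalars ℂ c) 0 :=
    hasFPowerSeriesAt_iff.2 (Eventually.of_forall fun t => by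
      simpa [FormalMultilinearSeries.coeff_ofScalars] using h t)
  have := congrArg (fun P => P.coeff k) (h1.eq_formalMultilinearSeries h2)
  simpa [FormalMultilinearSeries.coeff_ofScalars] using this

theorem homComp_of_homogeneous {P : Cn n → ℂ} (hP : ContDiff ℂ ∞ P) {j : ℕ}
    (h : ∀ (t : ℂ) z, P (t • z) = t ^ j * P z) (k : ℕ) (z : Cn n) :
    homComp P k z = if k = j then P z else 0 := by
  refine homComp_eq_of_hasSum hP (c := fun k => if k = j then P z else 0) (fun t => ?_) k
  rw [h]
  convert! hasSum_ite_eq j (t ^ j * P z) using 2 with i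
  split_ifs with hi <;> simp [hi]

theorem homComp_add {f g : Cn n → ℂ} (hf : ContDiff ℂ ∞ f) (hg : ContDiff ℂ ∞ g) (k : ℕ)
    (z : Cn n) : homComp (f + g) k z = homComp f k z + homComp g k z := by
  refine homComp_eq_of_hasSum (hf.add hg) (c := fun k => homComp f k z + homComp g k z)
    (fun t => ?_) k
  simpa [mul_add] using (hasSum_homComp_smul hf z t).add (hasSum_homComp_smul hg z t)

theorem homComp_sub {f g : Cn n → ℂ} (hf : ContDiff ℂ ∞ f) (hg : ContDiff ℂ ∞ g) (k : ℕ)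
    (z : Cn n) : homComp (f - g) k z = homComp f k z - homComp g k z := by
  refine homComp_eq_of_hasSum (hf.sub hg) (c := fun k => homComp f k z - homComp g k z)
    (fun t => ?_) k
  simpa [mul_sub] using (hasSum_homComp_smul hf z t).sub (hasSum_homComp_smul hg z t)

theorem homComp_const_smul {f : Cn n → ℂ} (hf : ContDiff ℂ ∞ f) (c : ℂ) (k : ℕ)
    (z : Cn n) : homComp (c • f) k z = c * homComp f k z := by
  refine homComp_eq_of_hasSum (contDiff_const.smul hf) (c := fun k => c * homComp f k z)
    (fun t => ?_) k
  simpa [mul_left_comm] using (hasSum_homComp_smul hf z t).mul_left c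

theorem norm_homComp_le {f : Cn n → ℂ} (hf : ContDiff ℂ ∞ f) {M R : ℝ} (hR : 0 < R)
    (hM : ∀ z, ‖z‖ ≤ R → ‖f z‖ ≤ M) (k : ℕ) (z : Cn n) :
    ‖homComp f k z‖ ≤ M * (‖z‖ / R) ^ k := by
  have hM0 : 0 ≤ M := (norm_nonneg _).trans (hM 0 (by simp [hR.le]))
  rcases eq_or_ne z 0 with rfl | hz
  · have h := homComp_smul f k 0 (0 : Cn n)
    rw [zero_smul] at h
    rcases Nat.eq_zero_or_pos k with rfl | hk
    · have := hasSum_homComp_smul hf (0 : Cn n) 0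
      have h0 : homComp f 0 0 = f 0 := by simp [homComp]
      simpa [h0] using hM 0 (by simp [hR.le])
    · rw [h, zero_pow hk.ne']
      simp; positivity
  have hz' : 0 < ‖z‖ := norm_pos_iff.2 hz
  -- Cauchy's estimate on |t| = R/‖z‖, the circle whose image tz lies on the sphere of radius R.
  have h := Complex.norm_iteratedDeriv_le_of_forall_mem_sphere_norm_le (c := 0) (R := R / ‖z‖)
    (C := M) k (by positivity) (differentiable_slice hf z).diffContOnCl (fun t ht => hM _ (by
      rw [mem_sphere_zero_iff_norm] at ht
      rw [norm_smul, ht, div_mul_cancel₀ _ hz'.ne']))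
  rw [homComp_eq_iteratedDeriv hf, norm_mul, norm_inv, Complex.norm_natCast]
  have hk : (0 : ℝ) < k.factorial := by exact_mod_cast k.factorial_pos
  rw [inv_mul_le_iff₀ hk]
  refine h.trans (le_of_eq ?_)
  rw [div_pow, div_pow]
  field_simp

/-- Cauchy's integral formula for the k-th coefficient of t ↦ f(tz) on the unit circle, written as a
Fourier coefficient. -/
theorem average_mul_exp_eq_homComp {f : Cn n → ℂ} (hf : ContDiff ℂ ∞ f) (k : ℕ) (z : Cn n) :
    (2 * Real.pi)⁻¹ • ∫ θ in (0 : ℝ)..(2 * Real.pi),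
      Complex.exp (-(k * (θ * Complex.I))) * f (rot θ z) = homComp f k z := by
  have h1 : HasFPowerSeriesAt (fun t : ℂ => f (t • z))
      (FormalMultilinearSeries.ofScalars ℂ fun k => homComp f k z) 0 :=
    hasFPowerSeriesAt_iff.2 (Eventually.of_forall fun t => by
      simpa [FormalMultilinearSeries.coeff_ofScalars] using hasSum_homComp_smul hf z t)
  have h2 := ((differentiable_slice hf z).hasFPowerSeriesOnBall 0
    (R := 1) one_pos).hasFPowerSeriesAt
  have h3 := congrArg (fun P => P k fun _ => 1) (h1.eq_formalMultilinearSeries h2)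
  have h4 : homComp f k z = (cauchyPowerSeries (fun t : ℂ => f (t • z)) 0 (1 : ℝ≥0) k fun _ => 1) := by
    rw [← h3]
    simp [FormalMultilinearSeries.apply_eq_prod_smul_coeff,
      FormalMultilinearSeries.coeff_ofScalars]
  rw [h4, cauchyPowerSeries_apply, circleIntegral]
  have hpi : (Real.pi : ℂ) ≠ 0 := by exact_mod_cast Real.pi_ne_zero
  have e : ∀ θ : ℝ, deriv (circleMap 0 ((1 : ℝ≥0) : ℝ)) θ • (1 / (circleMap 0 ((1 : ℝ≥0) : ℝ) θ - 0)) ^ k •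
      (circleMap 0 ((1 : ℝ≥0) : ℝ) θ - 0)⁻¹ • f (circleMap 0 ((1 : ℝ≥0) : ℝ) θ • z) =
      Complex.I * (Complex.exp (-(k * (θ * Complex.I))) * f (rot θ z)) := by
    intro θ
    have h0 : Complex.exp (θ * Complex.I) ≠ 0 := Complex.exp_ne_zero _
    simp only [deriv_circleMap, circleMap, NNReal.coe_one, Complex.ofReal_one, one_mul, zero_add,
      sub_zero, smul_eq_mul, rot, Complex.exp_neg, Complex.exp_nat_mul, one_div, inv_pow]
    field_simp
  simp only [e, intervalIntegral.integral_const_mul]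
  rw [smul_eq_mul, Complex.real_smul]
  push_cast
  generalize (∫ θ in (0 : ℝ)..(2 * Real.pi), _ : ℂ) = J
  field_simp

end Fock
end

/-! ### Low and high parts; convergence and boundedness of the pairing -/

noncomputable section

namespace Fock

open Filter Topology
open scoped ENNReal NNReal ContDiff

variable {n : ℕ}

/-- The sum of the homogeneous components of degree less than `N`. -/
def lowSum (N : ℕ) (f : Cn n → ℂ) (z : Cn n) : ℂ := ∑ k ∈ Finset.range N, homComp f k z

/-- The sum of the homogeneous components of degree at least `N`. -/
def highSum (N : ℕ) (f : Cn n → ℂ) (z : Cn n) : ℂ := f z - lowSum N f z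

theorem contDiff_lowSum (N : ℕ) (f : Cn n → ℂ) : ContDiff ℂ ∞ (lowSum N f) :=
  ContDiff.sum fun k _ => contDiff_homComp f k

theorem contDiff_highSum (N : ℕ) {f : Cn n → ℂ} (hf : ContDiff ℂ ∞ f) :
    ContDiff ℂ ∞ (highSum N f) :=
  hf.sub (contDiff_lowSum N f)

theorem homComp_lowSum (N : ℕ) (f : Cn n → ℂ) (k : ℕ) (z : Cn n) :
    homComp (lowSum N f) k z = if k < N then homComp f k z else 0 := by
  refine homComp_eq_of_hasSum (contDiff_lowSum N f)
    (c := fun k => if k < N then homComp f k z else 0) (fun t => ?_) k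
  have h : lowSum N f (t • z) =
      ∑ k ∈ Finset.range N, t ^ k * (if k < N then homComp f k z else 0) := by
    refine Finset.sum_congr rfl fun k hk => ?_
    rw [homComp_smul, if_pos (Finset.mem_range.1 hk)]
  rw [h]
  refine hasSum_sum_of_ne_finset_zero fun k hk => ?_
  rw [if_neg (by simpa using hk), mul_zero]

theorem homComp_highSum (N : ℕ) {f : Cn n → ℂ} (hf : ContDiff ℂ ∞ f) (k : ℕ) (z : Cn n) :
    homComp (highSum N f) k z = if k < N then 0 else homComp f k z := by
  have : highSum N f = f - lowSum N f := rfl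
  rw [this, homComp_sub hf (contDiff_lowSum N f), homComp_lowSum]
  split_ifs <;> simp

/-- The number of homogeneous components that are paired without a weight in `⟨·,·⟩_σ`. -/
def cut (n : ℕ) (σ : ℝ) : ℕ := if σ < 2 * n then 0 else ⌊|σ / 2|⌋₊ + 1

/-- For σ < 2n the cut is 0 and the low parts vanish, so one formula covers both cases of the
definition. -/
theorem pairing_eq (σ : ℝ) (f g : Cn n → ℂ) :
    pairing σ f g = intPairing 0 (lowSum (cut n σ) f) (lowSum (cut n σ) g) +
      intPairing σ (highSum (cut n σ) f) (highSum (cut n σ) g) := by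
  unfold pairing cut
  split_ifs with h
  · have h1 : intPairing 0 (lowSum 0 f) (lowSum 0 g) = 0 := by
      simp [intPairing, integrand, lowSum]
    have h2 : ∀ u : Cn n → ℂ, highSum 0 u = u := fun u => by funext z; simp [highSum, lowSum]
    rw [h1, h2, h2, zero_add]
  · rfl

theorem pairingConverges_of {σ : ℝ} {f g : Cn n → ℂ}
    (h1 : Integrable (integrand (lowSum (cut n σ) f) (lowSum (cut n σ) g)) (W n 0))
    (h2 : Integrable (integrand (highSum (cut n σ) f) (highSum (cut n σ) g)) (W n σ)) :
    PairingConverges σ f g := by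
  unfold PairingConverges
  unfold cut at h1 h2
  split_ifs at * with h
  · have h3 : ∀ u : Cn n → ℂ, highSum 0 u = u := fun u => by funext z; simp [highSum, lowSum]
    rwa [h3, h3] at h2
  · exact ⟨h1, h2⟩

/-- Exactly the condition for |z|^(2N-σ), with N the cut, to be integrable at the origin of a space
of real dimension 2n. -/
theorem lt_cut (n : ℕ) (σ : ℝ) : -(2 * n : ℝ) < 2 * cut n σ - σ := by
  unfold cut
  split_ifs with h
  · push_cast; linarith
  · have h0 : (0 : ℝ) ≤ n := n.cast_nonneg
    have h1 := Nat.lt_floor_add_one |σ / 2|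
    have h2 := le_abs_self (σ / 2)
    push_cast
    linarith

theorem exists_norm_homComp_le (p a : ℝ) [hp : Fact (1 < p)] {R : ℝ} (hR : 0 < R) :
    ∃ C : ℝ, 0 ≤ C ∧ ∀ (f : FockSpace n p (a * p)) (k : ℕ) (z : Cn n),
      ‖homComp f k z‖ ≤ C * ‖f‖ * (‖z‖ / R) ^ k := by
  obtain ⟨C, hC, h⟩ := exists_norm_apply_le (n := n) p a R
  exact ⟨C, hC, fun f k z => norm_homComp_le f.smooth hR (h f) k z⟩

theorem exists_norm_lowSum_le (p a : ℝ) [hp : Fact (1 < p)] (N : ℕ) :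
    ∃ C : ℝ, 0 ≤ C ∧ ∀ (f : FockSpace n p (a * p)) (z : Cn n),
      ‖lowSum N f z‖ ≤ C * ‖f‖ * Real.exp (N * ‖z‖) := by
  obtain ⟨C, hC, h⟩ := exists_norm_homComp_le (n := n) p a one_pos
  refine ⟨N * C, by positivity, fun f z => ?_⟩
  have : ∀ k ∈ Finset.range N, ‖homComp f k z‖ ≤ C * ‖f‖ * Real.exp (N * ‖z‖) := by
    intro k hk
    refine (h f k z).trans ?_
    rw [div_one]
    gcongr
    calc ‖z‖ ^ k ≤ Real.exp ‖z‖ ^ k := by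
          gcongr; linarith [Real.add_one_le_exp ‖z‖]
      _ = Real.exp (k * ‖z‖) := (Real.exp_nat_mul _ _).symm
      _ ≤ _ := by
          gcongr
          exact (Finset.mem_range.1 hk).le
  refine (norm_sum_le_of_le _ this).trans (le_of_eq ?_)
  rw [Finset.sum_const, Finset.card_range, nsmul_eq_mul]
  ring

/-- Low parts are polynomials with coefficients controlled by the norm of f, so the target exponents
r and b are arbitrary. -/
theorem exists_wnorm_lowSum_le (p a : ℝ) [hp : Fact (1 < p)] (N : ℕ) {r : ℝ} (hr : 0 < r) (b : ℝ) :
    ∃ C : ℝ, 0 ≤ C ∧ ∀ f : FockSpace n p (a * p),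
      wnorm r b (lowSum N f) ≤ ENNReal.ofReal (C * ‖f‖) := by
  obtain ⟨C, hC, h⟩ := exists_norm_lowSum_le (n := n) p a N
  obtain ⟨D, hD, h'⟩ := exists_wnorm_le_of_growth (n := n) hr b N
  refine ⟨D * C, by positivity, fun f => ?_⟩
  rw [mul_assoc]
  exact h' _ _ (h f)

theorem exists_wnorm_highSum_le (p a : ℝ) [hp : Fact (1 < p)] (N : ℕ) :
    ∃ C : ℝ, 0 ≤ C ∧ ∀ f : FockSpace n p (a * p),
      wnorm p a (highSum N f) ≤ ENNReal.ofReal (C * ‖f‖) := by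
  obtain ⟨C, hC, h⟩ := exists_wnorm_lowSum_le (n := n) p a N (one_pos.trans hp.out) a
  refine ⟨1 + C, by positivity, fun f => ?_⟩
  let l : FockSpace n p (a * p) := mkFock (lowSum N f)
    ((contDiff_lowSum N f).differentiable (by simp)) ((h f).trans_lt ENNReal.ofReal_lt_top).ne
  have h1 : ‖l‖ ≤ C * ‖f‖ := norm_le_of_wnorm_le l (by positivity) (h f)
  have h2 : wnorm p a (highSum N f) = ENNReal.ofReal ‖f - l‖ := wnorm_coe (f - l)
  rw [h2]
  refine ENNReal.ofReal_le_ofReal ((norm_sub_le _ _).trans ?_)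
  linarith

theorem exists_norm_highSum_le (p a : ℝ) [hp : Fact (1 < p)] (N : ℕ) :
    ∃ C : ℝ, 0 ≤ C ∧ ∀ (f : FockSpace n p (a * p)) (z : Cn n), ‖z‖ ≤ 1 →
      ‖highSum N f z‖ ≤ C * ‖f‖ * ‖z‖ ^ N := by
  -- Cauchy estimates at radius 2 leave a geometric series of ratio 1/2 on the unit ball, after
  -- |z|^N is taken out.
  obtain ⟨C, hC, h⟩ := exists_norm_homComp_le (n := n) p a two_pos
  refine ⟨C * 2, by positivity, fun f z hz => ?_⟩
  have hs : HasSum (fun k => homComp f (k + N) z) (highSum N f z) :=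
    (hasSum_nat_add_iff' N).2 (hasSum_homComp f.smooth z)
  have hg : HasSum (fun k : ℕ => C * ‖f‖ * ‖z‖ ^ N * (1 / 2) ^ k) (C * ‖f‖ * ‖z‖ ^ N * 2) :=
    hasSum_geometric_two.mul_left _
  have := tsum_of_norm_bounded hg (f := fun k => homComp f (k + N) z) fun k => by
    refine (h f (k + N) z).trans ?_
    rw [mul_assoc (C * ‖f‖)]
    gcongr
    rw [div_pow, pow_add, one_div, inv_pow, pow_add, div_eq_mul_inv, mul_inv]
    calc ‖z‖ ^ k * ‖z‖ ^ N * ((2 ^ k)⁻¹ * (2 ^ N)⁻¹) ≤ 1 * ‖z‖ ^ N * ((2 ^ k)⁻¹ * 1) := by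
          gcongr
          · exact pow_le_one₀ (norm_nonneg z) hz
          · exact inv_le_one_of_one_le₀ (one_le_pow₀ one_le_two)
      _ = _ := by ring
  rw [hs.tsum_eq] at this
  linarith

theorem finrank_Cn (n : ℕ) : Module.finrank ℝ (Cn n) = 2 * n := by
  rw [(WithLp.linearEquiv 2 ℝ (Fin n → ℂ)).finrank_eq, Module.finrank_pi_fintype]
  simp [Complex.finrank_real_complex, mul_comm]

theorem integrableOn_ball_norm_rpow (hn : 1 ≤ n) {N : ℕ} {σ : ℝ}
    (h : -(2 * n : ℝ) < 2 * N - σ) :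
    IntegrableOn (fun z : Cn n => ‖z‖ ^ (2 * N) * ‖z‖ ^ (-σ)) (Metric.ball 0 1) (V n) := by
  have : Nonempty (Fin n) := ⟨⟨0, hn⟩⟩
  have := (integrableOn_fun_norm_addHaar (V n)
    (f := fun r : ℝ => r ^ (2 * N) * r ^ (-σ)) (r := 1)).2
  refine this ?_
  rw [finrank_Cn]
  have h1 : IntegrableOn (fun y : ℝ => y ^ ((2 * n - 1 : ℕ) + (2 * N : ℕ) + -σ : ℝ))
      (Set.Ioo 0 1) := by
    rw [intervalIntegral.integrableOn_Ioo_rpow_iff one_pos]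
    have h2 : 1 ≤ 2 * n := by omega
    push_cast [Nat.cast_sub h2]
    linarith
  refine h1.congr_fun (fun y hy => ?_) measurableSet_Ioo
  have hy0 : 0 < y := hy.1
  simp only [smul_eq_mul]
  rw [Real.rpow_add hy0, Real.rpow_add hy0, Real.rpow_natCast, Real.rpow_natCast, mul_assoc]

/-- Away from the unit ball |z| and 1+|z| are comparable, so dV/|z|^σ may be replaced by the weight
of the norms. -/
theorem norm_rpow_neg_le (σ : ℝ) {r : ℝ} (hr : 1 ≤ r) :
    r ^ (-σ) ≤ 2 ^ |σ| * (1 + r) ^ (-σ) := by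
  have h0 : (0 : ℝ) < r := by linarith
  rcases le_total σ 0 with h | h
  · calc r ^ (-σ) ≤ (1 + r) ^ (-σ) := Real.rpow_le_rpow h0.le (by linarith) (by linarith)
      _ ≤ 2 ^ |σ| * (1 + r) ^ (-σ) :=
        le_mul_of_one_le_left (by positivity) (Real.one_le_rpow (by norm_num) (abs_nonneg σ))
  · rw [abs_of_nonneg h]
    calc r ^ (-σ) ≤ ((1 + r) / 2) ^ (-σ) :=
          Real.rpow_le_rpow_of_nonpos (by positivity) (by linarith) (by linarith)
      _ = 2 ^ σ * (1 + r) ^ (-σ) := by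
          rw [Real.div_rpow (by positivity) (by norm_num), Real.rpow_neg (by norm_num : (0:ℝ) ≤ 2)]
          field_simp

theorem enorm_integrand (ψ φ : Cn n → ℂ) (z : Cn n) :
    ‖integrand ψ φ z‖ₑ = ‖ψ z‖ₑ * ‖φ z‖ₑ * ENNReal.ofReal (Real.exp (-‖z‖ ^ 2)) := by
  rw [integrand, enorm_mul, enorm_mul, ← ofReal_norm (Complex.ofReal _), norm_ofReal_exp,
    ← ofReal_norm (starRingEnd ℂ _), Complex.norm_conj, ofReal_norm]

/-- Inside the unit ball both high parts are O(|z|^N), and the condition on N makes |z|^(2N)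
integrable against |z|^(-(a+b)). Outside, the weight is comparable to (1+|z|)^(-(a+b)) and Hölder's
inequality applies. -/
theorem exists_lintegral_highSum_le (hn : 1 ≤ n) (p q : ℝ) [hp : Fact (1 < p)] [hq : Fact (1 < q)]
    (hpq : p.HolderConjugate q) (a b : ℝ) {N : ℕ} (h : -(2 * n : ℝ) < 2 * N - (a + b)) :
    ∃ C : ℝ, 0 ≤ C ∧ ∀ (f : FockSpace n p (a * p)) (g : FockSpace n q (b * q)),
      ∫⁻ z, ‖integrand (highSum N f) (highSum N g) z‖ₑ ∂(W n (a + b)) ≤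
        ENNReal.ofReal (C * ‖f‖ * ‖g‖) := by
  obtain ⟨C₁, hC₁, h₁⟩ := exists_norm_highSum_le (n := n) p a N
  obtain ⟨C₂, hC₂, h₂⟩ := exists_norm_highSum_le (n := n) q b N
  obtain ⟨D₁, hD₁, h₁'⟩ := exists_wnorm_highSum_le (n := n) p a N
  obtain ⟨D₂, hD₂, h₂'⟩ := exists_wnorm_highSum_le (n := n) q b N
  have hI := (integrableOn_ball_norm_rpow hn h).lintegral_lt_top
  set I := ∫⁻ z in Metric.ball (0 : Cn n) 1,
    ENNReal.ofReal (‖z‖ ^ (2 * N) * ‖z‖ ^ (-(a + b))) ∂(V n)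
  refine ⟨C₁ * C₂ * I.toReal + 2 ^ |a + b| * D₁ * D₂, by positivity, fun f g => ?_⟩
  have cf := (contDiff_highSum N f.smooth).continuous
  have cg := (contDiff_highSum N g.smooth).continuous
  have hW : ∫⁻ z, ‖integrand (highSum N f) (highSum N g) z‖ₑ ∂(W n (a + b)) =
      ∫⁻ z, ENNReal.ofReal (‖z‖ ^ (-(a + b))) * (‖highSum N f z‖ₑ * ‖highSum N g z‖ₑ *
        ENNReal.ofReal (Real.exp (-‖z‖ ^ 2))) ∂(V n) := by
    rw [W, lintegral_withDensity_eq_lintegral_mul_non_measurable _ (by fun_prop)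
      (Eventually.of_forall fun z => ENNReal.ofReal_lt_top)]
    exact lintegral_congr fun z => by rw [Pi.mul_apply, enorm_integrand]
  rw [hW, ← lintegral_add_compl _ (measurableSet_ball (x := (0 : Cn n)) (ε := 1))]
  have key1 : ∫⁻ z in Metric.ball (0 : Cn n) 1, ENNReal.ofReal (‖z‖ ^ (-(a + b))) *
      (‖highSum N f z‖ₑ * ‖highSum N g z‖ₑ * ENNReal.ofReal (Real.exp (-‖z‖ ^ 2))) ∂(V n) ≤
      ENNReal.ofReal (C₁ * ‖f‖ * (C₂ * ‖g‖)) * I := by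
    rw [← lintegral_const_mul' _ _ ENNReal.ofReal_ne_top]
    refine setLIntegral_mono' measurableSet_ball fun z hz => ?_
    have hz' : ‖z‖ ≤ 1 := by simpa using (Metric.mem_ball.1 hz).le
    rw [← ofReal_norm, ← ofReal_norm, ← ENNReal.ofReal_mul (by positivity),
      ← ENNReal.ofReal_mul (by positivity), ← ENNReal.ofReal_mul (by positivity),
      ← ENNReal.ofReal_mul (by positivity)]
    refine ENNReal.ofReal_le_ofReal ?_
    calc ‖z‖ ^ (-(a + b)) * (‖highSum N f z‖ * ‖highSum N g z‖ * Real.exp (-‖z‖ ^ 2))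
        ≤ ‖z‖ ^ (-(a + b)) * ((C₁ * ‖f‖ * ‖z‖ ^ N) * (C₂ * ‖g‖ * ‖z‖ ^ N) * 1) := by
          gcongr
          · exact h₁ f z hz'
          · exact h₂ g z hz'
          · rw [Real.exp_le_one_iff]; nlinarith [sq_nonneg ‖z‖]
      _ = _ := by rw [two_mul, pow_add]; ring
  have key2 : ∫⁻ z in (Metric.ball (0 : Cn n) 1)ᶜ, ENNReal.ofReal (‖z‖ ^ (-(a + b))) *
      (‖highSum N f z‖ₑ * ‖highSum N g z‖ₑ * ENNReal.ofReal (Real.exp (-‖z‖ ^ 2))) ∂(V n) ≤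
      ENNReal.ofReal (2 ^ |a + b|) * (ENNReal.ofReal (D₁ * ‖f‖) * ENNReal.ofReal (D₂ * ‖g‖)) := by
    refine le_trans ?_ (mul_le_mul_right ((lintegral_mul_le_wnorm hpq a b
      cf.aemeasurable cg.aemeasurable).trans (mul_le_mul' (h₁' f) (h₂' g))) _)
    rw [← lintegral_const_mul' _ _ ENNReal.ofReal_ne_top]
    refine le_trans (setLIntegral_mono' measurableSet_ball.compl fun z hz => ?_)
      (setLIntegral_le_lintegral _ _)
    have hz' : 1 ≤ ‖z‖ := by simpa using hz
    rw [mul_left_comm, mul_left_comm (ENNReal.ofReal (2 ^ |a + b|))]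
    refine mul_le_mul_right ?_ _
    rw [← ENNReal.ofReal_mul (by positivity), ← ENNReal.ofReal_mul (by positivity)]
    refine ENNReal.ofReal_le_ofReal ?_
    rw [mul_left_comm, mul_comm]
    gcongr
    exact norm_rpow_neg_le _ hz'
  refine (add_le_add key1 key2).trans (le_of_eq ?_)
  rw [← ENNReal.ofReal_toReal hI.ne, ← ENNReal.ofReal_mul (by positivity),
    ← ENNReal.ofReal_mul (by positivity), ← ENNReal.ofReal_mul (by positivity),
    ← ENNReal.ofReal_add (by positivity) (by positivity), ENNReal.toReal_ofReal (by positivity)]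
  congr 1; ring

theorem W_zero (n : ℕ) : W n 0 = V n := by
  simp [W]

theorem exists_lintegral_lowSum_le (p q : ℝ) [hp : Fact (1 < p)] [hq : Fact (1 < q)]
    (hpq : p.HolderConjugate q) (a b : ℝ) (N : ℕ) :
    ∃ C : ℝ, 0 ≤ C ∧ ∀ (f : FockSpace n p (a * p)) (g : FockSpace n q (b * q)),
      ∫⁻ z, ‖integrand (lowSum N f) (lowSum N g) z‖ₑ ∂(W n 0) ≤
        ENNReal.ofReal (C * ‖f‖ * ‖g‖) := by
  obtain ⟨D₁, hD₁, h₁⟩ := exists_wnorm_lowSum_le (n := n) p a N (one_pos.trans hp.out) 0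
  obtain ⟨D₂, hD₂, h₂⟩ := exists_wnorm_lowSum_le (n := n) q b N (one_pos.trans hq.out) 0
  refine ⟨D₁ * D₂, by positivity, fun f g => ?_⟩
  have cf := (contDiff_lowSum N f).continuous
  have cg := (contDiff_lowSum N g).continuous
  have := (lintegral_mul_le_wnorm hpq 0 0 cf.aemeasurable cg.aemeasurable).trans
    (mul_le_mul' (h₁ f) (h₂ g))
  rw [W_zero]
  refine le_trans (le_of_eq ?_) (this.trans (le_of_eq ?_))
  · refine lintegral_congr fun z => ?_
    rw [enorm_integrand]; simp
  · rw [← ENNReal.ofReal_mul (by positivity)]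
    congr 1; ring

theorem continuous_integrand {ψ φ : Cn n → ℂ} (hψ : Continuous ψ) (hφ : Continuous φ) :
    Continuous (integrand ψ φ) := by
  unfold integrand
  have := Complex.continuous_conj.comp hφ
  exact (hψ.mul this).mul (by fun_prop)

theorem integrable_highSum (hn : 1 ≤ n) {p q : ℝ} [hp : Fact (1 < p)] [hq : Fact (1 < q)]
    (hpq : p.HolderConjugate q) {a b : ℝ} {N : ℕ} (h : -(2 * n : ℝ) < 2 * N - (a + b))
    (f : FockSpace n p (a * p)) (g : FockSpace n q (b * q)) :
    Integrable (integrand (highSum N f) (highSum N g)) (W n (a + b)) := by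
  obtain ⟨C, hC, h'⟩ := exists_lintegral_highSum_le hn p q hpq a b h
  exact ⟨(continuous_integrand (contDiff_highSum N f.smooth).continuous
    (contDiff_highSum N g.smooth).continuous).aestronglyMeasurable,
    (h' f g).trans_lt ENNReal.ofReal_lt_top⟩

theorem integrable_lowSum {p q : ℝ} [hp : Fact (1 < p)] [hq : Fact (1 < q)]
    (hpq : p.HolderConjugate q) {a b : ℝ} (N : ℕ)
    (f : FockSpace n p (a * p)) (g : FockSpace n q (b * q)) :
    Integrable (integrand (lowSum N f) (lowSum N g)) (W n 0) := by
  obtain ⟨C, hC, h'⟩ := exists_lintegral_lowSum_le (n := n) p q hpq a b N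
  exact ⟨(continuous_integrand (contDiff_lowSum N f).continuous
    (contDiff_lowSum N g).continuous).aestronglyMeasurable,
    (h' f g).trans_lt ENNReal.ofReal_lt_top⟩

theorem pairingConverges (hn : 1 ≤ n) {p q : ℝ} [hp : Fact (1 < p)] [hq : Fact (1 < q)]
    (hpq : p.HolderConjugate q) {a b : ℝ}
    (f : FockSpace n p (a * p)) (g : FockSpace n q (b * q)) :
    PairingConverges (a + b) f g :=
  pairingConverges_of (integrable_lowSum hpq _ f g)
    (integrable_highSum hn hpq (lt_cut n (a + b)) f g)

theorem exists_norm_pairing_le (hn : 1 ≤ n) (p q : ℝ) [hp : Fact (1 < p)] [hq : Fact (1 < q)]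
    (hpq : p.HolderConjugate q) (a b : ℝ) :
    ∃ C : ℝ, 0 ≤ C ∧ ∀ (f : FockSpace n p (a * p)) (g : FockSpace n q (b * q)),
      ‖pairing (a + b) f g‖ ≤ C * ‖g‖ * ‖f‖ := by
  obtain ⟨C, hC, h⟩ := exists_lintegral_highSum_le hn p q hpq a b (lt_cut n (a + b))
  obtain ⟨D, hD, h'⟩ := exists_lintegral_lowSum_le (n := n) p q hpq a b (cut n (a + b))
  refine ⟨D + C, by positivity, fun f g => ?_⟩
  have e1 := (enorm_integral_le_lintegral_enorm _).trans (h f g)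
  have e2 := (enorm_integral_le_lintegral_enorm _).trans (h' f g)
  rw [← ofReal_norm, ENNReal.ofReal_le_ofReal_iff (by positivity)] at e1 e2
  rw [pairing_eq]
  refine (norm_add_le_of_le e2 e1).trans (le_of_eq ?_)
  ring

theorem lowSum_add {f g : Cn n → ℂ} (N : ℕ) (hf : ContDiff ℂ ∞ f) (hg : ContDiff ℂ ∞ g)
    (z : Cn n) : lowSum N (f + g) z = lowSum N f z + lowSum N g z := by
  simp only [lowSum, homComp_add hf hg, Finset.sum_add_distrib]

theorem lowSum_smul {f : Cn n → ℂ} (N : ℕ) (c : ℂ) (hf : ContDiff ℂ ∞ f)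
    (z : Cn n) : lowSum N (c • f) z = c * lowSum N f z := by
  simp only [lowSum, homComp_const_smul hf, Finset.mul_sum]

end Fock
end

/-! ### Diagonalization of the pairing on homogeneous components -/

noncomputable section

namespace Fock

open Filter Topology
open scoped ENNReal NNReal ContDiff

variable {n : ℕ}

/-- The homogeneous component `(z·w̄)^k / k!` of the kernel `e^{z·w̄}`. -/
def kerComp (k : ℕ) (w z : Cn n) : ℂ := inner ℂ w z ^ k / k.factorial

/-- The kernel `e^{z·w̄}`. -/
def ker (w z : Cn n) : ℂ := Complex.exp (inner ℂ w z)

theorem contDiff_inner_right (w : Cn n) : ContDiff ℂ ∞ fun z : Cn n => (inner ℂ w z : ℂ) :=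
  (innerSL ℂ w).contDiff

theorem contDiff_kerComp (k : ℕ) (w : Cn n) : ContDiff ℂ ∞ (kerComp k w) :=
  ((contDiff_inner_right w).pow k).div_const _

theorem contDiff_ker (w : Cn n) : ContDiff ℂ ∞ (ker w) :=
  (contDiff_inner_right w).cexp

theorem kerComp_smul (k : ℕ) (w : Cn n) (t : ℂ) (z : Cn n) :
    kerComp k w (t • z) = t ^ k * kerComp k w z := by
  simp only [kerComp, inner_smul_right, mul_pow, mul_div_assoc]

theorem hasSum_kerComp (w z : Cn n) : HasSum (fun k => kerComp k w z) (ker w z) := by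
  rw [ker, Complex.exp_eq_exp_ℂ]
  exact NormedSpace.expSeries_div_hasSum_exp _

theorem homComp_ker (w : Cn n) (k : ℕ) (z : Cn n) : homComp (ker w) k z = kerComp k w z := by
  refine homComp_eq_of_hasSum (contDiff_ker w) (c := fun k => kerComp k w z) (fun t => ?_) k
  simpa only [kerComp_smul] using hasSum_kerComp w (t • z)

/-- Orthogonality of degrees: rotation by θ multiplies P by e^{ikθ}, so the angular average extracts
from g its k-th Fourier coefficient, which is g_k. Averaging avoids integrating the expansion of g
term by term. -/
theorem integral_integrand_eq_homComp {μ : Measure (Cn n)} [SFinite μ]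
    (hμ : ∀ θ, MeasurePreserving (rot θ) μ μ) {P g : Cn n → ℂ} {k : ℕ} (hP : Continuous P)
    (h : ∀ (t : ℂ) z, P (t • z) = t ^ k * P z) (hg : ContDiff ℂ ∞ g)
    (hi : Integrable (integrand P g) μ) :
    ∫ z, integrand P g z ∂μ = ∫ z, integrand P (homComp g k) z ∂μ := by
  rw [integral_eq_integral_average hμ (continuous_integrand hP hg.continuous) hi]
  refine integral_congr_ae (Eventually.of_forall fun z => ?_)
  have e : ∀ θ : ℝ, integrand P g (rot θ z) = P z * (Real.exp (-‖z‖ ^ 2) : ℂ) *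
      starRingEnd ℂ (Complex.exp (-(k * (θ * Complex.I))) * g (rot θ z)) := by
    intro θ
    have h1 : P (rot θ z) = Complex.exp (k * (θ * Complex.I)) * P z := by
      rw [rot, h, Complex.exp_nat_mul]
    have h2 : starRingEnd ℂ (Complex.exp (-(k * (θ * Complex.I)))) =
        Complex.exp (k * (θ * Complex.I)) := by
      rw [← Complex.exp_conj]
      simp
    simp only [integrand, norm_rot]
    rw [map_mul, h1, h2]
    ring
  simp only [e, intervalIntegral.integral_const_mul]
  rw [integrand, ← average_mul_exp_eq_homComp hg k z]
  have hpi : (0 : ℝ) ≤ 2 * Real.pi := by positivity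
  rw [intervalIntegral.integral_of_le hpi, intervalIntegral.integral_of_le hpi, integral_conj,
    Complex.real_smul, Complex.real_smul, map_mul, Complex.conj_ofReal]
  ring

/-- Polar coordinates. The point is that the spherical factor does not depend on φ, so changing the
radial weight changes the integral only by a scalar. -/
theorem integral_norm_mul_homogeneous (hn : 1 ≤ n) (φ : ℝ → ℝ) {H : Cn n → ℂ} {k : ℕ}
    (hH : ∀ (r : ℝ) (z : Cn n), 0 < r → H (r • z) = (r : ℂ) ^ (2 * k) * H z) :
    ∫ z, (φ ‖z‖ : ℂ) * H z ∂(volume : Measure (Cn n)) =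
      ((∫ r in Set.Ioi (0 : ℝ), r ^ (2 * n + 2 * k - 1) * φ r : ℝ) : ℂ) *
        ∫ z : Metric.sphere (0 : Cn n) 1, H z ∂(volume : Measure (Cn n)).toSphere := by
  have : Nonempty (Fin n) := ⟨⟨0, hn⟩⟩
  set μ : Measure (Cn n) := volume
  calc ∫ z, (φ ‖z‖ : ℂ) * H z ∂μ
      = ∫ z : ({(0)}ᶜ : Set (Cn n)), (φ ‖z.1‖ : ℂ) * H z.1 ∂(μ.comap (↑)) := by
        rw [integral_subtype_comap (measurableSet_singleton _).compl
          (fun z : Cn n => (φ ‖z‖ : ℂ) * H z), restrict_compl_singleton]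
    _ = ∫ x : Metric.sphere (0 : Cn n) 1 × Set.Ioi (0 : ℝ),
          (φ x.2 : ℂ) * ((x.2 : ℝ) : ℂ) ^ (2 * k) * H x.1
          ∂(μ.toSphere.prod (.volumeIoiPow (Module.finrank ℝ (Cn n) - 1))) := by
        rw [← (μ.measurePreserving_homeomorphUnitSphereProd).integral_comp
          (Homeomorph.measurableEmbedding _)
          (fun x : Metric.sphere (0 : Cn n) 1 × Set.Ioi (0 : ℝ) =>
            (φ x.2 : ℂ) * ((x.2 : ℝ) : ℂ) ^ (2 * k) * H x.1)]
        refine integral_congr_ae (Eventually.of_forall fun z => ?_)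
        have hz : 0 < ‖z.1‖ := norm_pos_iff.2 z.2
        have hz2 : z.1 = ‖z.1‖ • (‖z.1‖⁻¹ • z.1) := by
          rw [smul_smul, mul_inv_cancel₀ hz.ne', one_smul]
        simp only [homeomorphUnitSphereProd_apply_snd_coe, homeomorphUnitSphereProd_apply_fst_coe]
        conv_lhs => rw [hz2, hH _ _ hz, ← hz2]
        ring
    _ = _ := by
        have := integral_prod_mul (μ := μ.toSphere)
          (ν := .volumeIoiPow (Module.finrank ℝ (Cn n) - 1))
          (fun z : Metric.sphere (0 : Cn n) 1 => H z)
          (fun r : Set.Ioi (0 : ℝ) => (φ r : ℂ) * ((r : ℝ) : ℂ) ^ (2 * k))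
        simp only [mul_comm (H _)] at this
        rw [this, mul_comm]
        congr 1
        rw [Measure.volumeIoiPow, integral_withDensity_eq_integral_toReal_smul
          (by fun_prop) (by simp), ← integral_complex_ofReal,
          integral_subtype_comap measurableSet_Ioi
            (fun r : ℝ => (ENNReal.ofReal (r ^ (Module.finrank ℝ (Cn n) - 1))).toReal •
              ((φ r : ℂ) * (r : ℂ) ^ (2 * k)))]
        refine setIntegral_congr_fun measurableSet_Ioi fun r hr => ?_
        have hr' : (0 : ℝ) < r := hr
        rw [ENNReal.toReal_ofReal (by positivity), finrank_Cn, Complex.real_smul]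
        have : 2 * n + 2 * k - 1 = (2 * n - 1) + 2 * k := by omega
        rw [this, pow_add]
        push_cast
        ring

/-- Both sides have the same spherical factor, and the radial integral for the weight |z|^(-τ) is
Γ(n+k-τ/2)/2; take τ = σ and τ = 0. -/
theorem integral_W_mul_Gamma (hn : 1 ≤ n) {H : Cn n → ℂ} {k : ℕ} {σ : ℝ}
    (hσ : 0 < n + k - σ / 2)
    (hH : ∀ (r : ℝ) (z : Cn n), 0 < r → H (r • z) = (r : ℂ) ^ (2 * k) * H z) :
    (∫ z, H z * (Real.exp (-‖z‖ ^ 2) : ℂ) ∂(W n σ)) =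
      (Real.Gamma (n + k - σ / 2) / Real.Gamma (n + k) : ℝ) *
        ∫ z, H z * (Real.exp (-‖z‖ ^ 2) : ℂ) ∂(V n) := by
  have hnk : (0 : ℝ) < n + k := by
    have : (1 : ℝ) ≤ n := by exact_mod_cast hn
    positivity
  have key : ∀ τ : ℝ, 0 < n + k - τ / 2 →
      ∫ r in Set.Ioi (0 : ℝ), r ^ (2 * n + 2 * k - 1) * (r ^ (-τ) * Real.exp (-r ^ 2)) =
        1 / 2 * Real.Gamma (n + k - τ / 2) := by
    intro τ hτ
    have h := integral_rpow_mul_exp_neg_rpow (p := 2) (q := 2 * n + 2 * k - 1 - τ) two_pos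
      (by linarith)
    have e : ((2 * n + 2 * k - 1 - τ + 1) / 2 : ℝ) = n + k - τ / 2 := by ring
    rw [e] at h
    rw [← h]
    refine setIntegral_congr_fun measurableSet_Ioi fun r hr => ?_
    have hr' : (0 : ℝ) < r := hr
    rw [← mul_assoc, ← Real.rpow_natCast, ← Real.rpow_add hr', Real.rpow_two]
    have h2 : 1 ≤ 2 * n + 2 * k := by omega
    congr 2
    push_cast [Nat.cast_sub h2]
    ring
  have hW : ∀ τ : ℝ, 0 < n + k - τ / 2 → (∫ z, H z * (Real.exp (-‖z‖ ^ 2) : ℂ) ∂(W n τ)) =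
      ((Real.pi ^ n)⁻¹ : ℝ) * (((1 / 2 * Real.Gamma (n + k - τ / 2) : ℝ) : ℂ) *
        ∫ z : Metric.sphere (0 : Cn n) 1, H z ∂(volume : Measure (Cn n)).toSphere) := by
    intro τ hτ
    rw [W, integral_withDensity_eq_integral_toReal_smul (by fun_prop) (by simp), V,
      integral_smul_measure, ENNReal.toReal_ofReal (by positivity), Complex.real_smul, ← key τ hτ,
      ← integral_norm_mul_homogeneous hn (fun r => r ^ (-τ) * Real.exp (-r ^ 2)) hH]
    congr 1
    refine integral_congr_ae (Eventually.of_forall fun z => ?_)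
    simp only
    rw [ENNReal.toReal_ofReal (by positivity), Complex.real_smul]
    push_cast
    ring
  rw [hW σ hσ, ← W_zero, hW 0 (by simpa using hnk)]
  have hG : (Real.Gamma (n + k) : ℂ) ≠ 0 := by
    exact_mod_cast (Real.Gamma_pos_of_pos hnk).ne'
  simp only [zero_div, sub_zero]
  push_cast
  field_simp

theorem norm_ker_le (w z : Cn n) : ‖ker w z‖ ≤ Real.exp (‖w‖ * ‖z‖) := norm_exp_inner_le w z

/-- Doubling the exponential type buys the factor 2^(-k), which makes the expansion of the kernel
converge absolutely in norm. -/
theorem norm_kerComp_le (k : ℕ) (w z : Cn n) :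
    ‖kerComp k w z‖ ≤ (1 / 2) ^ k * Real.exp (2 * ‖w‖ * ‖z‖) := by
  have h1 : ‖kerComp k w z‖ ≤ (‖w‖ * ‖z‖) ^ k / k.factorial := by
    rw [kerComp, norm_div, norm_pow, Complex.norm_natCast]
    gcongr
    exact norm_inner_le_norm w z
  have h2 := Real.pow_div_factorial_le_exp (2 * (‖w‖ * ‖z‖)) (by positivity) k
  calc _ ≤ _ := h1
    _ = (1 / 2) ^ k * ((2 * (‖w‖ * ‖z‖)) ^ k / k.factorial) := by
      rw [← mul_div_assoc, ← mul_pow]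
      congr 2; ring
    _ ≤ _ := by rw [mul_assoc 2]; gcongr

theorem wnorm_ne_top_of_growth {p : ℝ} (hp : 0 < p) (a A M : ℝ) {F : Cn n → ℂ}
    (h : ∀ z, ‖F z‖ ≤ M * Real.exp (A * ‖z‖)) : wnorm p a F ≠ ⊤ := by
  obtain ⟨C, hC, h'⟩ := exists_wnorm_le_of_growth (n := n) hp a A
  exact ((h' M F h).trans_lt ENNReal.ofReal_lt_top).ne

/-- The kernel `e^{z·w̄}` as an element of the Fock space. -/
def kerF (p a : ℝ) [hp : Fact (1 < p)] (w : Cn n) : FockSpace n p (a * p) :=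
  mkFock (ker w) ((contDiff_ker w).differentiable (by simp))
    (wnorm_ne_top_of_growth (one_pos.trans hp.out) a ‖w‖ 1 fun z => by
      simpa using norm_ker_le w z)

/-- The function `(z·w̄)^k / k!` as an element of the Fock space. -/
def kerCompF (p a : ℝ) [hp : Fact (1 < p)] (k : ℕ) (w : Cn n) : FockSpace n p (a * p) :=
  mkFock (kerComp k w) ((contDiff_kerComp k w).differentiable (by simp))
    (wnorm_ne_top_of_growth (one_pos.trans hp.out) a _ _ (norm_kerComp_le k w))

theorem coe_kerF (p a : ℝ) [hp : Fact (1 < p)] (w : Cn n) :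
    ((kerF p a w : FockSpace n p (a * p)) : Cn n → ℂ) = ker w := rfl

theorem coe_kerCompF (p a : ℝ) [hp : Fact (1 < p)] (k : ℕ) (w : Cn n) :
    ((kerCompF p a k w : FockSpace n p (a * p)) : Cn n → ℂ) = kerComp k w := rfl

theorem hasSum_kerCompF (p a : ℝ) [hp : Fact (1 < p)] (w : Cn n) :
    HasSum (fun k => (kerCompF p a k w : FockSpace n p (a * p))) (kerF p a w) := by
  obtain ⟨C, hC, h⟩ := exists_wnorm_le_of_growth (n := n) (one_pos.trans hp.out) a (2 * ‖w‖)
  have hs : Summable fun k => (kerCompF p a k w : FockSpace n p (a * p)) := by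
    refine Summable.of_norm_bounded (g := fun k : ℕ => C * (1 / 2) ^ k)
      (summable_geometric_two.mul_left C) fun k => ?_
    exact norm_le_of_wnorm_le _ (by positivity) (h _ _ (norm_kerComp_le k w))
  have heq : ∑' k, (kerCompF p a k w : FockSpace n p (a * p)) = kerF p a w := by
    refine FockSpace.ext fun z => ?_
    -- Point evaluations are continuous, so the norm limit is identified by its pointwise values.
    have h1 := hs.hasSum.mapL (evalL p a z)
    exact h1.unique (hasSum_kerComp w z)
  rw [← heq]
  exact hs.hasSum

theorem expIntegrable_of_growth {A M : ℝ} {F : Cn n → ℂ} (hc : Continuous F)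
    (h : ∀ z, ‖F z‖ ≤ M * Real.exp (A * ‖z‖)) : ExpIntegrable F :=
  ExpIntegrable.of_wnorm one_lt_two hc.aemeasurable (wnorm_ne_top_of_growth two_pos 0 A M h)

/-- A homogeneous polynomial of degree `k` is reproduced by `(z·w̄)^k / k!`. -/
theorem integral_integrand_kerComp {P : Cn n → ℂ} {k : ℕ} (hP : ContDiff ℂ ∞ P)
    (hPe : ExpIntegrable P) (h : ∀ (t : ℂ) z, P (t • z) = t ^ k * P z) (w : Cn n) :
    ∫ z, integrand (kerComp k w) P z ∂(V n) = starRingEnd ℂ (P w) := by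
  have h1 : ∀ z, integrand P (ker w) z =
      P z * Complex.exp (inner ℂ z w) * (Real.exp (-‖z‖ ^ 2) : ℂ) := by
    intro z
    rw [integrand, ker, ← Complex.exp_conj, inner_conj_symm]
  -- The reproducing formula involves the whole kernel; paired with P, only its component of degree
  -- k survives.
  have h2 := integral_integrand_eq_homComp measurePreserving_rot_V hP.continuous h
    (contDiff_ker w) (by simpa only [funext h1] using hPe.integrable_kernel w)
  have h3 : ∫ z, integrand P (ker w) z ∂(V n) = P w := by
    conv_rhs => rw [← proj_eq_self (hP.differentiable (by simp)) hPe]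
    simp only [h1]
    rfl
  rw [← h3, h2, ← integral_conj]
  refine integral_congr_ae (Eventually.of_forall fun z => ?_)
  simp only [integrand, homComp_ker, map_mul, Complex.conj_conj, Complex.conj_ofReal]
  ring

/-- The ratio of `⟨f, g⟩_σ` and `(f, g)_0` on the homogeneous polynomials of degree `k`. -/
def coef (n : ℕ) (σ : ℝ) (k : ℕ) : ℝ :=
  if k < cut n σ then 1 else Real.Gamma (n + k - σ / 2) / Real.Gamma (n + k)

theorem pos_of_cut_le {σ : ℝ} {k : ℕ} (h : cut n σ ≤ k) : 0 < n + k - σ / 2 := by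
  have h1 := lt_cut n σ
  have h2 : (cut n σ : ℝ) ≤ k := by exact_mod_cast h
  linarith

theorem coef_pos (hn : 1 ≤ n) (σ : ℝ) (k : ℕ) : 0 < coef n σ k := by
  unfold coef
  split_ifs with h
  · exact one_pos
  · have hnk : (0 : ℝ) < n + k := by
      have : (1 : ℝ) ≤ n := by exact_mod_cast hn
      positivity
    exact div_pos (Real.Gamma_pos_of_pos (pos_of_cut_le (not_lt.1 h))) (Real.Gamma_pos_of_pos hnk)

theorem lowSum_of_homogeneous {P : Cn n → ℂ} (hP : ContDiff ℂ ∞ P) {j : ℕ}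
    (h : ∀ (t : ℂ) z, P (t • z) = t ^ j * P z) (N : ℕ) :
    lowSum N P = if j < N then P else 0 := by
  funext z
  simp only [lowSum, homComp_of_homogeneous hP h, Finset.sum_ite_eq', Finset.mem_range]
  split_ifs <;> rfl

theorem highSum_of_homogeneous {P : Cn n → ℂ} (hP : ContDiff ℂ ∞ P) {j : ℕ}
    (h : ∀ (t : ℂ) z, P (t • z) = t ^ j * P z) (N : ℕ) :
    highSum N P = if j < N then 0 else P := by
  funext z
  rw [highSum, lowSum_of_homogeneous hP h]
  split_ifs <;> simp

theorem expIntegrable_homComp {p a : ℝ} [hp : Fact (1 < p)] (g : FockSpace n p (a * p)) (k : ℕ) :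
    ExpIntegrable (homComp g k) := by
  obtain ⟨C, hC, h⟩ := exists_norm_homComp_le (n := n) p a one_pos
  refine expIntegrable_of_growth (A := k) (M := C * ‖g‖) (contDiff_homComp g k).continuous
    fun z => (h g k z).trans ?_
  rw [div_one, Real.exp_nat_mul]
  gcongr
  linarith [Real.add_one_le_exp ‖z‖]

/-- The diagonal form of the pairing. A homogeneous first argument leaves only one of the two terms,
orthogonality reduces g to g_k, the radial integrals give the scalar, and the kernel component
reproduces g_k(w). Injectivity and surjectivity both rest on this identity. -/
theorem pairing_kerComp (hn : 1 ≤ n) {p q : ℝ} [hp : Fact (1 < p)] [hq : Fact (1 < q)]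
    (hpq : p.HolderConjugate q) {a b : ℝ} (k : ℕ) (w : Cn n) (g : FockSpace n q (b * q)) :
    pairing (a + b) (kerCompF p a k w : FockSpace n p (a * p)) g =
      coef n (a + b) k * starRingEnd ℂ (homComp g k w) := by
  have hk := contDiff_kerComp k w
  have hks := kerComp_smul k w
  have hrep := integral_integrand_kerComp (contDiff_homComp g k) (expIntegrable_homComp g k)
    (homComp_smul g k) w
  have i1 := integrable_lowSum hpq (cut n (a + b)) (kerCompF p a k w) g
  have i2 := integrable_highSum hn hpq (lt_cut n (a + b)) (kerCompF p a k w) g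
  rw [coe_kerCompF] at *
  rw [pairing_eq, coef]
  rw [lowSum_of_homogeneous hk hks, highSum_of_homogeneous hk hks] at *
  have hz : ∀ (τ : ℝ) (φ : Cn n → ℂ), intPairing τ 0 φ = 0 := by
    intro τ φ; simp [intPairing, integrand]
  split_ifs with h
  · rw [if_pos h] at i1
    rw [hz, add_zero, intPairing, integral_integrand_eq_homComp (measurePreserving_rot_W 0)
      hk.continuous hks (contDiff_lowSum _ g) i1, Complex.ofReal_one, one_mul, ← hrep, W_zero]
    have : homComp (lowSum (cut n (a + b)) g) k = homComp g k := by
      funext z; rw [homComp_lowSum, if_pos h]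
    rw [this]
  · rw [if_neg h] at i2
    rw [hz, zero_add, intPairing, integral_integrand_eq_homComp (measurePreserving_rot_W _)
      hk.continuous hks (contDiff_highSum _ g.smooth) i2, ← hrep]
    have : homComp (highSum (cut n (a + b)) g) k = homComp g k := by
      funext z; rw [homComp_highSum _ g.smooth, if_neg h]
    rw [this]
    refine integral_W_mul_Gamma hn (pos_of_cut_le (not_lt.1 h))
      (H := fun z => kerComp k w z * starRingEnd ℂ (homComp g k z)) fun r z hr => ?_
    have hr' : r • z = (r : ℂ) • z := (Complex.coe_smul r z).symm
    rw [hr', hks, homComp_smul, map_mul, map_pow, Complex.conj_ofReal]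
    ring

end Fock
end

/-! ### Kernels in the Fock space and the transform of a functional -/

noncomputable section

namespace Fock

open Filter Topology
open scoped ENNReal NNReal ContDiff

variable {n : ℕ}

theorem norm_inner_mul_ker_le (w h z : Cn n) :
    ‖inner ℂ h z * ker w z‖ ≤ ‖h‖ * Real.exp ((‖w‖ + 1) * ‖z‖) := by
  rw [norm_mul, add_mul, one_mul, add_comm, Real.exp_add, ← mul_assoc]
  gcongr
  · refine (norm_inner_le_norm h z).trans ?_
    gcongr
    linarith [Real.add_one_le_exp ‖z‖]
  · exact norm_ker_le w z

/-- The second-order Taylor remainder of e^{z·h̄}, with a bound of exponential type. It makes w ↦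
e^{z·w̄} differentiable in norm, with conjugate-linear derivative. -/
theorem norm_ker_add_sub_le {w h : Cn n} (hh : ‖h‖ ≤ 1) (z : Cn n) :
    ‖ker (w + h) z - ker w z - inner ℂ h z * ker w z‖ ≤
      ‖h‖ ^ 2 * Real.exp ((‖w‖ + 3) * ‖z‖) := by
  have e : ker (w + h) z - ker w z - inner ℂ h z * ker w z =
      ker w z * (Complex.exp (inner ℂ h z) - ∑ m ∈ Finset.range 2, inner ℂ h z ^ m / m.factorial) := by
    simp only [ker, inner_add_left, Complex.exp_add, Finset.sum_range_succ, Finset.sum_range_zero]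
    simp
    ring
  have h1 := Complex.norm_exp_sub_sum_le_norm_mul_exp (inner ℂ h z) 2
  have h2 : ‖(inner ℂ h z : ℂ)‖ ≤ ‖h‖ * ‖z‖ := norm_inner_le_norm h z
  have h3 : ‖z‖ ≤ Real.exp ‖z‖ := by linarith [Real.add_one_le_exp ‖z‖]
  rw [e, norm_mul]
  calc ‖ker w z‖ * ‖Complex.exp (inner ℂ h z) -
        ∑ m ∈ Finset.range 2, inner ℂ h z ^ m / m.factorial‖
      ≤ Real.exp (‖w‖ * ‖z‖) * ((‖h‖ * ‖z‖) ^ 2 * Real.exp ‖z‖) := by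
        refine mul_le_mul (norm_ker_le w z) (h1.trans ?_) (norm_nonneg _) (Real.exp_pos _).le
        gcongr
        exact h2.trans (mul_le_of_le_one_left (norm_nonneg z) hh)
    _ ≤ Real.exp (‖w‖ * ‖z‖) * ((‖h‖ * Real.exp ‖z‖) ^ 2 * Real.exp ‖z‖) := by gcongr
    _ = _ := by
        have : (‖w‖ + 3) * ‖z‖ = ‖w‖ * ‖z‖ + ‖z‖ + ‖z‖ + ‖z‖ := by ring
        rw [this, Real.exp_add, Real.exp_add, Real.exp_add]
        ring

section Fock

variable {p a : ℝ} [hp : Fact (1 < p)]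

/-- The function `z ↦ (z·h̄) e^{z·w̄}` as an element of the Fock space. -/
def dkerF (p a : ℝ) [hp : Fact (1 < p)] (w h : Cn n) : FockSpace n p (a * p) :=
  mkFock (fun z => inner ℂ h z * ker w z)
    (((contDiff_inner_right h).mul (contDiff_ker w)).differentiable (by simp))
    (wnorm_ne_top_of_growth (one_pos.trans hp.out) a _ _ (norm_inner_mul_ker_le w h))

theorem exists_norm_kerF_sub_le (w : Cn n) :
    ∃ C : ℝ, 0 ≤ C ∧ ∀ h : Cn n, ‖h‖ ≤ 1 →
      ‖(kerF p a (w + h) - kerF p a w - dkerF p a w h : FockSpace n p (a * p))‖ ≤ C * ‖h‖ ^ 2 := by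
  obtain ⟨C, hC, hb⟩ := exists_wnorm_le_of_growth (n := n) (one_pos.trans hp.out) a (‖w‖ + 3)
  refine ⟨C, hC, fun h hh => norm_le_of_wnorm_le _ (by positivity) (hb _ _ ?_)⟩
  exact norm_ker_add_sub_le hh

theorem exists_norm_dkerF_le (w : Cn n) :
    ∃ C : ℝ, 0 ≤ C ∧ ∀ h : Cn n, ‖(dkerF p a w h : FockSpace n p (a * p))‖ ≤ C * ‖h‖ := by
  obtain ⟨C, hC, hb⟩ := exists_wnorm_le_of_growth (n := n) (one_pos.trans hp.out) a (‖w‖ + 1)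
  exact ⟨C, hC, fun h => norm_le_of_wnorm_le _ (by positivity)
    (hb _ _ (norm_inner_mul_ker_le w h))⟩

theorem continuous_kerF : Continuous (kerF p a : Cn n → FockSpace n p (a * p)) := by
  refine continuous_iff_continuousAt.2 fun w => ?_
  obtain ⟨C, hC, h₁⟩ := exists_norm_kerF_sub_le (p := p) (a := a) w
  obtain ⟨D, hD, h₂⟩ := exists_norm_dkerF_le (p := p) (a := a) w
  rw [ContinuousAt, tendsto_iff_norm_sub_tendsto_zero]
  have hlim : Tendsto (fun v : Cn n => C * ‖v - w‖ ^ 2 + D * ‖v - w‖) (𝓝 w) (𝓝 0) := by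
    have : Continuous fun v : Cn n => C * ‖v - w‖ ^ 2 + D * ‖v - w‖ := by fun_prop
    simpa using this.tendsto w
  refine squeeze_zero' (Eventually.of_forall fun v => norm_nonneg _) ?_ hlim
  filter_upwards [Metric.ball_mem_nhds w one_pos] with v hv
  have hv' : ‖v - w‖ ≤ 1 := (mem_ball_iff_norm.1 hv).le
  have e := h₁ (v - w) hv'
  rw [add_sub_cancel] at e
  calc ‖(kerF p a v - kerF p a w : FockSpace n p (a * p))‖
      = ‖(kerF p a v - kerF p a w - dkerF p a w (v - w)) + dkerF p a w (v - w)‖ := by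
        rw [sub_add_cancel]
    _ ≤ _ := norm_add_le_of_le e (h₂ _)

/-- The function `w ↦ conj (L (e^{z·w̄}))` attached to a functional `L`. -/
def transform (L : StrongDual ℂ (FockSpace n p (a * p))) (w : Cn n) : ℂ :=
  starRingEnd ℂ (L (kerF p a w))

/-- The kernel depends antiholomorphically on w, and the conjugation in `transform` turns this into
holomorphy. -/
theorem differentiable_transform (L : StrongDual ℂ (FockSpace n p (a * p))) :
    Differentiable ℂ (transform L) := by
  intro w
  let D : Cn n →ₗ[ℂ] ℂ :=
    { toFun := fun h => starRingEnd ℂ (L (dkerF p a w h))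
      map_add' := fun h₁ h₂ => by
        have : (dkerF p a w (h₁ + h₂) : FockSpace n p (a * p)) =
            dkerF p a w h₁ + dkerF p a w h₂ :=
          FockSpace.ext fun z => by simp [dkerF, add_mul]
        rw [this, map_add, map_add]
      map_smul' := fun c h => by
        have : (dkerF p a w (c • h) : FockSpace n p (a * p)) = starRingEnd ℂ c • dkerF p a w h :=
          FockSpace.ext fun z => by
            simp only [dkerF, mkFock_apply, inner_smul_left, FockSpace.smul_apply, mul_assoc]
        rw [this, map_smul, smul_eq_mul, map_mul, Complex.conj_conj]
        rfl }
  obtain ⟨C, hC, h₁⟩ := exists_norm_kerF_sub_le (p := p) (a := a) w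
  have : HasFDerivAt (transform L) (LinearMap.toContinuousLinearMap D) w := by
    rw [hasFDerivAt_iff_isLittleO_nhds_zero]
    refine Asymptotics.IsBigO.trans_isLittleO (g := fun h : Cn n => ‖h‖ ^ 2) ?_
      (Asymptotics.isLittleO_norm_pow_id one_lt_two)
    refine Asymptotics.IsBigO.of_bound (‖L‖ * C) ?_
    filter_upwards [Metric.ball_mem_nhds (0 : Cn n) one_pos] with h hh
    have hh' : ‖h‖ ≤ 1 := by simpa using (Metric.mem_ball.1 hh).le
    have e : transform L (w + h) - transform L w - LinearMap.toContinuousLinearMap D h =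
        starRingEnd ℂ (L (kerF p a (w + h) - kerF p a w - dkerF p a w h)) := by
      simp only [transform, map_sub]
      rfl
    rw [e, Complex.norm_conj, norm_pow, norm_norm, mul_assoc]
    exact L.le_opNorm_of_le (h₁ h hh')
  exact this.differentiableAt

/-- For bounded φ with bounded support, `proj φ` is a Bochner integral of kernels in the Fock space,
so any L passes under the integral sign. -/
theorem exists_fock_eq_proj {φ : Cn n → ℂ} (hφ : Measurable φ) {M R : ℝ} (hM : ∀ w, ‖φ w‖ ≤ M)
    (hR : ∀ w, R < ‖w‖ → φ w = 0) :
    ∃ u : FockSpace n p (a * p), (∀ z, u z = proj φ z) ∧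
      ∀ L : StrongDual ℂ (FockSpace n p (a * p)),
        L u = ∫ w, φ w * (Real.exp (-‖w‖ ^ 2) : ℂ) * L (kerF p a w) ∂(V n) := by
  let v : Cn n → FockSpace n p (a * p) := fun w => (Real.exp (-‖w‖ ^ 2) : ℂ) • kerF p a w
  have hv : Continuous v := by
    have := continuous_kerF (n := n) (p := p) (a := a)
    unfold v; fun_prop
  have hi : Integrable (fun w => φ w • v w) (V n) := by
    have h1 : IntegrableOn (fun w => φ w • v w) (Metric.closedBall 0 R) (V n) :=
      Integrable.bdd_smul
        (hv.continuousOn.integrableOn_compact (isCompact_closedBall 0 R)) M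
        hφ.aestronglyMeasurable (Eventually.of_forall hM)
    refine (integrableOn_iff_integrable_of_support_subset fun w hw => ?_).1 h1
    by_contra hc
    have : φ w = 0 := hR w (by simpa using hc)
    exact hw (by simp [this])
  have hL : ∀ L : StrongDual ℂ (FockSpace n p (a * p)), L (∫ w, φ w • v w ∂(V n)) =
      ∫ w, φ w * (Real.exp (-‖w‖ ^ 2) : ℂ) * L (kerF p a w) ∂(V n) := by
    intro L
    rw [← L.integral_comp_comm hi]
    refine integral_congr_ae (Eventually.of_forall fun w => ?_)
    simp only [v, map_smul, smul_eq_mul, mul_assoc]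
  refine ⟨∫ w, φ w • v w ∂(V n), fun z => ?_, hL⟩
  have := hL (evalL p a z)
  simp only [evalL_apply] at this
  rw [this, proj]
  refine integral_congr_ae (Eventually.of_forall fun w => ?_)
  simp only [coe_kerF, ker]
  ring

theorem enorm_ofReal_exp (x : ℝ) : ‖(Real.exp x : ℂ)‖ₑ = ENNReal.ofReal (Real.exp x) := by
  rw [← ofReal_norm, norm_ofReal_exp]

/-- From 2 Re⟨w,z⟩ = |z|² + |w|² - |z-w|²: after Gaussian normalization the kernel has modulus
exp(-|z-w|²/2). -/
theorem norm_ker_mul_exp (w z : Cn n) :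
    ‖Complex.exp (inner ℂ w z)‖ * Real.exp (-‖w‖ ^ 2) * Real.exp (-‖z‖ ^ 2 / 2) =
      Real.exp (-‖w‖ ^ 2 / 2) * Real.exp (-(1 / 2) * ‖z - w‖ ^ 2) := by
  have h := norm_sub_sq (𝕜 := ℂ) z w
  have h2 : RCLike.re (inner ℂ z w : ℂ) = (inner ℂ w z : ℂ).re := inner_re_symm z w
  rw [h2] at h
  rw [Complex.norm_exp, ← Real.exp_add, ← Real.exp_add, ← Real.exp_add, h]
  congr 1
  ring

theorem exists_wnorm_proj_le {p : ℝ} (hp : 1 < p) (a : ℝ) :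
    ∃ C : ℝ, 0 ≤ C ∧ ∀ F : Cn n → ℂ, Measurable F →
      wnorm p a (proj F) ≤ ENNReal.ofReal C * wnorm p a F := by
  obtain ⟨C, hC, h⟩ := exists_wnorm_le_of_kernel (n := n) hp a 0 (c := 1 / 2) (by norm_num)
  refine ⟨C, hC, fun F hF => ?_⟩
  have := h 1 F (proj F) hF fun z => ?_
  · rwa [add_zero, mul_one] at this
  rw [Real.rpow_zero, mul_one, ENNReal.ofReal_one, one_mul]
  refine (mul_le_mul_left (enorm_integral_le_lintegral_enorm _) _).trans (le_of_eq ?_)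
  rw [← lintegral_mul_const' _ _ ENNReal.ofReal_ne_top]
  refine lintegral_congr fun w => ?_
  rw [enorm_mul, enorm_mul, enorm_ofReal_exp, mul_assoc, mul_assoc, ← norm_ker_mul_exp,
    ENNReal.ofReal_mul (by positivity), ENNReal.ofReal_mul (by positivity), ofReal_norm, mul_assoc]

theorem tendsto_wnorm_sub_indicator (f : FockSpace n p (a * p)) :
    Tendsto (fun m : ℕ => wnorm p a (fun w => f w - (Metric.closedBall 0 (m : ℝ)).indicator f w))
      atTop (𝓝 0) := by
  have hp0 : 0 < p := one_pos.trans hp.out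
  have hc := f.continuous
  unfold wnorm
  have h0 : (0 : ℝ≥0∞) = 0 ^ (1 / p) := by
    rw [ENNReal.zero_rpow_of_pos (by positivity)]
  rw [h0]
  refine (ENNReal.continuous_rpow_const.tendsto _).comp ?_
  have hz : ∫⁻ _ : Cn n, (0 : ℝ≥0∞) ∂(V n) = 0 := by simp
  rw [← hz]
  refine tendsto_lintegral_of_dominated_convergence (fun z => (‖f z‖ₑ * ENNReal.ofReal
    (Real.exp (-‖z‖ ^ 2 / 2) * (1 + ‖z‖) ^ (-a))) ^ p) (fun m => ?_) (fun m => ?_) ?_ ?_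
  · have := hc.measurable.indicator (Metric.isClosed_closedBall (x := (0 : Cn n))
      (ε := (m : ℝ))).measurableSet
    fun_prop
  · refine Eventually.of_forall fun w => ?_
    refine ENNReal.rpow_le_rpow (mul_le_mul_left ?_ _) hp0.le
    beta_reduce
    by_cases h : w ∈ Metric.closedBall (0 : Cn n) (m : ℝ)
    · rw [Set.indicator_of_mem h, sub_self, enorm_zero]; exact zero_le
    · rw [Set.indicator_of_notMem h, sub_zero]
  · have := f.wnorm_ne_top
    rw [wnorm] at this
    intro htop
    rw [htop, ENNReal.top_rpow_of_pos (by positivity)] at this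
    exact this rfl
  · refine Eventually.of_forall fun w => ?_
    refine tendsto_const_nhds.congr' ?_
    obtain ⟨m₀, hm₀⟩ := exists_nat_ge ‖w‖
    filter_upwards [eventually_ge_atTop m₀] with m hm
    have h : w ∈ Metric.closedBall (0 : Cn n) (m : ℝ) := by
      rw [mem_closedBall_zero_iff]
      exact hm₀.trans (by exact_mod_cast hm)
    rw [Set.indicator_of_mem h, sub_self, enorm_zero, zero_mul, ENNReal.zero_rpow_of_pos hp0]

/-- The span of the kernels is dense: a functional that vanishes on them is zero. -/
theorem eq_zero_of_kerF (L : StrongDual ℂ (FockSpace n p (a * p)))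
    (h : ∀ w, L (kerF p a w) = 0) : L = 0 := by
  ext f
  obtain ⟨C, hC, hb⟩ := exists_wnorm_proj_le (n := n) hp.out a
  have hm : ∀ m : ℕ, Measurable ((Metric.closedBall 0 (m : ℝ)).indicator f : Cn n → ℂ) :=
    fun m => f.continuous.measurable.indicator Metric.isClosed_closedBall.measurableSet
  have key : ∀ m : ℕ, ‖L f‖ₑ ≤ ENNReal.ofReal ‖L‖ * (ENNReal.ofReal C *
      wnorm p a (fun w => f w - (Metric.closedBall 0 (m : ℝ)).indicator f w)) := by
    intro m
    obtain ⟨M, hM⟩ := (isCompact_closedBall (0 : Cn n) (m : ℝ)).exists_bound_of_continuousOn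
      f.continuous.continuousOn
    have hM' : ∀ w, ‖(Metric.closedBall 0 (m : ℝ)).indicator f w‖ ≤ max M 0 := by
      intro w
      by_cases hw : w ∈ Metric.closedBall (0 : Cn n) (m : ℝ)
      · rw [Set.indicator_of_mem hw]; exact (hM w hw).trans (le_max_left _ _)
      · rw [Set.indicator_of_notMem hw, norm_zero]; exact le_max_right _ _
    -- Here u is a superposition of kernels, so L u = 0, while f - u is the projection of the part
    -- of f outside the ball, whose norm tends to zero.
    obtain ⟨u, hu, hL⟩ := exists_fock_eq_proj (p := p) (a := a) (hm m) hM' (R := m) fun w hw => by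
      rw [Set.indicator_of_notMem]; simpa using hw
    have h0 : L u = 0 := by rw [hL]; simp [h]
    have hfu : ((f - u : FockSpace n p (a * p)) : Cn n → ℂ) =
        proj (fun w => f w - (Metric.closedBall 0 (m : ℝ)).indicator f w) := by
      funext z
      have e1 : f z = proj f z := (congrFun f.proj_eq z).symm
      rw [FockSpace.sub_apply, hu, e1]
      simp only [proj, sub_mul]
      refine (integral_sub (f.expIntegrable.integrable_kernel z) ?_).symm
      refine Integrable.mono (f.expIntegrable.integrable_kernel z) ?_ ?_
      · have := hm m
        exact Measurable.aestronglyMeasurable (by fun_prop)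
      · refine Eventually.of_forall fun w => ?_
        rw [norm_mul, norm_mul, norm_mul, norm_mul]
        gcongr
        exact norm_indicator_le_norm_self _ _
    have h1 : L f = L (f - u) := by rw [map_sub, h0, sub_zero]
    have h2 : ‖L f‖ ≤ ‖L‖ * ‖f - u‖ := by rw [h1]; exact L.le_opNorm _
    rw [← ofReal_norm]
    refine (ENNReal.ofReal_le_ofReal h2).trans ?_
    rw [ENNReal.ofReal_mul (norm_nonneg _), ← wnorm_coe, hfu]
    gcongr
    exact hb _ (f.continuous.measurable.sub (hm m))
  have hlim := ENNReal.Tendsto.const_mul (a := ENNReal.ofReal ‖L‖)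
    (ENNReal.Tendsto.const_mul (a := ENNReal.ofReal C) (tendsto_wnorm_sub_indicator f)
    (Or.inr ENNReal.ofReal_ne_top)) (Or.inr ENNReal.ofReal_ne_top)
  rw [mul_zero, mul_zero] at hlim
  have := ge_of_tendsto' hlim key
  simpa using this

/-- Duality: L is tested on the projection of the function that is extremal in Hölder's inequality
for g. The bounded projection controls the norm of the test function, and L of it is the integral of
the q-th power of the weighted modulus of g. -/
theorem exists_wnorm_transform_le {q : ℝ} (hpq : p.HolderConjugate q) (a : ℝ) :
    ∃ C : ℝ, 0 ≤ C ∧ ∀ L : StrongDual ℂ (FockSpace n p (a * p)),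
      wnorm q (-a) (transform L) ≤ ENNReal.ofReal (C * ‖L‖) := by
  have hp0 : 0 < p := hpq.pos
  have hq0 : 0 < q := hpq.symm.pos
  have hq1 : 1 < q := hpq.symm.lt
  obtain ⟨C, hC, hb⟩ := exists_wnorm_proj_le (n := n) hp.out a
  refine ⟨C, hC, fun L => ?_⟩
  set g := transform L
  have hg : Continuous g := (differentiable_transform L).continuous
  let T : Cn n → ℝ := fun w => ‖g w‖ * (Real.exp (-‖w‖ ^ 2 / 2) * (1 + ‖w‖) ^ a)
  have hT0 : ∀ w, 0 ≤ T w := fun w => by unfold T; positivity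
  have hTc : Continuous T := by
    have : Continuous fun w : Cn n => (1 + ‖w‖) ^ a :=
      Continuous.rpow_const (by fun_prop) fun w => Or.inl (by positivity)
    unfold T; fun_prop
  have hTe : ∀ w, ‖g w‖ₑ * ENNReal.ofReal (Real.exp (-‖w‖ ^ 2 / 2) * (1 + ‖w‖) ^ (- -a)) =
      ENNReal.ofReal (T w) := by
    intro w
    rw [neg_neg, ENNReal.ofReal_mul (norm_nonneg _), ofReal_norm]
  have key : ∀ m : ℕ, ∫⁻ w in Metric.closedBall 0 (m : ℝ), ENNReal.ofReal (T w) ^ q ∂(V n) ≤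
      ENNReal.ofReal (C * ‖L‖) ^ q := by
    intro m
    set B : Set (Cn n) := Metric.closedBall 0 (m : ℝ)
    have hB : MeasurableSet B := Metric.isClosed_closedBall.measurableSet
    -- It has the phase of g and weighted modulus T^(q-1), and (q-1)p = q. Where g vanishes, the
    -- convention 0/0 = 0 gives φ₀ = 0.
    let φ₀ : Cn n → ℂ := fun w => (g w / ‖g w‖) *
      ((T w ^ (q - 1) * (Real.exp (‖w‖ ^ 2 / 2) * (1 + ‖w‖) ^ a) : ℝ) : ℂ)
    let S : Cn n → ℝ := fun w => T w ^ (q - 1) * (Real.exp (‖w‖ ^ 2 / 2) * (1 + ‖w‖) ^ a)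
    have hS0 : ∀ w, 0 ≤ S w := fun w => by have := hT0 w; unfold S; positivity
    have hSc : Continuous S := by
      have h1 : Continuous fun w : Cn n => (1 + ‖w‖) ^ a :=
        Continuous.rpow_const (by fun_prop) fun w => Or.inl (by positivity)
      have h2 : Continuous fun w : Cn n => T w ^ (q - 1) :=
        hTc.rpow_const fun w => Or.inr (by linarith)
      unfold S; fun_prop
    have hφ₀ : ∀ w, ‖φ₀ w‖ ≤ S w := by
      intro w
      have h1 : ‖g w / (‖g w‖ : ℂ)‖ ≤ 1 := by
        rw [norm_div, Complex.norm_real, norm_norm]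
        exact div_self_le_one _
      calc ‖φ₀ w‖ = ‖g w / (‖g w‖ : ℂ)‖ * S w := by
            rw [norm_mul, Complex.norm_real, Real.norm_of_nonneg (hS0 w)]
        _ ≤ 1 * S w := mul_le_mul_of_nonneg_right h1 (hS0 w)
        _ = S w := one_mul _
    have hφm : Measurable φ₀ := by
      have h1 := hSc.measurable
      have h2 := hg.measurable
      exact (h2.div (Complex.measurable_ofReal.comp h2.norm)).mul (Complex.measurable_ofReal.comp h1)
    obtain ⟨M, hM⟩ := (isCompact_closedBall (0 : Cn n) (m : ℝ)).exists_bound_of_continuousOn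
      hSc.continuousOn
    have hM' : ∀ w, ‖B.indicator φ₀ w‖ ≤ max M 0 := by
      intro w
      by_cases hw : w ∈ B
      · rw [Set.indicator_of_mem hw]
        exact ((hφ₀ w).trans ((le_abs_self _).trans (hM w hw))).trans (le_max_left _ _)
      · rw [Set.indicator_of_notMem hw, norm_zero]; exact le_max_right _ _
    obtain ⟨u, hu, hL⟩ := exists_fock_eq_proj (p := p) (a := a) (hφm.indicator hB) hM' (R := m)
      fun w hw => by rw [Set.indicator_of_notMem]; simpa [B] using hw
    have hpair : ∀ w, φ₀ w * (Real.exp (-‖w‖ ^ 2) : ℂ) * L (kerF p a w) = ((T w ^ q : ℝ) : ℂ) := by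
      intro w
      have h1 : L (kerF p a w) = starRingEnd ℂ (g w) := by
        simp [g, transform]
      rcases eq_or_ne (g w) 0 with h0 | h0
      · have : T w = 0 := by simp [T, h0]
        rw [h1, h0, this, Real.zero_rpow hq0.ne']; simp
      · have hn : (‖g w‖ : ℂ) ≠ 0 := by simpa using h0
        have hTpos : 0 < T w := by
          have : 0 < ‖g w‖ := norm_pos_iff.2 h0
          unfold T; positivity
        have h2 : T w ^ q = T w ^ (q - 1) * T w := by
          rw [← Real.rpow_add_one hTpos.ne']; congr 1; ring
        have h3 : Real.exp (‖w‖ ^ 2 / 2) * Real.exp (-‖w‖ ^ 2) = Real.exp (-‖w‖ ^ 2 / 2) := by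
          rw [← Real.exp_add]; congr 1; ring
        have h4 : g w * starRingEnd ℂ (g w) = (‖g w‖ : ℂ) * ‖g w‖ := by
          rw [Complex.mul_conj, Complex.normSq_eq_norm_sq]; push_cast; ring
        have h5 : g w / (‖g w‖ : ℂ) * starRingEnd ℂ (g w) = ‖g w‖ := by
          rw [div_mul_eq_mul_div, h4, mul_div_cancel_right₀ _ hn]
        rw [h1, h2]
        calc φ₀ w * (Real.exp (-‖w‖ ^ 2) : ℂ) * starRingEnd ℂ (g w)
            = (g w / (‖g w‖ : ℂ) * starRingEnd ℂ (g w)) *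
              ((T w ^ (q - 1) * (1 + ‖w‖) ^ a *
                (Real.exp (‖w‖ ^ 2 / 2) * Real.exp (-‖w‖ ^ 2)) : ℝ) : ℂ) := by
              simp only [φ₀]; push_cast; ring
          _ = _ := by
              rw [h5, h3]; simp only [T]; push_cast; ring
    set A := ∫⁻ w in B, ENNReal.ofReal (T w) ^ q ∂(V n)
    have hTq : ∀ w, ENNReal.ofReal (T w) ^ q = ENNReal.ofReal (T w ^ q) := fun w =>
      ENNReal.ofReal_rpow_of_nonneg (hT0 w) hq0.le
    have hTqc : Continuous fun w => T w ^ q := hTc.rpow_const fun w => Or.inr hq0.le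
    have hAi : IntegrableOn (fun w => T w ^ q) B (V n) :=
      hTqc.continuousOn.integrableOn_compact (isCompact_closedBall 0 _)
    have hA : A = ENNReal.ofReal (∫ w in B, T w ^ q ∂(V n)) := by
      rw [ofReal_integral_eq_lintegral_ofReal hAi
        (Eventually.of_forall fun w => Real.rpow_nonneg (hT0 w) q)]
      simp only [A, hTq]
    have hLu : L u = ((∫ w in B, T w ^ q ∂(V n) : ℝ) : ℂ) := by
      rw [hL, ← integral_complex_ofReal, ← integral_indicator hB]
      refine integral_congr_ae (Eventually.of_forall fun w => ?_)
      by_cases hw : w ∈ B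
      · simp only [Set.indicator_of_mem hw]; exact hpair w
      · simp only [Set.indicator_of_notMem hw]; simp
    have hAn : 0 ≤ ∫ w in B, T w ^ q ∂(V n) :=
      setIntegral_nonneg hB fun w _ => Real.rpow_nonneg (hT0 w) q
    have hφn : wnorm p a (B.indicator φ₀) ≤ A ^ (1 / p) := by
      refine ENNReal.rpow_le_rpow ?_ (by positivity)
      simp only [A]
      rw [← lintegral_indicator hB]
      refine lintegral_mono fun w => ?_
      by_cases hw : w ∈ B
      · rw [Set.indicator_of_mem hw, Set.indicator_of_mem hw]
        have hpq' : (q - 1) * p = q := by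
          have := hpq.symm.sub_one_mul_conj
          linarith
        rw [← hpq', ENNReal.rpow_mul]
        refine ENNReal.rpow_le_rpow ?_ hp0.le
        rw [ENNReal.ofReal_rpow_of_nonneg (hT0 w) (by linarith), ← ofReal_norm,
          ← ENNReal.ofReal_mul (norm_nonneg _)]
        refine ENNReal.ofReal_le_ofReal ?_
        have h1w : (0 : ℝ) < 1 + ‖w‖ := by positivity
        calc ‖φ₀ w‖ * (Real.exp (-‖w‖ ^ 2 / 2) * (1 + ‖w‖) ^ (-a))
            ≤ S w * (Real.exp (-‖w‖ ^ 2 / 2) * (1 + ‖w‖) ^ (-a)) := by gcongr; exact hφ₀ w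
          _ = T w ^ (q - 1) * ((Real.exp (‖w‖ ^ 2 / 2) * Real.exp (-‖w‖ ^ 2 / 2)) *
              ((1 + ‖w‖) ^ a * (1 + ‖w‖) ^ (-a))) := by simp only [S]; ring
          _ = _ := by
            rw [← Real.exp_add, ← Real.rpow_add h1w]
            have : ‖w‖ ^ 2 / 2 + -‖w‖ ^ 2 / 2 = 0 := by ring
            rw [this, add_neg_cancel, Real.exp_zero, Real.rpow_zero, mul_one, mul_one]
      · rw [Set.indicator_of_notMem hw, Set.indicator_of_notMem hw, enorm_zero, zero_mul,
          ENNReal.zero_rpow_of_pos hp0]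
    have hun : ENNReal.ofReal ‖u‖ ≤ ENNReal.ofReal C * A ^ (1 / p) := by
      have : ((u : FockSpace n p (a * p)) : Cn n → ℂ) = proj (B.indicator φ₀) := funext hu
      rw [← wnorm_coe, this]
      exact (hb _ (hφm.indicator hB)).trans (mul_le_mul_right hφn _)
    have hmain : A ≤ ENNReal.ofReal (C * ‖L‖) * A ^ (1 / p) := by
      have h1 : ∫ w in B, T w ^ q ∂(V n) ≤ ‖L‖ * ‖u‖ := by
        have := L.le_opNorm u
        rwa [hLu, Complex.norm_real, Real.norm_of_nonneg hAn] at this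
      rw [hA] at *
      refine (ENNReal.ofReal_le_ofReal h1).trans ?_
      rw [ENNReal.ofReal_mul (norm_nonneg _), mul_comm C, ENNReal.ofReal_mul (norm_nonneg _),
        mul_assoc]
      gcongr
    -- Truncation to a ball makes A finite, so A^(1/p) can be cancelled in A ≤ C‖L‖ A^(1/p).
    have hAtop : A ≠ ⊤ := by rw [hA]; exact ENNReal.ofReal_ne_top
    rcases eq_or_ne A 0 with hA0 | hA0
    · rw [hA0]; exact zero_le
    have hsum : 1 / p + 1 / q = 1 := by simpa using hpq.inv_add_inv_eq_one
    have h2 : A ^ (1 / q) ≤ ENNReal.ofReal (C * ‖L‖) := by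
      have h3 : A = A ^ (1 / q) * A ^ (1 / p) := by
        rw [← ENNReal.rpow_add _ _ hA0 hAtop, add_comm, hsum, ENNReal.rpow_one]
      have hne : A ^ (1 / p) ≠ 0 := by
        simp [hA0, hp0, ENNReal.rpow_eq_zero_iff, hAtop]
      have hnt : A ^ (1 / p) ≠ ⊤ := ENNReal.rpow_ne_top_of_nonneg (by positivity) hAtop
      nth_rewrite 1 [h3] at hmain
      exact (ENNReal.mul_le_mul_iff_left hne hnt).1 hmain
    calc A = (A ^ (1 / q)) ^ q := by
          rw [← ENNReal.rpow_mul, one_div_mul_cancel hq0.ne', ENNReal.rpow_one]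
      _ ≤ _ := ENNReal.rpow_le_rpow h2 hq0.le
  have hfull : ∫⁻ w, ENNReal.ofReal (T w) ^ q ∂(V n) ≤ ENNReal.ofReal (C * ‖L‖) ^ q := by
    have hcov : AECover (V n) atTop fun m : ℕ => Metric.closedBall (0 : Cn n) (m : ℝ) :=
      aecover_closedBall tendsto_natCast_atTop_atTop
    have hm : Measurable fun w => ENNReal.ofReal (T w) ^ q := by
      have := hTc.measurable
      fun_prop
    exact le_of_tendsto' (hcov.lintegral_tendsto_of_countably_generated hm.aemeasurable) key
  rw [wnorm]
  simp only [hTe]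
  calc _ ≤ (ENNReal.ofReal (C * ‖L‖) ^ q) ^ (1 / q) := ENNReal.rpow_le_rpow hfull (by positivity)
    _ = _ := by rw [← ENNReal.rpow_mul, mul_one_div_cancel hq0.ne', ENNReal.rpow_one]

theorem homComp_transform (L : StrongDual ℂ (FockSpace n p (a * p)))
    (h : ContDiff ℂ ∞ (transform L)) (k : ℕ) (w : Cn n) :
    homComp (transform L) k w = starRingEnd ℂ (L (kerCompF p a k w)) := by
  refine homComp_eq_of_hasSum h (c := fun k => starRingEnd ℂ (L (kerCompF p a k w)))
    (fun t => ?_) k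
  have hc : (fun k => t ^ k * starRingEnd ℂ (L (kerCompF p a k w))) = fun k =>
      starRingEnd ℂ (starRingEnd ℂ t ^ k * L (kerCompF p a k w)) := by
    funext k; rw [map_mul, map_pow, Complex.conj_conj]
  rw [transform, hc, Complex.hasSum_conj, Complex.conj_conj]
  convert! (hasSum_kerCompF p a (t • w)).mapL L using 2 with j
  have e : (kerCompF p a j (t • w) : FockSpace n p (a * p)) =
      starRingEnd ℂ t ^ j • kerCompF p a j w :=
    FockSpace.ext fun z => by
      simp only [coe_kerCompF, kerComp, inner_smul_left, mul_pow, mul_div_assoc,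
        FockSpace.smul_apply]
  rw [e, map_smul, smul_eq_mul]

end Fock

end Fock
end

/-! ### Multipliers of homogeneous components -/

noncomputable section

namespace Fock

open Filter Topology
open scoped ENNReal NNReal ContDiff

variable {n : ℕ} {p : ℝ} [hp : Fact (1 < p)]

/-- Multiplying the homogeneous components of degree `k` by `ν k` maps the space with weight
exponent `a` boundedly to that with weight exponent `b`. -/
def MultBound (n : ℕ) (p : ℝ) [hp : Fact (1 < p)] (a b : ℝ) (ν : ℕ → ℝ) : Prop :=
  ∃ C : ℝ, 0 ≤ C ∧ ∀ f : FockSpace n p (a * p), ∃ u : FockSpace n p (b * p),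
    (∀ k z, homComp u k z = ν k * homComp f k z) ∧ ‖u‖ ≤ C * ‖f‖

namespace MultBound

variable {a b c : ℝ} {ν ν' : ℕ → ℝ}

theorem comp (h : MultBound n p a b ν) (h' : MultBound n p b c ν') :
    MultBound n p a c fun k => ν' k * ν k := by
  obtain ⟨C, hC, h⟩ := h
  obtain ⟨C', hC', h'⟩ := h'
  refine ⟨C' * C, by positivity, fun f => ?_⟩
  obtain ⟨u, hu, hun⟩ := h f
  obtain ⟨v, hv, hvn⟩ := h' u
  refine ⟨v, fun k z => by rw [hv, hu]; push_cast; ring, hvn.trans ?_⟩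
  rw [mul_assoc]
  gcongr

theorem add (h : MultBound n p a b ν) (h' : MultBound n p a b ν') :
    MultBound n p a b fun k => ν k + ν' k := by
  obtain ⟨C, hC, h⟩ := h
  obtain ⟨C', hC', h'⟩ := h'
  refine ⟨C + C', by positivity, fun f => ?_⟩
  obtain ⟨u, hu, hun⟩ := h f
  obtain ⟨v, hv, hvn⟩ := h' f
  refine ⟨u + v, fun k z => ?_, (norm_add_le_of_le hun hvn).trans (by rw [add_mul])⟩
  have e : ((u + v : FockSpace n p (b * p)) : Cn n → ℂ) = (u : Cn n → ℂ) + v := rfl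
  rw [e, homComp_add u.smooth v.smooth, hu, hv]
  push_cast; ring

theorem single (n : ℕ) (p : ℝ) [hp : Fact (1 < p)] (a b : ℝ) (j : ℕ) (c : ℝ) :
    MultBound n p a b fun k => if k = j then c else 0 := by
  obtain ⟨C, hC, h⟩ := exists_norm_homComp_le (n := n) p a one_pos
  obtain ⟨D, hD, h'⟩ := exists_wnorm_le_of_growth (n := n) (one_pos.trans hp.out) b j
  refine ⟨|c| * (D * C), by positivity, fun f => ?_⟩
  have hw : wnorm p b (homComp f j) ≤ ENNReal.ofReal (D * (C * ‖f‖)) := by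
    refine h' _ _ fun z => (h f j z).trans ?_
    rw [div_one, Real.exp_nat_mul]
    gcongr
    linarith [Real.add_one_le_exp ‖z‖]
  let u : FockSpace n p (b * p) := mkFock (homComp f j)
    ((contDiff_homComp f j).differentiable (by simp)) (hw.trans_lt ENNReal.ofReal_lt_top).ne
  refine ⟨(c : ℂ) • u, fun k z => ?_, ?_⟩
  · have e : (((c : ℂ) • u : FockSpace n p (b * p)) : Cn n → ℂ) = (c : ℂ) • homComp f j := rfl
    rw [e, homComp_const_smul (contDiff_homComp f j),
      homComp_of_homogeneous (contDiff_homComp f j) (homComp_smul f j)]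
    beta_reduce
    split_ifs with hk
    · rw [hk]
    · simp
  · have hu : ‖u‖ ≤ D * (C * ‖f‖) := norm_le_of_wnorm_le u (by positivity) hw
    rw [norm_smul, Complex.norm_real, Real.norm_eq_abs, mul_assoc, mul_assoc]
    gcongr

/-- Extraction of a single component is bounded between any two weights, so finitely many multiplier
values are irrelevant. Only the formula for `coef` above the cut matters. -/
theorem congr_of_le (N : ℕ) (h : MultBound n p a b ν) (hν : ∀ k, N ≤ k → ν' k = ν k) :
    MultBound n p a b ν' := by
  induction N generalizing ν with
  | zero =>
    have : ν' = ν := funext fun k => hν k (Nat.zero_le k)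
    rwa [this]
  | succ N ih =>
    refine ih (h.add (single n p a b N (ν' N - ν N))) fun k hk => ?_
    rcases hk.eq_or_lt with rfl | hk
    · simp
    · rw [if_neg hk.ne', add_zero, hν k hk]

end MultBound

/-- The operator `f ↦ c f + ∑ z_j ∂_j f`. -/
def euler (c : ℝ) (f : Cn n → ℂ) (z : Cn n) : ℂ := c * f z + fderiv ℂ f z z

theorem homComp_euler (c : ℝ) {f : Cn n → ℂ} (hf : ContDiff ℂ ∞ f) (hu : ContDiff ℂ ∞ (euler c f))
    (k : ℕ) (z : Cn n) : homComp (euler c f) k z = (k + c : ℝ) * homComp f k z := by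
  refine homComp_eq_of_hasSum hu (c := fun k => (k + c : ℝ) * homComp f k z) (fun t => ?_) k
  have hs := differentiable_slice hf z
  set s : ℂ → ℂ := fun t => f (t • z)
  have hd : deriv s t = fderiv ℂ f (t • z) z := by
    have h1 : HasFDerivAt f (fderiv ℂ f (t • z)) (t • z) :=
      ((hf.differentiable (by simp)) _).hasFDerivAt
    have h2 : HasDerivAt (fun t : ℂ => t • z) z t := by
      simpa using (hasDerivAt_id t).smul_const z
    exact (h1.comp_hasDerivAt t h2).deriv
  have hds : Differentiable ℂ (deriv s) :=
    hs.deriv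
  have h1 := (Complex.hasSum_taylorSeries_of_entire hds 0 t).mul_left t
  have h2 : HasSum (fun k : ℕ => t ^ (k + 1) * ((k + 1 : ℕ) * homComp f (k + 1) z))
      (t * deriv s t) := by
    convert! h1 using 2 with k
    have hk : ((k + 1 : ℕ) : ℂ) ≠ 0 := by exact_mod_cast k.succ_ne_zero
    rw [homComp_eq_iteratedDeriv hf, iteratedDeriv_succ', Nat.factorial_succ, Nat.cast_mul,
      sub_zero, smul_eq_mul, smul_eq_mul, mul_inv, pow_succ]
    field_simp
    rfl
  have h3 : HasSum (fun k : ℕ => t ^ k * (k * homComp f k z)) (t * deriv s t) := by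
    rw [← hasSum_nat_add_iff' 1]
    simpa using h2
  have h4 := ((hasSum_homComp_smul hf z t).mul_left (c : ℂ)).add h3
  have e : euler c f (t • z) = c * f (t • z) + t * deriv s t := by
    rw [euler, hd, map_smul, smul_eq_mul]
  rw [e]
  convert! h4 using 2 with k
  push_cast; ring

theorem euler_eq_integral (c : ℝ) {f : Cn n → ℂ} (hf : Differentiable ℂ f) (he : ExpIntegrable f)
    (z : Cn n) : euler c f z = ∫ w, f w * (c + inner ℂ w z) * Complex.exp (inner ℂ w z) *
      (Real.exp (-‖w‖ ^ 2) : ℂ) ∂(V n) := by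
  have hpr := proj_eq_self hf he
  have h1 : fderiv ℂ f z z = proj (fun w => f w * inner ℂ w z) z := by
    conv_lhs => rw [← hpr]
    exact fderiv_proj_apply he z z
  have h2 : f z = proj f z := (congrFun hpr z).symm
  rw [euler, h1, h2, proj, proj, ← integral_const_mul,
    ← integral_add ((he.integrable_kernel z).const_mul _)
      ((he.mul_inner z).integrable_kernel z)]
  refine integral_congr_ae (Eventually.of_forall fun w => ?_)
  ring

/-- In the reproducing formula the operator inserts the factor c + ⟨w,z⟩, at most a constant times
(1+|z|)²(1+|z-w|). The square is the loss of 2 in the weight; 1+|z-w| uses up half of the Gaussian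
decay rate 1/2. -/
theorem multBound_euler (n : ℕ) (p : ℝ) [hp : Fact (1 < p)] (a c : ℝ) :
    MultBound n p a (a + 2) fun k => k + c := by
  obtain ⟨C₁, hC₁, hb⟩ := exp_mul_rpow_le 0 1 (1 / 4) (by norm_num)
  obtain ⟨C, hC, h⟩ := exists_wnorm_le_of_kernel (n := n) hp.out a 2 (c := 1 / 4) (by norm_num)
  refine ⟨C * ((1 + |c|) * C₁), by positivity, fun f => ?_⟩
  have hsm : ContDiff ℂ ∞ (euler c f) := by
    have h1 : ContDiff ℂ ∞ (fderiv ℂ f) := f.smooth.fderiv_right (by simp)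
    exact (contDiff_const.mul f.smooth).add (h1.clm_apply contDiff_id)
  have hw : wnorm p (a + 2) (euler c f) ≤ ENNReal.ofReal (C * ((1 + |c|) * C₁) * ‖f‖) := by
    rw [ENNReal.ofReal_mul (by positivity), ← wnorm_coe]
    refine h _ f (euler c f) f.continuous.measurable fun z => ?_
    rw [euler_eq_integral c f.differentiable f.expIntegrable]
    refine (mul_le_mul_left (enorm_integral_le_lintegral_enorm _) _).trans ?_
    rw [← lintegral_mul_const' _ _ ENNReal.ofReal_ne_top,
      ← lintegral_const_mul' _ _ ENNReal.ofReal_ne_top]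
    refine lintegral_mono fun w => ?_
    have hbb := hb ‖z - w‖ (norm_nonneg _)
    rw [zero_mul, Real.exp_zero, one_mul, Real.rpow_one] at hbb
    have h1 : ‖(c : ℂ) + inner ℂ w z‖ ≤ (1 + |c|) * (1 + ‖z‖) ^ 2 * (1 + ‖z - w‖) := by
      have e1 : ‖(inner ℂ w z : ℂ)‖ ≤ ‖w‖ * ‖z‖ := norm_inner_le_norm w z
      have e2 : ‖w‖ ≤ ‖z‖ + ‖z - w‖ := by
        have := norm_sub_le z (z - w); simpa using this
      have e3 : ‖(c : ℂ) + inner ℂ w z‖ ≤ |c| + ‖w‖ * ‖z‖ := by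
        refine (norm_add_le _ _).trans (add_le_add (by simp) e1)
      have e4 : ‖w‖ * ‖z‖ ≤ (1 + ‖z‖) ^ 2 * (1 + ‖z - w‖) := by
        nlinarith [norm_nonneg z, norm_nonneg (z - w), norm_nonneg w,
          mul_nonneg (norm_nonneg z) (norm_nonneg (z - w)), mul_le_mul_of_nonneg_right e2 (norm_nonneg z),
          mul_nonneg (mul_nonneg (norm_nonneg z) (norm_nonneg z)) (norm_nonneg (z - w))]
      have e5 : 1 ≤ (1 + ‖z‖) ^ 2 * (1 + ‖z - w‖) := by
        have : (1 : ℝ) ≤ (1 + ‖z‖) ^ 2 := by nlinarith [norm_nonneg z]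
        nlinarith [norm_nonneg (z - w)]
      calc _ ≤ _ := e3
        _ ≤ |c| * ((1 + ‖z‖) ^ 2 * (1 + ‖z - w‖)) + (1 + ‖z‖) ^ 2 * (1 + ‖z - w‖) :=
          add_le_add (le_mul_of_one_le_right (abs_nonneg c) e5) e4
        _ = _ := by ring
    rw [enorm_mul, enorm_mul, enorm_mul, mul_assoc, mul_assoc, mul_assoc, mul_left_comm]
    rw [mul_left_comm (ENNReal.ofReal _) (‖f w‖ₑ), mul_left_comm (‖_‖ₑ) (‖f w‖ₑ)]
    refine mul_le_mul_right ?_ _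
    rw [enorm_ofReal_exp, ← ofReal_norm, ← ofReal_norm, ← ENNReal.ofReal_mul (by positivity),
      ← ENNReal.ofReal_mul (by positivity), ← ENNReal.ofReal_mul (by positivity),
      ← ENNReal.ofReal_mul (by positivity)]
    refine ENNReal.ofReal_le_ofReal ?_
    have hk := norm_ker_mul_exp w z
    have hzz : (1 + ‖z‖) ^ (2 : ℝ) = (1 + ‖z‖) ^ 2 := Real.rpow_two _
    rw [← mul_assoc (‖Complex.exp _‖), hk, hzz]
    calc ‖(c : ℂ) + inner ℂ w z‖ *
          (Real.exp (-‖w‖ ^ 2 / 2) * Real.exp (-(1 / 2) * ‖z - w‖ ^ 2))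
        ≤ (1 + |c|) * (1 + ‖z‖) ^ 2 * (C₁ * Real.exp (1 / 4 * ‖z - w‖ ^ 2)) *
          (Real.exp (-‖w‖ ^ 2 / 2) * Real.exp (-(1 / 2) * ‖z - w‖ ^ 2)) := by
          refine mul_le_mul_of_nonneg_right (h1.trans ?_) (by positivity)
          gcongr
      _ = (1 + |c|) * C₁ * (1 + ‖z‖) ^ 2 * (Real.exp (-‖w‖ ^ 2 / 2) *
          (Real.exp (1 / 4 * ‖z - w‖ ^ 2) * Real.exp (-(1 / 2) * ‖z - w‖ ^ 2))) := by ring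
      _ = _ := by
          rw [← Real.exp_add]
          congr 3; ring
  let u : FockSpace n p ((a + 2) * p) := mkFock (euler c f) (hsm.differentiable (by simp))
    (hw.trans_lt ENNReal.ofReal_lt_top).ne
  exact ⟨u, homComp_euler c f.smooth hsm, norm_le_of_wnorm_le u (by positivity) hw⟩

theorem multBound_prod (n : ℕ) (p : ℝ) [hp : Fact (1 < p)] (a c : ℝ) (m : ℕ) :
    MultBound n p a (a + 2 * m) fun k => ∏ j ∈ Finset.range m, (k + (c + j)) := by
  induction m with
  | zero =>
    simp only [Nat.cast_zero, mul_zero, add_zero, Finset.range_zero, Finset.prod_empty]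
    exact ⟨1, zero_le_one, fun f => ⟨f, fun k z => by simp, by simp⟩⟩
  | succ m ih =>
    have := ih.comp (multBound_euler n p (a + 2 * m) (c + m))
    simp only [Finset.prod_range_succ]
    have e : a + 2 * (m + 1 : ℕ) = a + 2 * m + 2 := by push_cast; ring
    rw [e]
    convert! this using 2 with k
    ring

/-- The weight of the fractional integration of order `δ`. -/
def fracWeight (n : ℕ) (δ t : ℝ) : ℝ := t ^ (n - 1) * (1 - t) ^ (δ - 1)

/-- Fractional integration of order `δ` along the rays. -/
def fracInt (δ : ℝ) (f : Cn n → ℂ) (z : Cn n) : ℂ :=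
  ∫ t in Set.Ioc (0 : ℝ) 1, (fracWeight n δ t : ℂ) * f ((t : ℂ) • z)

/-- Orders δ ≥ 1 suffice, since the order can be raised by an integer and corrected by Euler
operators; they spare the singularity at t = 1. -/
theorem continuous_fracWeight {δ : ℝ} (hδ : 1 ≤ δ) : Continuous (fracWeight n δ) := by
  have : Continuous fun t : ℝ => (1 - t) ^ (δ - 1) :=
    Continuous.rpow_const (by fun_prop) fun t => Or.inr (by linarith)
  unfold fracWeight; fun_prop

theorem fracWeight_nonneg {δ t : ℝ} (ht : t ∈ Set.Ioc (0 : ℝ) 1) :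
    0 ≤ fracWeight n δ t :=
  mul_nonneg (pow_nonneg ht.1.le _) (Real.rpow_nonneg (by linarith [ht.2]) _)

/-- This is the Beta integral B(n+k, δ); the power t^(n-1) in the weight is there to produce Γ(n+k).
-/
theorem integral_fracWeight (hn : 1 ≤ n) {δ : ℝ} (hδ : 0 < δ) (k : ℕ) :
    ∫ t in Set.Ioc (0 : ℝ) 1, (fracWeight n δ t : ℂ) * (t : ℂ) ^ k =
      (Real.Gamma (n + k) * Real.Gamma δ / Real.Gamma (n + k + δ) : ℝ) := by
  have hnk : (0 : ℝ) < n + k := by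
    have : (1 : ℝ) ≤ n := by exact_mod_cast hn
    positivity
  have h := Complex.betaIntegral_eq_Gamma_mul_div ((n + k : ℝ) : ℂ) (δ : ℂ) (by simpa using hnk)
    (by simpa using hδ)
  rw [Complex.betaIntegral, intervalIntegral.integral_of_le zero_le_one, ← Complex.ofReal_add,
    Complex.Gamma_ofReal, Complex.Gamma_ofReal, Complex.Gamma_ofReal] at h
  push_cast at h ⊢
  rw [← h]
  refine setIntegral_congr_fun measurableSet_Ioc fun t ht => ?_
  have h1 : (t : ℂ) ^ ((n : ℂ) + k - 1) = (t : ℂ) ^ (n - 1) * (t : ℂ) ^ k := by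
    have e : (n : ℂ) + k - 1 = ((n - 1 + k : ℕ) : ℂ) := by
      push_cast [Nat.cast_sub hn]; ring
    rw [e, Complex.cpow_natCast, pow_add]
  have h2 : (1 - (t : ℂ)) ^ ((δ : ℂ) - 1) = (((1 - t) ^ (δ - 1) : ℝ) : ℂ) := by
    rw [Complex.ofReal_cpow (by linarith [ht.2])]
    push_cast; rfl
  simp only [h1, h2, fracWeight]
  push_cast; ring

theorem differentiable_fracInt {δ : ℝ} (hδ : 1 ≤ δ) {f : Cn n → ℂ} (hf : ContDiff ℂ ∞ f) :
    Differentiable ℂ (fracInt δ f) := by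
  intro z
  have hρ := continuous_fracWeight (n := n) hδ
  have hfc := hf.continuous
  have hf' : Continuous (fderiv ℂ f) := hf.continuous_fderiv (by simp)
  obtain ⟨M, hM⟩ := (isCompact_closedBall (0 : Cn n) (‖z‖ + 1)).exists_bound_of_continuousOn
    hf'.continuousOn
  have : IsFiniteMeasure (volume.restrict (Set.Ioc (0 : ℝ) 1)) := inferInstance
  refine (hasFDerivAt_integral_of_dominated_of_fderiv_le (μ := volume.restrict (Set.Ioc (0 : ℝ) 1))
    (F := fun (z : Cn n) (t : ℝ) => (fracWeight n δ t : ℂ) * f ((t : ℂ) • z))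
    (F' := fun z t => (fracWeight n δ t : ℂ) • (t : ℂ) • fderiv ℂ f ((t : ℂ) • z))
    (bound := fun t => |fracWeight n δ t| * M)
    (Metric.ball_mem_nhds z one_pos) ?_ ?_ ?_ ?_ ?_ ?_).differentiableAt
  · refine Eventually.of_forall fun y => Continuous.aestronglyMeasurable ?_
    fun_prop
  · have : Continuous fun t : ℝ => (fracWeight n δ t : ℂ) * f ((t : ℂ) • z) := by fun_prop
    exact (this.integrableOn_Icc (a := 0) (b := 1)).mono_set Set.Ioc_subset_Icc_self
  · refine Continuous.aestronglyMeasurable ?_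
    fun_prop
  · refine (ae_restrict_iff' measurableSet_Ioc).2 (Eventually.of_forall fun t ht y hy => ?_)
    have ht0 : ‖(t : ℂ)‖ = t := by rw [Complex.norm_real, Real.norm_of_nonneg ht.1.le]
    have hy' : ‖y‖ ≤ ‖z‖ + 1 := by
      have := norm_le_norm_add_norm_sub' y z
      rw [mem_ball_iff_norm] at hy
      linarith
    have hty : ‖(t : ℂ) • y‖ ≤ ‖z‖ + 1 := by
      rw [norm_smul, ht0]
      exact (mul_le_of_le_one_left (norm_nonneg y) ht.2).trans hy'
    rw [norm_smul, norm_smul, ht0, Complex.norm_real, Real.norm_eq_abs]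
    gcongr
    calc t * ‖fderiv ℂ f ((t : ℂ) • y)‖ ≤ 1 * ‖fderiv ℂ f ((t : ℂ) • y)‖ := by
          gcongr; exact ht.2
      _ ≤ M := by rw [one_mul]; exact hM _ (by simpa using hty)
  · have : Continuous fun t : ℝ => |fracWeight n δ t| * M := by fun_prop
    exact (this.integrableOn_Icc (a := 0) (b := 1)).mono_set Set.Ioc_subset_Icc_self
  · refine Eventually.of_forall fun t y _ => ?_
    have h1 : HasFDerivAt f (fderiv ℂ f ((t : ℂ) • y)) ((t : ℂ) • y) :=
      ((hf.differentiable (by simp)) _).hasFDerivAt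
    have h2 : HasFDerivAt (fun y : Cn n => (t : ℂ) • y)
        ((t : ℂ) • ContinuousLinearMap.id ℂ (Cn n)) y := (hasFDerivAt_id y).const_smul (t : ℂ)
    refine ((h1.comp y h2).const_mul (fracWeight n δ t : ℂ)).congr_fderiv ?_
    ext v
    simp

theorem homComp_fracInt (hn : 1 ≤ n) {δ : ℝ} (hδ : 1 ≤ δ) {f : Cn n → ℂ} (hf : ContDiff ℂ ∞ f)
    (hu : ContDiff ℂ ∞ (fracInt δ f)) (k : ℕ) (z : Cn n) :
    homComp (fracInt δ f) k z =
      (Real.Gamma (n + k) * Real.Gamma δ / Real.Gamma (n + k + δ) : ℝ) * homComp f k z := by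
  refine homComp_eq_of_hasSum hu (c := fun k =>
    (Real.Gamma (n + k) * Real.Gamma δ / Real.Gamma (n + k + δ) : ℝ) * homComp f k z)
    (fun s => ?_) k
  have hρ := continuous_fracWeight (n := n) hδ
  have hs := (hasSum_homComp_smul hf z s).summable.norm
  have h1 : HasSum (fun k : ℕ => ∫ t in Set.Ioc (0 : ℝ) 1,
      (fracWeight n δ t : ℂ) * (t : ℂ) ^ k * (s ^ k * homComp f k z)) (fracInt δ f (s • z)) := by
    refine hasSum_integral_of_dominated_convergence
      (fun k t => |fracWeight n δ t| * ‖s ^ k * homComp f k z‖) (fun k => ?_) (fun k => ?_) ?_ ?_ ?_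
    · exact Continuous.aestronglyMeasurable (by fun_prop)
    · refine (ae_restrict_iff' measurableSet_Ioc).2 (Eventually.of_forall fun t ht => ?_)
      have ht0 : ‖(t : ℂ)‖ = t := by rw [Complex.norm_real, Real.norm_of_nonneg ht.1.le]
      rw [norm_mul, norm_mul, norm_pow, ht0, Complex.norm_real, Real.norm_eq_abs]
      refine mul_le_mul_of_nonneg_right ?_ (norm_nonneg _)
      exact mul_le_of_le_one_right (abs_nonneg _) (pow_le_one₀ ht.1.le ht.2)
    · exact Eventually.of_forall fun t => hs.mul_left _
    · simp only [tsum_mul_left]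
      have : Continuous fun t : ℝ => |fracWeight n δ t| * ∑' k, ‖s ^ k * homComp f k z‖ := by
        fun_prop
      exact (this.integrableOn_Icc (a := 0) (b := 1)).mono_set Set.Ioc_subset_Icc_self
    · refine Eventually.of_forall fun t => ?_
      have := (hasSum_homComp_smul hf z ((t : ℂ) * s)).mul_left (fracWeight n δ t : ℂ)
      rw [mul_smul] at this
      convert! this using 2 with k
      rw [mul_pow]; ring
  convert! h1 using 2 with k
  rw [integral_mul_const, integral_fracWeight hn (by linarith)]
  ring

/-- The exponential restricts 1-t to size about 1/(1+r²), and integrating (1-t)^(δ-1) there gives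
(1+r)^(-2δ); precisely, compare with the Gamma integral. -/
theorem integral_fracWeight_mul_exp_le {δ : ℝ} (hδ : 1 ≤ δ) {r : ℝ} (hr : 0 ≤ r) :
    ∫ t in Set.Ioc (0 : ℝ) 1, fracWeight n δ t * Real.exp (-((1 - t) * r ^ 2 / 4)) ≤
      Real.exp (1 / 4) * 8 ^ δ * Real.Gamma δ * (1 + r) ^ (-(2 * δ)) := by
  have hδ0 : 0 < δ := by linarith
  -- Using (1+r²)/4 instead of r²/4 keeps the rate positive at r = 0, at the cost of e^{1/4}. The 8
  -- comes from 4/(1+r²) ≤ 8/(1+r)².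
  set c : ℝ := (1 + r ^ 2) / 4 with hc
  have hc0 : 0 < c := by positivity
  have hΓ := Real.integral_rpow_mul_exp_neg_mul_Ioi hδ0 hc0
  have hint : IntegrableOn (fun t : ℝ => t ^ (δ - 1) * Real.exp (-(c * t))) (Set.Ioi 0) := by
    by_contra hcon
    rw [integral_undef hcon] at hΓ
    have : 0 < (1 / c) ^ δ * Real.Gamma δ :=
      mul_pos (by positivity) (Real.Gamma_pos_of_pos hδ0)
    linarith
  have h1 : ∫ t in Set.Ioc (0 : ℝ) 1, fracWeight n δ t * Real.exp (-((1 - t) * r ^ 2 / 4)) ≤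
      ∫ t in Set.Ioc (0 : ℝ) 1,
        Real.exp (1 / 4) * ((1 - t) ^ (δ - 1) * Real.exp (-(c * (1 - t)))) := by
    have hρ := continuous_fracWeight (n := n) hδ
    have hρ' : Continuous fun t : ℝ => (1 - t) ^ (δ - 1) :=
      Continuous.rpow_const (by fun_prop) fun t => Or.inr (by linarith)
    refine setIntegral_mono_on ?_ ?_ measurableSet_Ioc fun t ht => ?_
    · have : Continuous fun t : ℝ => fracWeight n δ t * Real.exp (-((1 - t) * r ^ 2 / 4)) := by
        fun_prop
      exact (this.integrableOn_Icc (a := 0) (b := 1)).mono_set Set.Ioc_subset_Icc_self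
    · have : Continuous fun t : ℝ =>
          Real.exp (1 / 4) * ((1 - t) ^ (δ - 1) * Real.exp (-(c * (1 - t)))) := by
        fun_prop
      exact (this.integrableOn_Icc (a := 0) (b := 1)).mono_set Set.Ioc_subset_Icc_self
    · have h1t : 0 ≤ 1 - t := by linarith [ht.2]
      have e1 : fracWeight n δ t ≤ (1 - t) ^ (δ - 1) :=
        mul_le_of_le_one_left (Real.rpow_nonneg h1t _) (pow_le_one₀ ht.1.le ht.2)
      have e2 : Real.exp (-((1 - t) * r ^ 2 / 4)) ≤ Real.exp (1 / 4) * Real.exp (-(c * (1 - t))) := by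
        rw [← Real.exp_add]
        refine Real.exp_le_exp.2 ?_
        rw [hc]
        nlinarith [ht.1]
      calc _ ≤ (1 - t) ^ (δ - 1) * (Real.exp (1 / 4) * Real.exp (-(c * (1 - t)))) :=
            mul_le_mul e1 e2 (Real.exp_pos _).le (Real.rpow_nonneg h1t _)
        _ = _ := by ring
  have h2 : ∫ t in Set.Ioc (0 : ℝ) 1, (1 - t) ^ (δ - 1) * Real.exp (-(c * (1 - t))) ≤
      (1 / c) ^ δ * Real.Gamma δ := by
    rw [← hΓ, ← intervalIntegral.integral_of_le zero_le_one,
      intervalIntegral.integral_comp_sub_left (fun x => x ^ (δ - 1) * Real.exp (-(c * x))) 1,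
      sub_self, sub_zero, intervalIntegral.integral_of_le zero_le_one]
    refine setIntegral_mono_set hint ?_ (Eventually.of_forall Set.Ioc_subset_Ioi_self)
    refine (ae_restrict_iff' measurableSet_Ioi).2 (Eventually.of_forall fun t ht => ?_)
    exact mul_nonneg (Real.rpow_nonneg (le_of_lt ht) _) (Real.exp_pos _).le
  have h3 : (1 / c) ^ δ ≤ 8 ^ δ * (1 + r) ^ (-(2 * δ)) := by
    have e : (1 + r) ^ (-(2 * δ)) = (((1 + r) ^ 2)⁻¹) ^ δ := by
      rw [← Real.rpow_natCast, ← Real.rpow_neg (by positivity), ← Real.rpow_mul (by positivity)]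
      congr 1; push_cast; ring
    rw [e, ← Real.mul_rpow (by norm_num) (by positivity)]
    refine Real.rpow_le_rpow (by positivity) ?_ hδ0.le
    rw [← div_eq_mul_inv, div_le_div_iff₀ hc0 (by positivity), hc]
    nlinarith [sq_nonneg (1 - r)]
  rw [integral_const_mul] at h1
  have hG := Real.Gamma_pos_of_pos hδ0
  calc _ ≤ _ := h1
    _ ≤ Real.exp (1 / 4) * ((8 ^ δ * (1 + r) ^ (-(2 * δ))) * Real.Gamma δ) := by
      gcongr
      exact h2.trans (by gcongr)
    _ = _ := by ring

/-- The exponent contains -t|z-w|²/2, useless for small t, and -(1-t)(|z|²+|w|²)/2. Half of the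
latter dominates (1-t)|z-w|²/8 by the parallelogram law, which restores the off-diagonal decay; the
rest supplies the decay in (1-t)|z|². -/
theorem norm_ker_smul_mul_exp_le {t : ℝ} (ht0 : 0 ≤ t) (ht1 : t ≤ 1) (w z : Cn n) :
    ‖Complex.exp (inner ℂ w ((t : ℂ) • z))‖ * Real.exp (-‖w‖ ^ 2) * Real.exp (-‖z‖ ^ 2 / 2) ≤
      Real.exp (-((1 - t) * ‖z‖ ^ 2 / 4)) *
        (Real.exp (-‖w‖ ^ 2 / 2) * Real.exp (-(1 / 8) * ‖z - w‖ ^ 2)) := by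
  have h := norm_sub_sq (𝕜 := ℂ) z w
  have h2 : RCLike.re (inner ℂ z w : ℂ) = (inner ℂ w z : ℂ).re := inner_re_symm z w
  have h3 : (inner ℂ w ((t : ℂ) • z) : ℂ).re = t * (inner ℂ w z : ℂ).re := by
    rw [inner_smul_right, Complex.re_ofReal_mul]
  have h4 := parallelogram_law_with_norm ℂ z w
  have h5 : ‖z - w‖ ^ 2 ≤ 2 * (‖z‖ ^ 2 + ‖w‖ ^ 2) := by nlinarith [norm_nonneg (z + w)]
  rw [h2] at h
  rw [Complex.norm_exp, h3, ← Real.exp_add, ← Real.exp_add, ← Real.exp_add, ← Real.exp_add]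
  refine Real.exp_le_exp.2 ?_
  have h6 : (inner ℂ w z : ℂ).re = (‖z‖ ^ 2 + ‖w‖ ^ 2 - ‖z - w‖ ^ 2) / 2 := by linarith
  rw [h6]
  have h7 := mul_le_mul_of_nonneg_left h5 (sub_nonneg.2 ht1)
  have h8 : 0 ≤ (1 - t) * ‖w‖ ^ 2 := mul_nonneg (sub_nonneg.2 ht1) (sq_nonneg _)
  have h9 : 0 ≤ t * ‖z - w‖ ^ 2 := mul_nonneg ht0 (sq_nonneg _)
  nlinarith

/-- For each t the kernel is a fixed off-diagonal Gaussian times exp(-(1-t)|z|²/4); integrating in t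
leaves (1+|z|)^(-2δ), which is the gain in the weight. -/
theorem multBound_fracInt (hn : 1 ≤ n) (p : ℝ) [hp : Fact (1 < p)] (a : ℝ) {δ : ℝ} (hδ : 1 ≤ δ) :
    MultBound n p a (a - 2 * δ) fun k =>
      Real.Gamma (n + k) * Real.Gamma δ / Real.Gamma (n + k + δ) := by
  obtain ⟨C, hC, h⟩ := exists_wnorm_le_of_kernel (n := n) hp.out a (-(2 * δ)) (c := 1 / 8)
    (by norm_num)
  have hG := Real.Gamma_pos_of_pos (show 0 < δ by linarith)
  set K := Real.exp (1 / 4) * 8 ^ δ * Real.Gamma δ with hK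
  have hK0 : 0 < K := by positivity
  rw [← sub_eq_add_neg] at h
  refine ⟨C * K, by positivity, fun f => ?_⟩
  have hρ := continuous_fracWeight (n := n) hδ
  have hw : wnorm p (a - 2 * δ) (fracInt δ f) ≤ ENNReal.ofReal (C * K * ‖f‖) := by
    rw [ENNReal.ofReal_mul (by positivity), ← wnorm_coe]
    refine h _ f (fracInt δ f) f.continuous.measurable fun z => ?_
    set J := ∫⁻ w, ‖f w‖ₑ * ENNReal.ofReal
      (Real.exp (-‖w‖ ^ 2 / 2) * Real.exp (-(1 / 8) * ‖z - w‖ ^ 2)) ∂(V n)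
    have h1 : ∀ t ∈ Set.Ioc (0 : ℝ) 1,
        ‖(fracWeight n δ t : ℂ) * f ((t : ℂ) • z)‖ₑ * ENNReal.ofReal (Real.exp (-‖z‖ ^ 2 / 2)) ≤
        ENNReal.ofReal (fracWeight n δ t * Real.exp (-((1 - t) * ‖z‖ ^ 2 / 4))) * J := by
      intro t ht
      have e0 : f ((t : ℂ) • z) = proj f ((t : ℂ) • z) := (congrFun f.proj_eq _).symm
      have e1 : ‖(fracWeight n δ t : ℂ)‖ₑ = ENNReal.ofReal (fracWeight n δ t) := by
        rw [← ofReal_norm, Complex.norm_real, Real.norm_of_nonneg (fracWeight_nonneg ht)]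
      rw [enorm_mul, e1, e0, mul_assoc, ENNReal.ofReal_mul (fracWeight_nonneg ht), mul_assoc]
      refine mul_le_mul_right ?_ _
      refine (mul_le_mul_left (enorm_integral_le_lintegral_enorm _) _).trans ?_
      rw [← lintegral_mul_const' _ _ ENNReal.ofReal_ne_top,
        ← lintegral_const_mul' _ _ ENNReal.ofReal_ne_top]
      refine lintegral_mono fun w => ?_
      rw [enorm_mul, enorm_mul, enorm_ofReal_exp, mul_assoc, mul_assoc,
        mul_left_comm (ENNReal.ofReal _) (‖f w‖ₑ)]
      refine mul_le_mul_right ?_ _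
      rw [← ofReal_norm, ← ENNReal.ofReal_mul (by positivity),
        ← ENNReal.ofReal_mul (by positivity), ← ENNReal.ofReal_mul (by positivity), ← mul_assoc]
      exact ENNReal.ofReal_le_ofReal (norm_ker_smul_mul_exp_le ht.1.le ht.2 w z)
    have hc : Continuous fun t : ℝ =>
        fracWeight n δ t * Real.exp (-((1 - t) * ‖z‖ ^ 2 / 4)) := by fun_prop
    calc ‖fracInt δ f z‖ₑ * ENNReal.ofReal (Real.exp (-‖z‖ ^ 2 / 2))
        ≤ (∫⁻ t in Set.Ioc (0 : ℝ) 1, ‖(fracWeight n δ t : ℂ) * f ((t : ℂ) • z)‖ₑ) *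
          ENNReal.ofReal (Real.exp (-‖z‖ ^ 2 / 2)) :=
          mul_le_mul_left (enorm_integral_le_lintegral_enorm _) _
      _ ≤ ∫⁻ t in Set.Ioc (0 : ℝ) 1,
          ENNReal.ofReal (fracWeight n δ t * Real.exp (-((1 - t) * ‖z‖ ^ 2 / 4))) * J := by
          rw [← lintegral_mul_const' _ _ ENNReal.ofReal_ne_top]
          exact setLIntegral_mono' measurableSet_Ioc h1
      _ = ENNReal.ofReal (∫ t in Set.Ioc (0 : ℝ) 1,
            fracWeight n δ t * Real.exp (-((1 - t) * ‖z‖ ^ 2 / 4))) * J := by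
          rw [lintegral_mul_const _ (by have := hc.measurable; fun_prop),
            ofReal_integral_eq_lintegral_ofReal
              ((hc.integrableOn_Icc (a := 0) (b := 1)).mono_set Set.Ioc_subset_Icc_self)]
          refine (ae_restrict_iff' measurableSet_Ioc).2 (Eventually.of_forall fun t ht => ?_)
          exact mul_nonneg (fracWeight_nonneg ht) (Real.exp_pos _).le
      _ ≤ _ := by
          refine mul_le_mul_left (ENNReal.ofReal_le_ofReal ?_) _
          exact integral_fracWeight_mul_exp_le hδ (norm_nonneg z)
  let u : FockSpace n p ((a - 2 * δ) * p) := mkFock (fracInt δ f)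
    (differentiable_fracInt hδ f.smooth) (hw.trans_lt ENNReal.ofReal_lt_top).ne
  exact ⟨u, homComp_fracInt hn hδ f.smooth u.smooth, norm_le_of_wnorm_le u (by positivity) hw⟩

theorem Gamma_add_natCast {x : ℝ} (hx : 0 < x) (m : ℕ) :
    Real.Gamma (x + m) = (∏ j ∈ Finset.range m, (x + j)) * Real.Gamma x := by
  induction m with
  | zero => simp
  | succ m ih =>
    have : x + (m + 1 : ℕ) = (x + m) + 1 := by push_cast; ring
    rw [this, Real.Gamma_add_one (by positivity), ih, Finset.prod_range_succ]
    ring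

/-- The inverses of the ratios `coef n σ k` are multipliers between the weighted spaces. -/
theorem multBound_inv_coef (hn : 1 ≤ n) (p : ℝ) [hp : Fact (1 < p)] (a σ : ℝ) :
    MultBound n p a (a + σ) fun k => (coef n σ k)⁻¹ := by
  set s := σ / 2 with hs
  -- Large enough that the order m - s of the fractional integration is at least 1, whatever the
  -- sign of s.
  set m : ℕ := ⌈|s|⌉₊ + 1 with hm
  have hδ : 1 ≤ m - s := by
    have h1 := Nat.le_ceil |s|
    have h2 := le_abs_self s
    rw [hm]; push_cast; linarith
  -- With δ = m - s, n+k+δ = (n+k-s) + m, so the product of the m Euler factors turns 1/Γ(n+k+δ)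
  -- into 1/Γ(n+k-s). The net shift of the weight is -2δ + 2m = σ.
  have h1 := (multBound_fracInt hn p a hδ).comp (multBound_prod n p (a - 2 * (m - s)) (n - s) m)
  have e : a - 2 * (m - s) + 2 * m = a + σ := by rw [hs]; ring
  rw [e] at h1
  have hG := Real.Gamma_pos_of_pos (show 0 < m - s by linarith)
  have h2 : MultBound n p (a + σ) (a + σ) fun _ => (Real.Gamma (m - s))⁻¹ := by
    refine ⟨(Real.Gamma (m - s))⁻¹, by positivity, fun f =>
      ⟨(((Real.Gamma (m - s))⁻¹ : ℝ) : ℂ) • f, fun k z => ?_, ?_⟩⟩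
    · exact homComp_const_smul f.smooth _ k z
    · rw [norm_smul, Complex.norm_real, Real.norm_of_nonneg (by positivity)]
  refine (h1.comp h2).congr_of_le (cut n σ) fun k hk => ?_
  have hpos : 0 < n + k - s := pos_of_cut_le hk
  have hnk : (0 : ℝ) < n + k := by
    have : (1 : ℝ) ≤ n := by exact_mod_cast hn
    positivity
  rw [coef, if_neg (not_lt.2 hk), inv_div, ← hs]
  have e1 : (n + k + (m - s) : ℝ) = (n + k - s) + m := by ring
  have e2 : ∀ j : ℕ, (k + (n - s + j) : ℝ) = (n + k - s) + j := fun j => by ring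
  simp only [e1, e2]
  have h3 : 0 < ∏ j ∈ Finset.range m, ((n + k - s) + j : ℝ) :=
    Finset.prod_pos fun j _ => by positivity
  have h4 := Real.Gamma_pos_of_pos hpos
  rw [Gamma_add_natCast hpos]
  clear_value s
  field_simp

end Fock
end

/-! ### Bijectivity of the pairing map and the theorem -/

noncomputable section

namespace Fock

open Filter Topology
open scoped ENNReal NNReal ContDiff

variable {n : ℕ} {p q : ℝ} [hp : Fact (1 < p)] [hq : Fact (1 < q)] {a b : ℝ}

theorem integrand_add_left (ψ₁ ψ₂ φ : Cn n → ℂ) (z : Cn n) :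
    integrand (ψ₁ + ψ₂) φ z = integrand ψ₁ φ z + integrand ψ₂ φ z := by
  simp only [integrand, Pi.add_apply]; ring

theorem integrand_add_right (ψ φ₁ φ₂ : Cn n → ℂ) (z : Cn n) :
    integrand ψ (φ₁ + φ₂) z = integrand ψ φ₁ z + integrand ψ φ₂ z := by
  simp only [integrand, Pi.add_apply, map_add]; ring

theorem intPairing_smul_left (σ : ℝ) (c : ℂ) (ψ φ : Cn n → ℂ) :
    intPairing σ (c • ψ) φ = c * intPairing σ ψ φ := by
  rw [intPairing, intPairing, ← integral_const_mul]
  refine integral_congr_ae (Eventually.of_forall fun z => ?_)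
  simp only [integrand, Pi.smul_apply, smul_eq_mul]; ring

theorem intPairing_smul_right (σ : ℝ) (c : ℂ) (ψ φ : Cn n → ℂ) :
    intPairing σ ψ (c • φ) = starRingEnd ℂ c * intPairing σ ψ φ := by
  rw [intPairing, intPairing, ← integral_const_mul]
  refine integral_congr_ae (Eventually.of_forall fun z => ?_)
  simp only [integrand, Pi.smul_apply, smul_eq_mul, map_mul]; ring

theorem lowSum_coe_add {c : ℝ} (N : ℕ) (f g : FockSpace n p (c * p)) :
    lowSum N ((f + g : FockSpace n p (c * p)) : Cn n → ℂ) = lowSum N f + lowSum N g :=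
  funext fun z => lowSum_add N f.smooth g.smooth z

theorem lowSum_coe_smul {c : ℝ} (N : ℕ) (t : ℂ) (f : FockSpace n p (c * p)) :
    lowSum N ((t • f : FockSpace n p (c * p)) : Cn n → ℂ) = t • lowSum N f :=
  funext fun z => lowSum_smul N t f.smooth z

theorem highSum_coe_add {c : ℝ} (N : ℕ) (f g : FockSpace n p (c * p)) :
    highSum N ((f + g : FockSpace n p (c * p)) : Cn n → ℂ) = highSum N f + highSum N g := by
  funext z
  simp only [highSum, lowSum_coe_add, Pi.add_apply, FockSpace.add_apply]
  ring

theorem highSum_coe_smul {c : ℝ} (N : ℕ) (t : ℂ) (f : FockSpace n p (c * p)) :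
    highSum N ((t • f : FockSpace n p (c * p)) : Cn n → ℂ) = t • highSum N f := by
  funext z
  simp only [highSum, lowSum_coe_smul, Pi.smul_apply, FockSpace.smul_apply, smul_eq_mul]
  ring

/-- The bounded functional `⟨·, g⟩_{a+b}`. -/
def pairingL (hn : 1 ≤ n) (hpq : p.HolderConjugate q) (g : FockSpace n q (b * q)) :
    StrongDual ℂ (FockSpace n p (a * p)) :=
  LinearMap.mkContinuous
    { toFun := fun f => pairing (a + b) f g
      map_add' := fun f₁ f₂ => by
        simp only [pairing_eq, lowSum_coe_add, highSum_coe_add, intPairing, integrand_add_left]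
        rw [integral_add (integrable_lowSum hpq _ f₁ g) (integrable_lowSum hpq _ f₂ g),
          integral_add (integrable_highSum hn hpq (lt_cut n _) f₁ g)
            (integrable_highSum hn hpq (lt_cut n _) f₂ g)]
        ring
      map_smul' := fun c f => by
        simp only [pairing_eq, lowSum_coe_smul, highSum_coe_smul, intPairing_smul_left,
          RingHom.id_apply, smul_eq_mul]
        ring }
    ((exists_norm_pairing_le hn p q hpq a b).choose * ‖g‖)
    fun f => (exists_norm_pairing_le hn p q hpq a b).choose_spec.2 f g

@[simp] theorem pairingL_apply (hn : 1 ≤ n) (hpq : p.HolderConjugate q)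
    (g : FockSpace n q (b * q)) (f : FockSpace n p (a * p)) :
    pairingL hn hpq g f = pairing (a + b) f g := rfl

/-- The conjugate-linear map `g ↦ ⟨·, g⟩_{a+b}`. -/
def pairingMap (hn : 1 ≤ n) (hpq : p.HolderConjugate q) (a b : ℝ) :
    FockSpace n q (b * q) →ₛₗ[starRingEnd ℂ] StrongDual ℂ (FockSpace n p (a * p)) where
  toFun := pairingL hn hpq
  map_add' g₁ g₂ := by
    ext f
    rw [add_apply, pairingL_apply, pairingL_apply, pairingL_apply]
    simp only [pairing_eq, lowSum_coe_add, highSum_coe_add, intPairing, integrand_add_right]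
    rw [integral_add (integrable_lowSum hpq _ f g₁) (integrable_lowSum hpq _ f g₂),
      integral_add (integrable_highSum hn hpq (lt_cut n _) f g₁)
        (integrable_highSum hn hpq (lt_cut n _) f g₂)]
    ring
  map_smul' c g := by
    ext f
    rw [smul_apply, pairingL_apply, pairingL_apply]
    simp only [pairing_eq, lowSum_coe_smul, highSum_coe_smul, intPairing_smul_right, smul_eq_mul]
    ring

@[simp] theorem pairingMap_apply (hn : 1 ≤ n) (hpq : p.HolderConjugate q)
    (g : FockSpace n q (b * q)) (f : FockSpace n p (a * p)) :
    pairingMap hn hpq a b g f = pairing (a + b) f g := rfl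

theorem exists_norm_pairingMap_le (hn : 1 ≤ n) (hpq : p.HolderConjugate q) (a b : ℝ) :
    ∃ C : ℝ, 0 ≤ C ∧ ∀ g : FockSpace n q (b * q), ‖pairingMap hn hpq a b g‖ ≤ C * ‖g‖ := by
  obtain ⟨C, hC, h⟩ := exists_norm_pairing_le (n := n) hn p q hpq a b
  exact ⟨C, hC, fun g => ContinuousLinearMap.opNorm_le_bound _ (by positivity) fun f => h f g⟩

/-- Testing on the kernel components returns every g_k(w) up to a nonzero factor. -/
theorem pairingMap_injective (hn : 1 ≤ n) (hpq : p.HolderConjugate q) (a b : ℝ) :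
    Function.Injective (pairingMap hn hpq a b) := by
  rw [injective_iff_map_eq_zero]
  intro g hg
  have h : ∀ k w, homComp g k w = 0 := by
    intro k w
    have h1 := pairing_kerComp hn hpq (a := a) k w g
    rw [← pairingMap_apply hn hpq, hg, zero_apply] at h1
    rcases mul_eq_zero.1 h1.symm with h2 | h2
    · exact absurd (by exact_mod_cast h2) (coef_pos hn (a + b) k).ne'
    · simpa using h2
  refine FockSpace.ext fun w => ?_
  have h1 := hasSum_homComp g.smooth w
  simp only [h] at h1
  exact h1.unique hasSum_zero

/-- The representing function is the transform of L with its components divided by `coef`; the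
exponent goes from -a to -a + (a+b) = b. Both functionals agree on kernel components, hence on
kernels, hence everywhere. -/
theorem exists_pairingMap_eq (hn : 1 ≤ n) (hpq : p.HolderConjugate q) (a b : ℝ) :
    ∃ C : ℝ, 0 ≤ C ∧ ∀ L : StrongDual ℂ (FockSpace n p (a * p)),
      ∃ g : FockSpace n q (b * q), pairingMap hn hpq a b g = L ∧ ‖g‖ ≤ C * ‖L‖ := by
  obtain ⟨C, hC, h⟩ := exists_wnorm_transform_le (n := n) hpq a
  have hM := multBound_inv_coef hn q (-a) (a + b)
  rw [neg_add_cancel_left] at hM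
  obtain ⟨D, hD, h'⟩ := hM
  refine ⟨D * C, by positivity, fun L => ?_⟩
  let u : FockSpace n q (-a * q) := mkFock (transform L) (differentiable_transform L)
    ((h L).trans_lt ENNReal.ofReal_lt_top).ne
  obtain ⟨g, hg, hgn⟩ := h' u
  refine ⟨g, ?_, hgn.trans ?_⟩
  · rw [← sub_eq_zero]
    refine eq_zero_of_kerF _ fun w => ?_
    have hk : ∀ k, (pairingMap hn hpq a b g - L) (kerCompF p a k w) = 0 := by
      intro k
      have hu : homComp u k w = starRingEnd ℂ (L (kerCompF p a k w)) :=
        homComp_transform L u.smooth k w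
      have hc : (coef n (a + b) k : ℂ) ≠ 0 := by
        exact_mod_cast (coef_pos hn (a + b) k).ne'
      rw [sub_apply, pairingMap_apply, pairing_kerComp hn hpq, hg, hu, map_mul,
        Complex.conj_ofReal, Complex.conj_conj]
      push_cast
      rw [mul_inv_cancel_left₀ hc, sub_self]
    have h1 := (hasSum_kerCompF p a w).mapL (pairingMap hn hpq a b g - L)
    simp only [hk] at h1
    exact h1.unique hasSum_zero
  · have hu : ‖u‖ ≤ C * ‖L‖ := norm_le_of_wnorm_le u (by positivity) (h L)
    rw [mul_assoc]
    gcongr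

end Fock
end

theorem theorem5p5 (n : ℕ) (hn : 1 ≤ n) (p q : ℝ) [Fact (1 < p)] [Fact (1 < q)]
    (hpq : 1 / p + 1 / q = 1) (α β : ℝ) :
    (∀ (f : Fock.FockSpace n p (α * p)) (g : Fock.FockSpace n q (β * q)),
      Fock.PairingConverges (α + β) f g) ∧
    ∃ Φ : Fock.FockSpace n q (β * q) ≃ₛₗ[starRingEnd ℂ]
        StrongDual ℂ (Fock.FockSpace n p (α * p)),
      (∀ (g : Fock.FockSpace n q (β * q)) (f : Fock.FockSpace n p (α * p)),
        Φ g f = Fock.pairing (α + β) f g) ∧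
      ∃ C : ℝ, 0 < C ∧ ∀ g : Fock.FockSpace n q (β * q),
        C⁻¹ * ‖g‖ ≤ ‖Φ g‖ ∧ ‖Φ g‖ ≤ C * ‖g‖ := by
  have hpq' : p.HolderConjugate q :=
    Real.holderConjugate_iff.2 ⟨Fact.out, by simpa using hpq⟩
  refine ⟨fun f g => Fock.pairingConverges hn hpq' f g, ?_⟩
  obtain ⟨C, hC, hup⟩ := Fock.exists_norm_pairingMap_le hn hpq' α β
  obtain ⟨D, hD, hlow⟩ := Fock.exists_pairingMap_eq hn hpq' α β
  have hinj := Fock.pairingMap_injective hn hpq' α β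
  let Φ := LinearEquiv.ofBijective (Fock.pairingMap hn hpq' α β)
    ⟨hinj, fun L => ⟨(hlow L).choose, (hlow L).choose_spec.1⟩⟩
  -- The 1 guarantees positivity, since C and D are only known to be nonnegative.
  refine ⟨Φ, fun g f => rfl, max (max C D) 1, by positivity, fun g => ⟨?_, ?_⟩⟩
  -- By injectivity the preimage with controlled norm is g itself, so no open mapping argument is
  -- needed and D does not depend on g.
  · obtain ⟨g', hg', hle⟩ := hlow (Φ g)
    have : g' = g := hinj hg'
    rw [this] at hle
    rw [inv_mul_le_iff₀ (by positivity)]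
    refine hle.trans (mul_le_mul_of_nonneg_right ?_ (norm_nonneg _))
    exact (le_max_right C D).trans (le_max_left _ _)
  · refine (hup g).trans (mul_le_mul_of_nonneg_right ?_ (norm_nonneg _))
    exact (le_max_left C D).trans (le_max_left _ _)
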